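/- Let $n\ge 1$, $\mathbb R^n_+=(0,\infty)^n$, $\lambda\in(-1/2,\infty)^n$, $\eta\in\{0,1\}^n$, $K\in\mathbb N=\{0,1,2,\dots\}$ and $M\in\mathbb N^n$ with $|M|+K>0$, where $|M|=M_1+\dots+M_n$. Let $dw_\lambda^+(x)=\prod_{j}x_j^{2\lambda_j}\,dx$ on $\mathbb R^n_+$, and $B(x,r)=\{y\in\mathbb R^n_+:|y-x|<r\}$ with the Euclidean distance. For $x,y\in\mathbb R^n_+$ and $t>0$ put $$W_t^\lambda(x,y)=\frac1{(2t)^n}\exp\Big(-\frac{|x|^2+|y|^2}{4t}\Big)\prod_{j=1}^n (x_jy_j)^{-\lambda_j+1/2}I_{\lambda_j-1/2}\Big(\frac{x_jy_j}{2t}\Big),$$ where $I_\nu$ is the modified Bessel function of the first kind, and, with $(xy)^\eta=\prod_j(x_jy_j)^{\eta_j}$, $$\mathbb G_t^{\lambda,\eta,+}(x,y)=(xy)^\eta W_t^{\lambda+\eta}(x,y),\qquad \mathbb P_t^{\lambda,\eta,+}(x,y)=\int_0^\infty \mathbb G^{\lambda,\eta,+}_{t^2/(4u)}(x,y)\frac{e^{-u}\,du}{\sqrt{\pi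 u}}.$$ Let $\delta_j=\partial_{x_j}$, $\delta_j^*=\partial_{x_j}+\frac{2\lambda_j}{x_j}$, and let $\delta_{\eta,M}=\delta_{1,\eta_1,M_1}\circ\dots\circ\delta_{n,\eta_n,M_n}$, where $\delta_{j,0,m}$ equals $(\delta_j^*\delta_j)^{m/2}$ for $m$ even and $\delta_j(\delta_j^*\delta_j)^{(m-1)/2}$ for $m$ odd, and $\delta_{j,1,m}$ equals $(\delta_j\delta_j^*)^{m/2}$ for $m$ even and $\delta_j^*(\delta_j\delta_j^*)^{(m-1)/2}$ for $m$ odd. For $x\in\mathbb R^n_+$, $t>0$ and $z\in\mathbb R^n$ with $x+z\in\mathbb R^n_+$, let $$\Xi_\lambda(x,z,t)=\prod_{j=1}^n\frac{(x_j+z_j)^{2\lambda_j}}{V^{\lambda_j,+}_{\sqrt t}(x_j)},\qquad V^{\lambda_j,+}_{t}(x_j)=\int_{(x_j-t,x_j+t)\cap(0,\infty)}s^{2\lambda_j}\,ds.$$ Let $\Gamma=\{(z,t)\in\mathbb R^n\times(0,\infty):|z|<t\}$, $\mathbb B=L^2(\Gamma,t^{2K+2|M|-1}dz\,dt)$, and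 let $$\mathcal S(x,y)=\mathcal S^{\lambda,\eta,+}_{P,K,M}(x,y)=\Big\{\partial_t^K\delta_{\eta,M,\mathbf x}\mathbb P_t^{\lambda,\eta,+}(\mathbf x,y)\big|_{\mathbf x=x+z}\sqrt{\Xi_\lambda(x,z,t^2)}\,\chi_{\{x+z\in\mathbb R^n_+\}}\Big\}_{(z,t)\in\Gamma}$$ be the kernel of the Poisson-Bessel-type Lusin area integral. **Proposition.** The kernel $\mathcal S$ takes values in $\mathbb B$ for $x\neq y$ in $\mathbb R^n_+$, and satisfies the standard estimates for the space of homogeneous type $(\mathbb R^n_+,dw_\lambda^+,|\cdot|)$. That is, there is a constant $C$, independent of $x,x',y,y'\in\mathbb R^n_+$, such that $$\|\mathcal S(x,y)\|_{\mathbb B}\le \frac{C}{w_\lambda^+(B(x,|x-y|))},\qquad x\ne y,$$ and, for some $\gamma>0$ and $C$ independent of $x,x',y,y'$, $$\|\mathcal S(x,y)-\mathcal S(x',y)\|_{\mathbb B}\le C\Big(\frac{|x-x'|}{|x-y|}\Big)^{\gamma}\frac{1}{w_\lambda^+(B(x,|x-y|))},\qquad |x-y|>2|x-x'|,$$ $$\|\mathcal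 S(x,y)-\mathcal S(x,y')\|_{\mathbb B}\le C\Big(\frac{|y-y'|}{|x-y|}\Big)^{\gamma}\frac{1}{w_\lambda^+(B(x,|x-y|))},\qquad |x-y|>2|y-y'|.$$ More precisely, the last two estimates hold for every $\gamma\in(0,1/2]$ such that $\gamma<\min_{1\le k\le n}(\lambda_k+1/2)$, with $C$ allowed to depend on $\gamma$. -/

import Mathlib

open MeasureTheory Set
open scoped ENNReal

noncomputable section

namespace DunklBessel

/-- The open positive orthant `(0,∞)^n` of Euclidean `n`-space. -/
def posOrthant (n : ℕ) : Set (EuclideanSpace ℝ (Fin n)) := {x | ∀ j, 0 < x j}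

/-- The measure `dw⁺(x) = ∏ x_j ^ (2 lam_j) dx` on the positive orthant
(extended by zero to the whole space). -/
def wPlus {n : ℕ} (lam : Fin n → ℝ) : Measure (EuclideanSpace ℝ (Fin n)) :=
  (volume.restrict (posOrthant n)).withDensity
    fun x => ENNReal.ofReal (∏ j, x j ^ (2 * lam j))

/-- Balls of the orthant, for the Euclidean distance. -/
def posBall {n : ℕ} (x : EuclideanSpace ℝ (Fin n)) (r : ℝ) : Set (EuclideanSpace ℝ (Fin n)) :=
  {y | y ∈ posOrthant n ∧ dist y x < r}

/-- The one-dimensional measure `s ^ (2 l) ds` on `(0,∞)`. -/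
def wPlusOne (l : ℝ) : Measure ℝ :=
  (volume.restrict (Ioi 0)).withDensity fun s => ENNReal.ofReal (s ^ (2 * l))

/-- `V_t(s)`, the `wPlusOne l` measure of `(s - t, s + t) ∩ (0,∞)`. -/
def vPlusOne (l t s : ℝ) : ℝ := (wPlusOne l).real (Ioo (s - t) (s + t) ∩ Ioi 0)

/-- `Ξ(x,z,t) = ∏ (x_j + z_j) ^ (2 lam_j) / V_{√t}(x_j)`, used for `x` and `x + z` in the orthant. -/
def Xi {n : ℕ} (lam : Fin n → ℝ) (x z : EuclideanSpace ℝ (Fin n)) (t : ℝ) : ℝ :=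
  ∏ j, (x j + z j) ^ (2 * lam j) / vPlusOne (lam j) (Real.sqrt t) (x j)

/-- The modified Bessel function of the first kind, of order `ν > -1`, at `z > 0`. -/
def besselI (ν z : ℝ) : ℝ :=
  ∑' m : ℕ, (z / 2) ^ (ν + 2 * (m : ℝ)) / ((m.factorial : ℝ) * Real.Gamma ((m : ℝ) + ν + 1))

/-- The heat-Bessel kernel `W_t(x,y)`, for `x`, `y` in the orthant and `t > 0`. -/
def heatBessel {n : ℕ} (lam : Fin n → ℝ) (t : ℝ) (x y : EuclideanSpace ℝ (Fin n)) : ℝ :=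
  1 / (2 * t) ^ n * Real.exp (-(1 / (4 * t)) * (‖x‖ ^ 2 + ‖y‖ ^ 2)) *
    ∏ j, (x j * y j) ^ (-lam j + 1 / 2) * besselI (lam j - 1 / 2) (x j * y j / (2 * t))

/-- The Bessel-type heat kernel `(xy)^η W_t^{lam + η}(x,y)`. -/
def heatKer {n : ℕ} (lam : Fin n → ℝ) (η : Fin n → Fin 2) (t : ℝ)
    (x y : EuclideanSpace ℝ (Fin n)) : ℝ :=
  (∏ j, (x j * y j) ^ (η j : ℕ)) * heatBessel (fun j => lam j + ((η j : ℕ) : ℝ)) t x y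

/-- The Poisson-Bessel-type kernel, subordinated to the heat kernel. -/
def poissonKer {n : ℕ} (lam : Fin n → ℝ) (η : Fin n → Fin 2) (t : ℝ)
    (x y : EuclideanSpace ℝ (Fin n)) : ℝ :=
  ∫ u in Ioi (0 : ℝ),
    heatKer lam η (t ^ 2 / (4 * u)) x y * (Real.exp (-u) / Real.sqrt (Real.pi * u))

/-- `δ_j = ∂ / ∂x_j`. -/
def deltaJ {n : ℕ} (j : Fin n) (f : EuclideanSpace ℝ (Fin n) → ℝ) :
    EuclideanSpace ℝ (Fin n) → ℝ :=
  fun x => lineDeriv ℝ f x (EuclideanSpace.single j (1 : ℝ))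

/-- `δ_j^* = ∂ / ∂x_j + 2 lam_j / x_j`. -/
def deltaStarJ {n : ℕ} (lam : Fin n → ℝ) (j : Fin n) (f : EuclideanSpace ℝ (Fin n) → ℝ) :
    EuclideanSpace ℝ (Fin n) → ℝ :=
  fun x => lineDeriv ℝ f x (EuclideanSpace.single j (1 : ℝ)) + 2 * lam j / x j * f x

/-- The derivative `δ_{j, e, m}` of order `m` in the `j`th variable, of parity type `e`:
for `e = 0` it is `(δ_j^* δ_j)^(m/2)` or `δ_j (δ_j^* δ_j)^((m-1)/2)`,
for `e = 1` it is `(δ_j δ_j^*)^(m/2)` or `δ_j^* (δ_j δ_j^*)^((m-1)/2)`,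
according to whether `m` is even or odd. -/
def deltaOne {n : ℕ} (lam : Fin n → ℝ) (j : Fin n) (e : Fin 2) (m : ℕ)
    (f : EuclideanSpace ℝ (Fin n) → ℝ) : EuclideanSpace ℝ (Fin n) → ℝ :=
  if e = 0 then
    if Even m then (fun g => deltaStarJ lam j (deltaJ j g))^[m / 2] f
    else deltaJ j ((fun g => deltaStarJ lam j (deltaJ j g))^[(m - 1) / 2] f)
  else
    if Even m then (fun g => deltaJ j (deltaStarJ lam j g))^[m / 2] f
    else deltaStarJ lam j ((fun g => deltaJ j (deltaStarJ lam j g))^[(m - 1) / 2] f)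

/-- `δ_{η, M} = δ_{1, η_1, M_1} ∘ ⋯ ∘ δ_{n, η_n, M_n}`. -/
def deltaOp {n : ℕ} (lam : Fin n → ℝ) (η : Fin n → Fin 2) (M : Fin n → ℕ)
    (f : EuclideanSpace ℝ (Fin n) → ℝ) : EuclideanSpace ℝ (Fin n) → ℝ :=
  (List.finRange n).foldr (fun j g => deltaOne lam j (η j) (M j) g) f

/-- The cone `Γ = {(z,t) : t > 0, |z| < t}`. -/
def cone (n : ℕ) : Set (EuclideanSpace ℝ (Fin n) × ℝ) := {p | 0 < p.2 ∧ ‖p.1‖ < p.2}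

/-- The measure `t ^ (2K + 2|M| - 1) dz dt` on the cone. -/
def coneMeasure {n : ℕ} (K : ℕ) (M : Fin n → ℕ) : Measure (EuclideanSpace ℝ (Fin n) × ℝ) :=
  (volume.restrict (cone n)).withDensity
    fun p => ENNReal.ofReal (p.2 ^ (2 * (K : ℝ) + 2 * ((∑ j, M j : ℕ) : ℝ) - 1))

/-- The Banach space `L²(Γ, t ^ (2K + 2|M| - 1) dz dt)`. -/
abbrev coneL2 {n : ℕ} (K : ℕ) (M : Fin n → ℕ) : Type := Lp ℂ 2 (coneMeasure K M)

/-- The function of `p = (z,t)` which is the value at `(x,y)` of the kernel of the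
Poisson-Bessel-type Lusin area integral. -/
def lusinKer {n : ℕ} (lam : Fin n → ℝ) (η : Fin n → Fin 2) (K : ℕ) (M : Fin n → ℕ)
    (x y : EuclideanSpace ℝ (Fin n)) (p : EuclideanSpace ℝ (Fin n) × ℝ) : ℝ :=
  iteratedDeriv K (fun t => deltaOp lam η M (fun x' => poissonKer lam η t x' y) (x + p.1)) p.2 *
    Real.sqrt (Xi lam x p.1 (p.2 ^ 2)) * (posOrthant n).indicator (fun _ => 1) (x + p.1)

/-- The standard estimates, with smoothness exponent `γ`, for a kernel defined off the diagonal
of the orthant and valued in the Banach space `B`, in the sense of the space of homogeneous type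
given by the orthant, the measure `wPlus lam` and the Euclidean distance. -/
structure StandardEstimates {n : ℕ} {B : Type*} [NormedAddCommGroup B] (lam : Fin n → ℝ) (γ : ℝ)
    (S : EuclideanSpace ℝ (Fin n) → EuclideanSpace ℝ (Fin n) → B) : Prop where
  growth : ∃ C : ℝ, 0 < C ∧ ∀ x ∈ posOrthant n, ∀ y ∈ posOrthant n, x ≠ y →
    ‖S x y‖ ≤ C * (1 / (wPlus lam).real (posBall x (dist x y)))
  smooth_left : ∃ C : ℝ, 0 < C ∧ ∀ x ∈ posOrthant n, ∀ x' ∈ posOrthant n, ∀ y ∈ posOrthant n,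
    2 * dist x x' < dist x y →
    ‖S x y - S x' y‖ ≤
      C * ((dist x x' / dist x y) ^ γ * (1 / (wPlus lam).real (posBall x (dist x y))))
  smooth_right : ∃ C : ℝ, 0 < C ∧ ∀ x ∈ posOrthant n, ∀ y ∈ posOrthant n, ∀ y' ∈ posOrthant n,
    2 * dist y y' < dist x y →
    ‖S x y - S x y'‖ ≤
      C * ((dist y y' / dist x y) ^ γ * (1 / (wPlus lam).real (posBall x (dist x y))))

end DunklBessel

end

open DunklBessel

/-! The measure of a ball of centre x and radius r is compared with `bulk lam x r`, the product of
the numbers r (r + x_j)^(2 lam_j). The proof is a pointwise bound of the kernel in terms of `bulk`,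
followed by an integration over the cone.

The heat kernel is a product over the coordinates, and each factor is a multiple of s^(-l-1/2)
exp(-(x-y)^2/4s) h(xy/2s) with h = `besselH l`. The symbol estimates |h^(i)(z)| ≤ C (1+z)^(-l-i) of
`iteratedDeriv_besselH_le` are drawn from the differential equation of h, without asymptotic
expansions. They give Gaussian bounds for a class of functions that is stable under derivatives in
s, x, y (`HeatClass`, `HeatClass.le`).

The operators δ* contain the singular coefficient 2l/x, but it disappears in the alternating
products that make up δ_{η,M}. If K is the even kernel and B the odd one, then δ*δ K = ∂_s K, δ* B =
-∂_y K and ∂_x ∂_y K = -∂_s B. So a derivative of order m lies in the class with homogeneity m/2,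
and for the same parameter l when the kernel is odd (`heatClass_heatD`).

Let N = K + |M|. Subordination and doubling bound the differentiated Poisson kernel by C r^(-N) /
bulk(x,r) whenever r ≤ t + |x-y| (`subKer_le`), and a further derivative in x or y costs 1/r
(`subKer_sub_le`).

On |z| < t the function Ξ(x,z,t^2), cut off to the orthant, is a product of one-dimensional
probability densities on (-t,t) (`xiDens`). With D = |x-y| the size estimate becomes an integral in
t of t^(2N-1) (t+D)^(-2N) bulk(x,t+D)^(-2). It converges at infinity by reverse doubling, and N ≥ 1
takes care of t near zero (`eLpNorm_coneMeasure_le`).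

Smoothness in y is the derivative bound. For smoothness in x the difference splits into a difference
of kernels and a difference of the roots of Ξ. Since (√a - √b)^2 ≤ |a - b|, the second part is
governed by the L¹ modulus of continuity of the normalised densities under translation. That modulus
is (|x-x'|/t)^(2γ) as soon as 2γ ≤ 1 and 2γ ≤ 2 lam_k + 1 (`lintegral_abs_xiDens_sub_le`), whence
the range of γ. -/

noncomputable section

namespace DunklBessel

open Filter Topology
open scoped ContDiff

/-! ### Series of the modified Bessel function, and symbol estimates for its scaled form. -/

/-- The Taylor coefficients of `besselE`. -/
def besselCoeff (l : ℝ) (m : ℕ) : ℝ :=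
  2 ^ (-(l - 1 / 2)) * (1 / 4) ^ m / ((m.factorial : ℝ) * Real.Gamma ((m : ℝ) + (l + 1 / 2)))

/-- The entire function with `I_{l - 1/2}(z) = z ^ (l - 1/2) * besselE l (z ^ 2)`. -/
def besselE (l w : ℝ) : ℝ := ∑' m : ℕ, besselCoeff l m * w ^ m

/-- The Gamma function is not monotone near zero, hence a minimum over `m = 0` and `m = 1`; from
there on each step multiplies by a factor at least one. -/
lemma exists_pos_le_gamma_natCast_add {a : ℝ} (ha : 0 < a) :
    ∃ c : ℝ, 0 < c ∧ ∀ m : ℕ, c ≤ Real.Gamma ((m : ℝ) + a) := by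
  have h0 := Real.Gamma_pos_of_pos ha
  have h1 : 0 < Real.Gamma (1 + a) := Real.Gamma_pos_of_pos (by linarith)
  refine ⟨min (Real.Gamma a) (Real.Gamma (1 + a)), lt_min h0 h1, fun m => ?_⟩
  have key : ∀ k : ℕ, Real.Gamma (1 + a) ≤ Real.Gamma (((k + 1 : ℕ) : ℝ) + a) := by
    intro k
    induction k with
    | zero => simp
    | succ k ih =>
      have hp : (0 : ℝ) < ((k + 1 : ℕ) : ℝ) + a := by positivity
      have e : (((k + 1 + 1 : ℕ) : ℝ) + a) = (((k + 1 : ℕ) : ℝ) + a) + 1 := by push_cast; ring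
      rw [e, Real.Gamma_add_one hp.ne']
      have h2 : (1 : ℝ) ≤ ((k + 1 : ℕ) : ℝ) + a := by push_cast; linarith [k.cast_nonneg (α := ℝ)]
      nlinarith [Real.Gamma_pos_of_pos hp]
  cases m with
  | zero => simp
  | succ k => exact (min_le_right _ _).trans (key k)

lemma summable_besselCoeff_mul_pow {l : ℝ} (hl : -(1 / 2) < l) (w : ℝ) :
    Summable fun m : ℕ => besselCoeff l m * w ^ m := by
  obtain ⟨c, hc, hcm⟩ := exists_pos_le_gamma_natCast_add (a := l + 1 / 2) (by linarith)
  have hs := (Real.summable_pow_div_factorial (|w| / 4)).mul_left (2 ^ (-(l - 1 / 2)) / c)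
  refine Summable.of_norm_bounded hs fun m => ?_
  have hG := hc.trans_le (hcm m)
  have hf : (0 : ℝ) < m.factorial := by exact_mod_cast m.factorial_pos
  have h2 : (0 : ℝ) < 2 ^ (-(l - 1 / 2)) := by positivity
  rw [besselCoeff, norm_mul, norm_pow, Real.norm_eq_abs, Real.norm_eq_abs,
    abs_of_pos (by positivity)]
  have e : (2 : ℝ) ^ (-(l - 1 / 2)) / c * ((|w| / 4) ^ m / (m.factorial : ℝ)) =
      2 ^ (-(l - 1 / 2)) * (1 / 4) ^ m * |w| ^ m / ((m.factorial : ℝ) * c) := by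
    rw [div_pow, div_pow, one_pow]; field_simp
  rw [e, div_mul_eq_mul_div]
  gcongr
  exact hcm m

/-- The coefficient form of the rule that differentiating `besselE l` gives half of `besselE (l +
1)`. -/
lemma besselCoeff_succ {l : ℝ} (hl : -(1 / 2) < l) (m : ℕ) :
    besselCoeff l (m + 1) * ((m + 1 : ℕ) : ℝ) = besselCoeff (l + 1) m / 2 := by
  have h1 : ((m + 1 : ℕ) : ℝ) + (l + 1 / 2) = (m : ℝ) + (l + 1 + 1 / 2) := by push_cast; ring
  have hm : (0 : ℝ) ≤ m := m.cast_nonneg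
  have hG : Real.Gamma ((m : ℝ) + (l + 1 + 1 / 2)) ≠ 0 :=
    (Real.Gamma_pos_of_pos (by linarith)).ne'
  have hf : (m.factorial : ℝ) ≠ 0 := by exact_mod_cast m.factorial_ne_zero
  have h2 : (2 : ℝ) ^ (-(l + 1 - 1 / 2)) = 2 ^ (-(l - 1 / 2)) / 2 := by
    rw [show -(l + 1 - 1 / 2) = -(l - 1 / 2) - 1 by ring, Real.rpow_sub_one (by norm_num)]
  have hm1 : (m : ℝ) + 1 ≠ 0 := by positivity
  simp only [besselCoeff, h1, h2, Nat.factorial_succ, pow_succ]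
  push_cast
  field_simp
  ring

lemma besselCoeff_zero_rec {l : ℝ} (hl : -(1 / 2) < l) :
    besselCoeff l 0 = (2 * l + 1) * besselCoeff (l + 1) 0 := by
  have h2 : (2 : ℝ) ^ (-(l + 1 - 1 / 2)) = 2 ^ (-(l - 1 / 2)) / 2 := by
    rw [show -(l + 1 - 1 / 2) = -(l - 1 / 2) - 1 by ring, Real.rpow_sub_one (by norm_num)]
  have hG : Real.Gamma (l + 1 / 2) ≠ 0 := (Real.Gamma_pos_of_pos (by linarith)).ne'
  have h3 : Real.Gamma (l + 1 + 1 / 2) = (l + 1 / 2) * Real.Gamma (l + 1 / 2) := by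
    rw [← Real.Gamma_add_one (by linarith)]; ring_nf
  have h4 : l * 2 + 1 ≠ 0 := by linarith
  simp only [besselCoeff, h2, Nat.cast_zero, zero_add, h3]
  have h5 : l + 1 / 2 ≠ 0 := by linarith
  field_simp

lemma besselCoeff_succ_rec {l : ℝ} (hl : -(1 / 2) < l) (m : ℕ) :
    besselCoeff l (m + 1) = (2 * l + 1) * besselCoeff (l + 1) (m + 1) + besselCoeff (l + 2) m := by
  have hm : (0 : ℝ) ≤ m := m.cast_nonneg
  have hf : (m.factorial : ℝ) ≠ 0 := by exact_mod_cast m.factorial_ne_zero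
  have h2 : (2 : ℝ) ^ (-(l + 1 - 1 / 2)) = 2 ^ (-(l - 1 / 2)) / 2 := by
    rw [show -(l + 1 - 1 / 2) = -(l - 1 / 2) - 1 by ring, Real.rpow_sub_one (by norm_num)]
  have h3 : (2 : ℝ) ^ (-(l + 2 - 1 / 2)) = 2 ^ (-(l - 1 / 2)) / 4 := by
    rw [show -(l + 2 - 1 / 2) = -(l - 1 / 2) - (2 : ℕ) by push_cast; ring,
      Real.rpow_sub_natCast (by norm_num)]
    norm_num
  set G := Real.Gamma ((m : ℝ) + (l + 1 + 1 / 2)) with hGdef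
  have hG : G ≠ 0 := (Real.Gamma_pos_of_pos (by linarith)).ne'
  have h1 : Real.Gamma (((m + 1 : ℕ) : ℝ) + (l + 1 / 2)) = G := by
    rw [hGdef]; push_cast; ring_nf
  have h5 : (m : ℝ) + (l + 1 + 1 / 2) ≠ 0 := by linarith
  have h4 : Real.Gamma (((m + 1 : ℕ) : ℝ) + (l + 1 + 1 / 2)) = (m + (l + 1 + 1 / 2)) * G := by
    rw [hGdef, ← Real.Gamma_add_one h5]; push_cast; ring_nf
  have h6 : Real.Gamma ((m : ℝ) + (l + 2 + 1 / 2)) = (m + (l + 1 + 1 / 2)) * G := by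
    rw [hGdef, ← Real.Gamma_add_one h5]; ring_nf
  have hm1 : (m : ℝ) + 1 ≠ 0 := by positivity
  simp only [besselCoeff, h1, h2, h3, h4, h6, Nat.factorial_succ, pow_succ]
  rw [show 2 * l + 1 = 2 * ((m : ℝ) + (l + 1 + 1 / 2)) - 2 * (m + 1) by ring]
  generalize (m : ℝ) + (l + 1 + 1 / 2) = D at h5 ⊢
  push_cast
  field_simp
  ring

/-- This is the classical recurrence I_{ν-1} - I_{ν+1} = (2ν/z) I_ν, with ν = l + 1/2 and w = z^2.
-/
lemma besselE_rec {l : ℝ} (hl : -(1 / 2) < l) (w : ℝ) :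
    besselE l w = (2 * l + 1) * besselE (l + 1) w + w * besselE (l + 2) w := by
  have s0 := summable_besselCoeff_mul_pow hl w
  have s1 := summable_besselCoeff_mul_pow (l := l + 1) (by linarith) w
  have s2 := summable_besselCoeff_mul_pow (l := l + 2) (by linarith) w
  have s1' := (summable_nat_add_iff 1).2 s1
  rw [besselE, s0.tsum_eq_zero_add, besselE, s1.tsum_eq_zero_add, besselE, mul_add,
    ← tsum_mul_left, ← tsum_mul_left, add_assoc, ← (s1'.mul_left _).tsum_add (s2.mul_left w),
    besselCoeff_zero_rec hl]
  congr 1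
  · ring
  · refine tsum_congr fun m => ?_
    rw [besselCoeff_succ_rec hl]; ring

lemma hasDerivAt_besselE {l : ℝ} (hl : -(1 / 2) < l) (w : ℝ) :
    HasDerivAt (besselE l) (besselE (l + 1) w / 2) w := by
  set R := |w| + 1 with hR
  have hR0 : 0 < R := by positivity
  -- A majorant of the differentiated series on the ball of radius R. Shifted by one index it is
  -- half of the series of absolute values of `besselE (l + 1)` at R.
  have hs : Summable fun m : ℕ => |besselCoeff l m| * ((m : ℝ) * R ^ (m - 1)) := by
    refine (summable_nat_add_iff 1).1 ?_
    have h := ((summable_besselCoeff_mul_pow (l := l + 1) (by linarith) R).div_const 2).abs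
    refine h.congr fun m => ?_
    have h2 := besselCoeff_succ hl m
    rw [mul_div_right_comm, ← h2, abs_mul, abs_mul, abs_of_pos (pow_pos hR0 m), Nat.abs_cast]
    simp only [Nat.add_sub_cancel]
    ring
  have key := hasDerivAt_tsum_of_isPreconnected (𝕜 := ℝ) (F := ℝ)
    (g := fun m y => besselCoeff l m * y ^ m)
    (g' := fun m y => besselCoeff l m * ((m : ℝ) * y ^ (m - 1)))
    (t := Metric.ball 0 R) (y := w) (y₀ := 0) hs Metric.isOpen_ball
    (convex_ball (0 : ℝ) R).isPreconnected
    (fun m y _ => (hasDerivAt_pow m y).const_mul _) (fun m y hy => ?_) (by simpa using hR0)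
    (summable_besselCoeff_mul_pow hl 0) (by simp [hR])
  · have e : ∑' m : ℕ, besselCoeff l m * ((m : ℝ) * w ^ (m - 1)) = besselE (l + 1) w / 2 := by
      have hs' : Summable fun m : ℕ => besselCoeff l m * ((m : ℝ) * w ^ (m - 1)) := by
        refine Summable.of_norm_bounded hs fun m => ?_
        rw [norm_mul, norm_mul, norm_pow, Real.norm_natCast, Real.norm_eq_abs, Real.norm_eq_abs]
        gcongr
        linarith
      rw [hs'.tsum_eq_zero_add, besselE, ← tsum_div_const]
      simp only [Nat.cast_zero, zero_mul, mul_zero, zero_add, Nat.add_sub_cancel]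
      refine tsum_congr fun m => ?_
      rw [← mul_assoc, besselCoeff_succ hl]; ring
    rw [← e]
    exact key
  · rw [norm_mul, norm_mul, norm_pow, Real.norm_natCast, Real.norm_eq_abs, Real.norm_eq_abs]
    have hy' : |y| ≤ R := by
      have := mem_ball_zero_iff.1 hy
      exact this.le
    gcongr

lemma contDiff_besselE {l : ℝ} (hl : -(1 / 2) < l) : ContDiff ℝ ∞ (besselE l) := by
  refine contDiff_infty.2 fun k => ?_
  induction k generalizing l with
  | zero =>
    exact contDiff_zero.2 (Differentiable.continuous (𝕜 := ℝ)
      fun w => (hasDerivAt_besselE hl w).differentiableAt)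
  | succ k ih =>
    have hd : deriv (besselE l) = fun w => besselE (l + 1) w / 2 :=
      funext fun w => (hasDerivAt_besselE hl w).deriv
    push_cast
    refine contDiff_succ_iff_deriv.2 ⟨fun w => (hasDerivAt_besselE hl w).differentiableAt,
      by simp, ?_⟩
    rw [hd]
    exact (ih (l := l + 1) (by linarith)).div_const 2

/-- The exponentially scaled Bessel function `exp (-z) * z ^ (-(l - 1/2)) * I_{l - 1/2}(z)`. -/
def besselH (l z : ℝ) : ℝ := Real.exp (-z) * besselE l (z ^ 2)

lemma contDiff_besselH {l : ℝ} (hl : -(1 / 2) < l) : ContDiff ℝ ∞ (besselH l) :=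
  (Real.contDiff_exp.comp contDiff_neg).mul ((contDiff_besselE hl).comp (contDiff_id.pow 2))

lemma hasDerivAt_besselE_sq {l : ℝ} (hl : -(1 / 2) < l) (z : ℝ) :
    HasDerivAt (fun z => besselE l (z ^ 2)) (z * besselE (l + 1) (z ^ 2)) z := by
  have h := (hasDerivAt_besselE hl (z ^ 2)).comp z (hasDerivAt_pow 2 z)
  refine h.congr_deriv ?_
  simp; ring

lemma hasDerivAt_exp_neg (z : ℝ) : HasDerivAt (fun z : ℝ => Real.exp (-z)) (-Real.exp (-z)) z := by
  simpa using (hasDerivAt_neg z).exp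

lemma hasDerivAt_besselH {l : ℝ} (hl : -(1 / 2) < l) (z : ℝ) :
    HasDerivAt (besselH l) (z * besselH (l + 1) z - besselH l z) z := by
  refine ((hasDerivAt_exp_neg z).mul (hasDerivAt_besselE_sq hl z)).congr_deriv ?_
  simp only [besselH]; ring

lemma deriv_besselH {l : ℝ} (hl : -(1 / 2) < l) (z : ℝ) :
    deriv (besselH l) z = z * besselH (l + 1) z - besselH l z :=
  (hasDerivAt_besselH hl z).deriv

lemma hasDerivAt_iteratedDeriv_besselH {l : ℝ} (hl : -(1 / 2) < l) (i : ℕ) (z : ℝ) :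
    HasDerivAt (iteratedDeriv i (besselH l)) (iteratedDeriv (i + 1) (besselH l) z) z := by
  rw [iteratedDeriv_succ]
  exact ((contDiff_besselH hl).differentiable_iteratedDeriv i
    (WithTop.coe_lt_coe.2 (ENat.natCast_lt_top i)) z).hasDerivAt

/-- For `i = 0` this is Bessel's equation rewritten for the scaled function, a consequence of
`besselE_rec`; differentiating it raises `i`. It gives both the decay of the derivatives and the
identities between the heat kernels. -/
lemma besselH_ode {l : ℝ} (hl : -(1 / 2) < l) (i : ℕ) (z : ℝ) :
    z * iteratedDeriv (i + 2) (besselH l) z +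
      (2 * l + i + 2 * z) * iteratedDeriv (i + 1) (besselH l) z +
      2 * (l + i) * iteratedDeriv i (besselH l) z = 0 := by
  induction i generalizing z with
  | zero =>
    have h1 : iteratedDeriv 1 (besselH l) = fun z => z * besselH (l + 1) z - besselH l z := by
      rw [iteratedDeriv_one]; exact funext fun z => deriv_besselH hl z
    have h2 : iteratedDeriv 2 (besselH l) z =
        besselH (l + 1) z + z * (z * besselH (l + 2) z - besselH (l + 1) z) -
          (z * besselH (l + 1) z - besselH l z) := by
      rw [iteratedDeriv_succ, h1]
      have h := ((hasDerivAt_id z).mul (hasDerivAt_besselH (l := l + 1) (by linarith) z)).sub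
        (hasDerivAt_besselH hl z)
      refine (HasDerivAt.deriv (h.congr_deriv ?_))
      rw [show l + 1 + 1 = l + 2 by ring]; simp
    have h3 : besselH l z = (2 * l + 1) * besselH (l + 1) z + z ^ 2 * besselH (l + 2) z := by
      simp only [besselH]; rw [besselE_rec hl]; ring
    simp only [zero_add, Nat.cast_zero, iteratedDeriv_zero, h1, h2]
    linear_combination (-z) * h3
  | succ i ih =>
    have hz := hasDerivAt_id z
    have d := ((hz.mul (hasDerivAt_iteratedDeriv_besselH hl (i + 2) z)).add
      (((hz.const_mul 2).const_add (2 * l + i)).mul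
        (hasDerivAt_iteratedDeriv_besselH hl (i + 1) z))).add
      ((hasDerivAt_iteratedDeriv_besselH hl i z).const_mul (2 * (l + i)))
    have e := d.unique ((hasDerivAt_const z (0 : ℝ)).congr_of_eventuallyEq
      (Eventually.of_forall fun z => by simpa using ih z))
    simp only [id] at e
    push_cast
    linear_combination e

/-- The comparison is assumed in both directions because the exponent may have either sign. -/
lemma rpow_le_of_le_mul {a b κ : ℝ} (ha : 0 < a) (hb : 0 < b) (hκ : 1 ≤ κ) (hab : a ≤ κ * b)
    (hba : b ≤ κ * a) (p : ℝ) : a ^ p ≤ κ ^ |p| * b ^ p := by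
  have hκ0 : 0 < κ := by linarith
  rcases le_total 0 p with hp | hp
  · rw [abs_of_nonneg hp, ← Real.mul_rpow hκ0.le hb.le]
    exact Real.rpow_le_rpow ha.le hab hp
  · rw [abs_of_nonpos hp, Real.rpow_neg hκ0.le, ← Real.inv_rpow hκ0.le,
      ← Real.mul_rpow (by positivity) hb.le]
    refine Real.rpow_le_rpow_of_nonpos (by positivity) ?_ hp
    rw [inv_mul_le_iff₀ hκ0]; exact hba

/-- An energy argument. The squares of z^l e^(-z) E and of z^l e^(-z) E' are added, and the weight
exp(l^2/z), bounded on [1,∞), absorbs the integrable error l^2/z^2, so that the total is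
nonincreasing. -/
lemma besselH_le_of_one_le {l : ℝ} (hl : -(1 / 2) < l) :
    ∃ C : ℝ, 0 < C ∧ ∀ z, 1 ≤ z → |besselH l z| ≤ C * z ^ (-l) := by
  set E := fun z => besselE l (z ^ 2) with hE
  set E1 := fun z => z * besselE (l + 1) (z ^ 2) with hE1
  set V := fun z : ℝ => (z ^ l * Real.exp (-z) * E z) ^ 2 + (z ^ l * Real.exp (-z) * E1 z) ^ 2
    with hV
  set W := fun z : ℝ => V z * Real.exp (l ^ 2 / z) with hW
  have hp : ∀ z : ℝ, 0 < z → HasDerivAt (fun z => z ^ l * Real.exp (-z))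
      (z ^ l * Real.exp (-z) * (l / z - 1)) z := by
    intro z hz
    refine ((Real.hasDerivAt_rpow_const (p := l) (Or.inl hz.ne')).mul
      (hasDerivAt_exp_neg z)).congr_deriv ?_
    rw [Real.rpow_sub_one hz.ne']; ring
  have hdE : ∀ z, HasDerivAt E (E1 z) z := fun z => hasDerivAt_besselE_sq hl z
  have hdE1 : ∀ z, 0 < z → HasDerivAt E1 (E z - 2 * l / z * E1 z) z := by
    intro z hz
    refine ((hasDerivAt_id z).mul
      (hasDerivAt_besselE_sq (l := l + 1) (by linarith) z)).congr_deriv ?_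
    simp only [hE, hE1]
    rw [besselE_rec hl (z ^ 2), show l + 1 + 1 = l + 2 by ring]
    simp only [id]
    field_simp
    ring
  have hdW : ∀ z, 0 < z → HasDerivAt W
      ((2 * (z ^ l * Real.exp (-z)) ^ 2 * ((l / z) * (E z ^ 2 - E1 z ^ 2) - (E z - E1 z) ^ 2)
        - l ^ 2 / z ^ 2 * V z) * Real.exp (l ^ 2 / z)) z := by
    intro z hz
    have h1 := (((hp z hz).mul (hdE z)).pow 2).add (((hp z hz).mul (hdE1 z hz)).pow 2)
    have h2 : HasDerivAt (fun z : ℝ => Real.exp (l ^ 2 / z))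
        (Real.exp (l ^ 2 / z) * (-(l ^ 2 / z ^ 2))) z := by
      refine HasDerivAt.exp ?_
      refine ((hasDerivAt_inv hz.ne').const_mul (l ^ 2)).congr_deriv ?_
      ring
    refine (h1.mul h2).congr_deriv ?_
    simp only [hV, Pi.mul_apply, Pi.pow_apply, Pi.add_apply]
    field_simp
    ring
  have hanti : AntitoneOn W (Ici 1) := by
    refine antitoneOn_of_deriv_nonpos (convex_Ici 1) ?_ ?_ ?_
    · exact fun z hz => (hdW z (by linarith [mem_Ici.1 hz])).continuousAt.continuousWithinAt
    · rw [interior_Ici]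
      exact fun z hz => (hdW z (by linarith [mem_Ioi.1 hz])).differentiableAt.differentiableWithinAt
    · rw [interior_Ici]
      intro z hz
      have hz0 : 0 < z := by linarith [mem_Ioi.1 hz]
      rw [(hdW z hz0).deriv]
      refine mul_nonpos_of_nonpos_of_nonneg ?_ (Real.exp_pos _).le
      -- Completing the square in E - E1 and E + E1: the weight contributes exactly the term in (E +
      -- E1)^2 that is left over.
      have e : 2 * (z ^ l * Real.exp (-z)) ^ 2 *
          ((l / z) * (E z ^ 2 - E1 z ^ 2) - (E z - E1 z) ^ 2) - l ^ 2 / z ^ 2 * V z =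
          -(z ^ l * Real.exp (-z)) ^ 2 * (2 * ((E z - E1 z) - l / z * (E z + E1 z) / 2) ^ 2 +
            (l / z) ^ 2 * (E z - E1 z) ^ 2 / 2) := by
        simp only [hV]; ring
      rw [e]
      have : 0 ≤ (z ^ l * Real.exp (-z)) ^ 2 * (2 * ((E z - E1 z) - l / z * (E z + E1 z) / 2) ^ 2 +
            (l / z) ^ 2 * (E z - E1 z) ^ 2 / 2) := by positivity
      linarith
  have hW1 : 0 ≤ W 1 := by simp only [hW, hV]; positivity
  refine ⟨Real.sqrt (W 1) + 1, by positivity, fun z hz => ?_⟩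
  have hz0 : 0 < z := by linarith
  have h1 : W z ≤ W 1 := hanti (mem_Ici.2 le_rfl) hz hz
  have h2 : (z ^ l * Real.exp (-z) * E z) ^ 2 ≤ W z := by
    have : 1 ≤ Real.exp (l ^ 2 / z) := Real.one_le_exp (by positivity)
    have hV0 : (z ^ l * Real.exp (-z) * E z) ^ 2 ≤ V z := by simp only [hV]; nlinarith
    simp only [hW]; nlinarith [sq_nonneg (z ^ l * Real.exp (-z) * E z)]
  have h3 : |z ^ l * besselH l z| ≤ Real.sqrt (W 1) := by
    refine Real.abs_le_sqrt (le_trans (le_of_eq ?_) (h2.trans h1))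
    simp only [besselH, hE]; ring
  rw [abs_mul, abs_of_pos (Real.rpow_pos_of_pos hz0 l)] at h3
  rw [Real.rpow_neg hz0.le, ← div_eq_mul_inv, le_div_iff₀ (Real.rpow_pos_of_pos hz0 l)]
  linarith

/-- A function bounded by a power on `[1,∞)` is, if continuous, bounded by the same power of `1 + z`
on `[0,∞)`. -/
lemma le_one_add_rpow_of_le {g : ℝ → ℝ} (hg : Continuous g) {α C : ℝ} (hC : 0 < C)
    (h : ∀ z, 1 ≤ z → |g z| ≤ C * z ^ (-α)) :
    ∃ C' : ℝ, 0 < C' ∧ ∀ z, 0 ≤ z → |g z| ≤ C' * (1 + z) ^ (-α) := by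
  obtain ⟨B, hB⟩ := (isCompact_Icc (a := (0 : ℝ)) (b := 1)).exists_bound_of_continuousOn
    hg.continuousOn
  have hB0 : 0 ≤ B := (norm_nonneg _).trans (hB 0 (by simp))
  refine ⟨(C + B) * 2 ^ |α|, by positivity, fun z hz => ?_⟩
  have hq : ∀ w : ℝ, 0 < w → w ≤ 2 * (1 + z) → 1 + z ≤ 2 * w →
      w ^ (-α) ≤ 2 ^ |α| * (1 + z) ^ (-α) := by
    intro w hw h1 h2
    have := rpow_le_of_le_mul hw (by linarith) one_le_two h1 h2 (-α)
    rwa [abs_neg] at this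
  have hpos : 0 < (1 + z) ^ (-α) := by positivity
  have h2pos : (0 : ℝ) < 2 ^ |α| := by positivity
  rcases le_total 1 z with h1 | h1
  · refine (h z h1).trans ?_
    have := hq z (by linarith) (by linarith) (by linarith)
    calc C * z ^ (-α) ≤ C * (2 ^ |α| * (1 + z) ^ (-α)) := by gcongr
      _ ≤ _ := by rw [← mul_assoc]; gcongr; linarith
  · refine (hB z ⟨hz, h1⟩).trans ?_
    have := hq 1 one_pos (by linarith) (by linarith)
    rw [Real.one_rpow] at this
    calc B = B * 1 := (mul_one _).symm
      _ ≤ B * (2 ^ |α| * (1 + z) ^ (-α)) := by gcongr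
      _ ≤ _ := by rw [← mul_assoc]; gcongr; linarith

/-- Decay is gained by differentiating a solution of `z g'' + (b + 2 z) g' + 2 a g = 0`. -/
lemma deriv_decay_of_ode {g g1 g2 : ℝ → ℝ} {a b β C : ℝ} (hb : -1 < b)
    (hg1 : ∀ z, HasDerivAt g1 (g2 z) z)
    (hode : ∀ z, z * g2 z + (b + 2 * z) * g1 z + 2 * a * g z = 0) (hC : 0 < C)
    (hg : ∀ z, 0 ≤ z → |g z| ≤ C * (1 + z) ^ (1 - β)) :
    ∃ C' : ℝ, 0 < C' ∧ ∀ z, 1 ≤ z → |g1 z| ≤ C' * z ^ (-β) := by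
  -- This shift gives β/(A+z) ≤ 1/4, while b > -1 and z ≥ 1 give b/z ≥ -1; the logarithmic
  -- derivative b/z + 2 - β/(A+z) of `v` is then at least 1/2.
  set A := 1 + 4 * |β| with hA
  have hA1 : 1 ≤ A := by have := abs_nonneg β; linarith
  -- The first term dominates the source `2 a g`, the second the value of `g1` at `z = 1`.
  set C1 := 8 * |a| * C * A ^ |β| + |g1 1| * (A + 1) ^ β + 1 with hC1
  have hC1pos : 0 < C1 := by positivity
  -- With the integrating factor z^b e^(2z) the equation reads u' = -2a z^(b-1) e^(2z) g. The
  -- barrier `v` satisfies |u'| ≤ v' and |u(1)| ≤ v(1), hence |u| ≤ v on [1,∞).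
  set u := fun z : ℝ => z ^ b * Real.exp (2 * z) * g1 z with hu
  set v := fun z : ℝ => C1 * (z ^ b * Real.exp (2 * z) * (A + z) ^ (-β)) with hv
  have hp : ∀ z : ℝ, 0 < z → HasDerivAt (fun z => z ^ b * Real.exp (2 * z))
      (z ^ b * Real.exp (2 * z) * (b / z + 2)) z := by
    intro z hz
    refine ((Real.hasDerivAt_rpow_const (p := b) (Or.inl hz.ne')).mul
      ((hasDerivAt_id z).const_mul 2).exp).congr_deriv ?_
    rw [Real.rpow_sub_one hz.ne']; simp only [id]; ring
  have hdu : ∀ z, 0 < z → HasDerivAt u (z ^ b * Real.exp (2 * z) * (-(2 * a * g z) / z)) z := by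
    intro z hz
    refine ((hp z hz).mul (hg1 z)).congr_deriv ?_
    have e : g2 z = (-(b + 2 * z) * g1 z - 2 * a * g z) / z := by
      field_simp; linear_combination hode z
    rw [e]; field_simp; ring
  have hdv : ∀ z, 0 < z → HasDerivAt v (C1 * (z ^ b * Real.exp (2 * z) * (A + z) ^ (-β) *
      (b / z + 2 - β / (A + z)))) z := by
    intro z hz
    have hAz : 0 < A + z := by linarith
    have h := (Real.hasDerivAt_rpow_const (p := -β) (Or.inl hAz.ne')).comp z
      ((hasDerivAt_id z).const_add A)
    refine (((hp z hz).mul h).const_mul C1).congr_deriv ?_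
    simp only [Function.comp_def]
    rw [Real.rpow_sub_one hAz.ne']; field_simp; ring
  have hcmp : ∀ z, 1 ≤ z → |z ^ b * Real.exp (2 * z) * (-(2 * a * g z) / z)| ≤
      C1 * (z ^ b * Real.exp (2 * z) * (A + z) ^ (-β) * (b / z + 2 - β / (A + z))) := by
    intro z hz
    have hz0 : 0 < z := by linarith
    have hAz : 0 < A + z := by linarith
    have h1 : (1 + z) ^ (-β) ≤ A ^ |β| * (A + z) ^ (-β) := by
      have := rpow_le_of_le_mul (a := 1 + z) (b := A + z) (by linarith) hAz hA1
        (by nlinarith) (by nlinarith) (-β)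
      rwa [abs_neg] at this
    have h2 : |g z| ≤ C * (2 * z * (A ^ |β| * (A + z) ^ (-β))) := by
      refine (hg z hz0.le).trans ?_
      rw [show 1 - β = 1 + -β by ring, Real.rpow_add (by linarith), Real.rpow_one]
      gcongr
      linarith
    have h3 : β / (A + z) ≤ 1 / 4 := by
      rw [div_le_iff₀ hAz]
      linarith [le_abs_self β]
    have h4 : -1 ≤ b / z := by
      rw [le_div_iff₀ hz0]; linarith
    have hX : 0 < z ^ b * Real.exp (2 * z) := by positivity
    have hY : 0 < (A + z) ^ (-β) := by positivity
    rw [abs_mul, abs_of_pos hX, abs_div, abs_neg, abs_mul, abs_mul, abs_two, abs_of_pos hz0]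
    calc z ^ b * Real.exp (2 * z) * (2 * |a| * |g z| / z)
        ≤ z ^ b * Real.exp (2 * z) * (2 * |a| * (C * (2 * z * (A ^ |β| * (A + z) ^ (-β)))) / z) := by
          gcongr
      _ = z ^ b * Real.exp (2 * z) * (A + z) ^ (-β) * (8 * |a| * C * A ^ |β|) * (1 / 2) := by
          field_simp; ring
      _ ≤ z ^ b * Real.exp (2 * z) * (A + z) ^ (-β) * C1 * (b / z + 2 - β / (A + z)) := by
          gcongr
          · rw [hC1]
            have : 0 ≤ |g1 1| * (A + 1) ^ β := by positivity
            linarith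
          · linarith
      _ = _ := by ring
  have hinit : |u 1| ≤ v 1 := by
    simp only [hu, hv, Real.one_rpow, one_mul, mul_one]
    rw [abs_mul, abs_of_pos (Real.exp_pos _)]
    have : |g1 1| ≤ C1 * (A + 1) ^ (-β) := by
      rw [Real.rpow_neg (by linarith), ← div_eq_mul_inv, le_div_iff₀ (by positivity), hC1]
      have : 0 ≤ 8 * |a| * C * A ^ |β| := by positivity
      linarith
    nlinarith [Real.exp_pos 2]
  -- The signs σ = 1 and σ = -1 give the two halves of |u| ≤ v.
  have hmain : ∀ σ : ℝ, |σ| = 1 → ∀ z, 1 ≤ z → σ * u z ≤ v z := by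
    intro σ hσ z hz
    have hmono : MonotoneOn (fun z => v z - σ * u z) (Ici 1) := by
      have hd : ∀ z, 1 ≤ z → HasDerivAt (fun z => v z - σ * u z) _ z := fun z hz =>
        (hdv z (by linarith)).sub ((hdu z (by linarith)).const_mul σ)
      refine monotoneOn_of_deriv_nonneg (convex_Ici 1) ?_ ?_ ?_
      · exact fun z hz => (hd z hz).continuousAt.continuousWithinAt
      · rw [interior_Ici]
        exact fun z hz => (hd z (mem_Ioi.1 hz).le).differentiableAt.differentiableWithinAt
      · rw [interior_Ici]
        intro z hz
        rw [(hd z (mem_Ioi.1 hz).le).deriv, sub_nonneg]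
        refine (le_abs_self _).trans ?_
        rw [abs_mul, hσ, one_mul]
        exact hcmp z (mem_Ioi.1 hz).le
    have h1 := hmono (mem_Ici.2 le_rfl) hz hz
    have h2 : σ * u 1 ≤ v 1 := by
      refine (le_abs_self _).trans ?_
      rw [abs_mul, hσ, one_mul]; exact hinit
    simp only at h1
    linarith
  refine ⟨C1 * (A + 1) ^ |β|, by positivity, fun z hz => ?_⟩
  have hz0 : 0 < z := by linarith
  have h1 := hmain 1 (by simp) z hz
  have h2 := hmain (-1) (by simp) z hz
  have h3 : |u z| ≤ v z := abs_le.2 ⟨by linarith, by linarith⟩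
  have hX : 0 < z ^ b * Real.exp (2 * z) := by positivity
  simp only [hu, hv] at h3
  rw [abs_mul, abs_of_pos hX, mul_left_comm] at h3
  have h4 := le_of_mul_le_mul_left h3 hX
  have h5 : (A + z) ^ (-β) ≤ (A + 1) ^ |β| * z ^ (-β) := by
    have := rpow_le_of_le_mul (a := A + z) (b := z) (κ := A + 1) (by linarith) hz0 (by linarith)
      (by nlinarith) (by nlinarith) (-β)
    rwa [abs_neg] at this
  calc |g1 z| ≤ C1 * (A + z) ^ (-β) := h4
    _ ≤ C1 * ((A + 1) ^ |β| * z ^ (-β)) := by gcongr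
    _ = _ := by ring

/-- Symbol estimates for the scaled Bessel function. -/
theorem iteratedDeriv_besselH_le {l : ℝ} (hl : -(1 / 2) < l) (i : ℕ) :
    ∃ C : ℝ, 0 < C ∧ ∀ z, 0 ≤ z → |iteratedDeriv i (besselH l) z| ≤ C * (1 + z) ^ (-(l + i)) := by
  have hcont : ∀ i, Continuous (iteratedDeriv i (besselH l)) := fun i =>
    continuous_iff_continuousAt.2 fun z => (hasDerivAt_iteratedDeriv_besselH hl i z).continuousAt
  induction i with
  | zero =>
    obtain ⟨C, hC, h⟩ := besselH_le_of_one_le hl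
    simpa using le_one_add_rpow_of_le (hcont 0) hC (by simpa using h)
  | succ i ih =>
    obtain ⟨C, hC, h⟩ := ih
    -- Here b = 2l + i, and l > -1/2 is what makes b > -1.
    obtain ⟨C', hC', h'⟩ := deriv_decay_of_ode (b := 2 * l + i) (β := l + (i + 1 : ℕ))
      (by have := i.cast_nonneg (α := ℝ); linarith)
      (fun z => hasDerivAt_iteratedDeriv_besselH hl (i + 1) z)
      (a := l + i) (fun z => by simpa using besselH_ode hl i z) hC
      (fun z hz => by
        have := h z hz
        rwa [show -(l + i) = 1 - (l + ((i + 1 : ℕ) : ℝ)) by push_cast; ring] at this)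
    exact le_one_add_rpow_of_le (hcont (i + 1)) hC' h'

/-- The modified Bessel function in terms of its even entire part. -/
lemma besselI_eq {l z : ℝ} (hz : 0 < z) :
    besselI (l - 1 / 2) z = z ^ (l - 1 / 2) * besselE l (z ^ 2) := by
  rw [besselI, besselE, ← tsum_mul_left]
  refine tsum_congr fun m => ?_
  rw [besselCoeff, Real.rpow_add (by positivity), Real.div_rpow hz.le (by norm_num),
    Real.rpow_neg (by norm_num), show (2 : ℝ) * (m : ℝ) = ((2 * m : ℕ) : ℝ) by push_cast; ring,
    Real.rpow_natCast, pow_mul, div_pow, show ((m : ℝ) + (l - 1 / 2) + 1) = m + (l + 1 / 2) by ring]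
  have h2 : (0 : ℝ) < 2 ^ (l - 1 / 2) := by positivity
  rw [show (z ^ 2 / 2 ^ 2) = z ^ 2 * (1 / 4) by ring, mul_pow]
  field_simp

end DunklBessel

end

/-! ### Derivatives of the one-dimensional heat kernel and their Gaussian bounds. -/

noncomputable section

namespace DunklBessel

open Filter Topology
open scoped ContDiff

/-- The derivative in the first of three real variables. -/
def dS (F : ℝ × ℝ × ℝ → ℝ) (v : ℝ × ℝ × ℝ) : ℝ := fderiv ℝ F v (1, 0, 0)

/-- The derivative in the second of three real variables. -/
def dX (F : ℝ × ℝ × ℝ → ℝ) (v : ℝ × ℝ × ℝ) : ℝ := fderiv ℝ F v (0, 1, 0)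

/-- The derivative in the third of three real variables. -/
def dY (F : ℝ × ℝ × ℝ → ℝ) (v : ℝ × ℝ × ℝ) : ℝ := fderiv ℝ F v (0, 0, 1)

lemma hasDerivAt_dS {F : ℝ × ℝ × ℝ → ℝ} {s x y : ℝ} (h : DifferentiableAt ℝ F (s, x, y)) :
    HasDerivAt (fun s => F (s, x, y)) (dS F (s, x, y)) s :=
  h.hasFDerivAt.comp_hasDerivAt s
    ((hasDerivAt_id s).prodMk ((hasDerivAt_const s x).prodMk (hasDerivAt_const s y)))

lemma hasDerivAt_dX {F : ℝ × ℝ × ℝ → ℝ} {s x y : ℝ} (h : DifferentiableAt ℝ F (s, x, y)) :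
    HasDerivAt (fun x => F (s, x, y)) (dX F (s, x, y)) x :=
  h.hasFDerivAt.comp_hasDerivAt x
    ((hasDerivAt_const x s).prodMk ((hasDerivAt_id x).prodMk (hasDerivAt_const x y)))

lemma hasDerivAt_dY {F : ℝ × ℝ × ℝ → ℝ} {s x y : ℝ} (h : DifferentiableAt ℝ F (s, x, y)) :
    HasDerivAt (fun y => F (s, x, y)) (dY F (s, x, y)) y :=
  h.hasFDerivAt.comp_hasDerivAt y
    ((hasDerivAt_const y s).prodMk ((hasDerivAt_const y x).prodMk (hasDerivAt_id y)))

lemma fderiv_fderiv_apply_comm {F : ℝ × ℝ × ℝ → ℝ} {v : ℝ × ℝ × ℝ} (h : ContDiffAt ℝ ∞ F v)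
    (a b : ℝ × ℝ × ℝ) :
    fderiv ℝ (fun w => fderiv ℝ F w a) v b = fderiv ℝ (fun w => fderiv ℝ F w b) v a := by
  have h2 : (2 : ℕ∞ω) ≤ (∞ : ℕ∞ω) := WithTop.coe_le_coe.2 le_top
  have hd : DifferentiableAt ℝ (fderiv ℝ F) v :=
    (h.fderiv_right (m := 1) (by rw [one_add_one_eq_two]; exact h2)).differentiableAt (by norm_num)
  have e : ∀ c d : ℝ × ℝ × ℝ, fderiv ℝ (fun w => fderiv ℝ F w c) v d =
      fderiv ℝ (fderiv ℝ F) v d c := by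
    intro c d
    have := (hd.hasFDerivAt.clm_apply (hasFDerivAt_const c v)).fderiv
    rw [this]; simp
  rw [e, e]
  exact (h.isSymmSndFDerivAt (by simpa using h2)) b a

/-- The building blocks of the derivatives of the one-dimensional heat-Bessel kernel,
as functions of `(s, x, y)`. -/
def heatAtom (l c a : ℝ) (p q r m : ℕ) (v : ℝ × ℝ × ℝ) : ℝ :=
  c * v.1 ^ a * v.2.1 ^ p * v.2.2 ^ q * (v.2.1 - v.2.2) ^ r *
    Real.exp (-(v.2.1 - v.2.2) ^ 2 / (4 * v.1)) *
    iteratedDeriv m (besselH l) (v.2.1 * v.2.2 / (2 * v.1))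

/-- Sums of building blocks of homogeneity `-2κ` relative to the heat-Bessel kernel. -/
inductive HeatClass (l : ℝ) : ℝ → (ℝ × ℝ × ℝ → ℝ) → Prop
  -- The value of `a` is forced by the scaling (σ²s, σx, σy). The condition p + q ≤ 2m lets the m
  -- extra powers of decay of the Bessel derivative absorb x^p y^q.
  | atom {κ : ℝ} (c a : ℝ) (p q r m : ℕ) (ha : a = -(l + 1 / 2) - κ - ((p : ℝ) + q + r) / 2)
      (hm : p + q ≤ 2 * m) : HeatClass l κ (heatAtom l c a p q r m)
  | add {κ : ℝ} {F G : ℝ × ℝ × ℝ → ℝ} (hF : HeatClass l κ F) (hG : HeatClass l κ G) :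
      HeatClass l κ (fun v => F v + G v)
  -- Values at s ≤ 0 carry no meaning, so membership depends on s > 0 only.
  | congr {κ : ℝ} {F G : ℝ × ℝ × ℝ → ℝ} (hF : HeatClass l κ F)
      (h : ∀ v : ℝ × ℝ × ℝ, 0 < v.1 → F v = G v) : HeatClass l κ G

lemma eventually_fst_pos {v : ℝ × ℝ × ℝ} (hv : 0 < v.1) : ∀ᶠ w in 𝓝 v, 0 < w.1 :=
  continuous_fst.continuousAt.eventually (lt_mem_nhds hv)

lemma contDiff_iteratedDeriv_besselH {l : ℝ} (hl : -(1 / 2) < l) (m : ℕ) :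
    ContDiff ℝ ∞ (iteratedDeriv m (besselH l)) := by
  induction m with
  | zero => simpa using contDiff_besselH hl
  | succ m ih => rw [iteratedDeriv_succ]; exact (contDiff_infty_iff_deriv.1 ih).2

lemma contDiffAt_heatAtom {l : ℝ} (hl : -(1 / 2) < l) (c a : ℝ) (p q r m : ℕ) {v : ℝ × ℝ × ℝ}
    (hv : 0 < v.1) : ContDiffAt ℝ ∞ (heatAtom l c a p q r m) v := by
  have h1 : ContDiffAt ℝ ∞ (fun v : ℝ × ℝ × ℝ => v.1) v := contDiffAt_fst
  have h2 : ContDiffAt ℝ ∞ (fun v : ℝ × ℝ × ℝ => v.2.1) v := contDiff_fst.contDiffAt.comp v contDiffAt_snd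
  have h3 : ContDiffAt ℝ ∞ (fun v : ℝ × ℝ × ℝ => v.2.2) v := contDiff_snd.contDiffAt.comp v contDiffAt_snd
  have h4 := h2.sub h3
  refine ContDiffAt.mul (ContDiffAt.mul ((((contDiffAt_const.mul
    (h1.rpow_const_of_ne hv.ne')).mul (h2.pow p)).mul (h3.pow q)).mul (h4.pow r)) ?_) ?_
  · exact Real.contDiff_exp.contDiffAt.comp v
      ((h4.pow 2).neg.div (contDiffAt_const.mul h1) (by positivity))
  · exact (contDiff_iteratedDeriv_besselH hl m).contDiffAt.comp v
      ((h2.mul h3).div (contDiffAt_const.mul h1) (by positivity))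

lemma HeatClass.contDiffAt {l κ : ℝ} (hl : -(1 / 2) < l) {F : ℝ × ℝ × ℝ → ℝ}
    (h : HeatClass l κ F) {v : ℝ × ℝ × ℝ} (hv : 0 < v.1) : ContDiffAt ℝ ∞ F v := by
  induction h with
  | atom c a p q r m ha hm => exact contDiffAt_heatAtom hl c a p q r m hv
  | add hF hG ihF ihG => exact ihF.add ihG
  | congr hF h ih =>
    exact ih.congr_of_eventuallyEq ((eventually_fst_pos hv).mono fun w hw => (h w hw).symm)

lemma HeatClass.differentiableAt {l κ : ℝ} (hl : -(1 / 2) < l) {F : ℝ × ℝ × ℝ → ℝ}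
    (h : HeatClass l κ F) {v : ℝ × ℝ × ℝ} (hv : 0 < v.1) : DifferentiableAt ℝ F v :=
  (h.contDiffAt hl hv).differentiableAt (by simp)

lemma heatClass_zero (l κ : ℝ) : HeatClass l κ (fun _ => 0) :=
  (HeatClass.atom 0 _ 0 0 0 0 rfl (by simp)).congr fun v _ => by simp [heatAtom]

lemma HeatClass.neg {l κ : ℝ} {F : ℝ × ℝ × ℝ → ℝ} (h : HeatClass l κ F) :
    HeatClass l κ (fun v => -F v) := by
  induction h with
  | atom c a p q r m ha hm =>
    exact (HeatClass.atom (-c) a p q r m ha hm).congr fun v _ => by simp [heatAtom]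
  | add hF hG ihF ihG => exact (ihF.add ihG).congr fun v _ => by ring
  | congr hF h ih => exact ih.congr fun v hv => by rw [h v hv]

lemma hasDerivAt_exp_quot_time {w s : ℝ} (hs : 0 < s) :
    HasDerivAt (fun s : ℝ => Real.exp (-w ^ 2 / (4 * s)))
      (Real.exp (-w ^ 2 / (4 * s)) * (w ^ 2 / (4 * s ^ 2))) s := by
  refine HasDerivAt.exp ?_
  refine ((hasDerivAt_const s (-w ^ 2)).div ((hasDerivAt_id s).const_mul 4)
    (by simp [hs.ne'])).congr_deriv ?_
  simp; field_simp

lemma hasDerivAt_heatAtom_time {l : ℝ} (hl : -(1 / 2) < l) (c a : ℝ) (p q r m : ℕ) {s : ℝ}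
    (hs : 0 < s) (x y : ℝ) : HasDerivAt (fun s => heatAtom l c a p q r m (s, x, y))
      (heatAtom l (c * a) (a - 1) p q r m (s, x, y) +
        (heatAtom l (c / 4) (a - 2) p q (r + 2) m (s, x, y) +
        heatAtom l (-c / 2) (a - 2) (p + 1) (q + 1) r (m + 1) (s, x, y))) s := by
  have hw : HasDerivAt (fun s : ℝ => x * y / (2 * s)) (-(x * y) / (2 * s ^ 2)) s := by
    refine ((hasDerivAt_const s (x * y)).div ((hasDerivAt_id s).const_mul 2)
      (by simp [hs.ne'])).congr_deriv ?_
    simp; field_simp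
  have h1 := ((((((Real.hasDerivAt_rpow_const (p := a) (Or.inl hs.ne')).const_mul c).mul_const
    (x ^ p)).mul_const (y ^ q)).mul_const ((x - y) ^ r)).mul
    (hasDerivAt_exp_quot_time (w := x - y) hs)).mul
    ((hasDerivAt_iteratedDeriv_besselH hl m (x * y / (2 * s))).comp s hw)
  refine h1.congr_deriv ?_
  simp only [heatAtom, Function.comp_def, Pi.mul_apply]
  rw [show a - 2 = a - (2 : ℕ) by norm_num, Real.rpow_sub_natCast hs.ne', Real.rpow_sub_one hs.ne']
  field_simp
  ring

lemma hasDerivAt_heatAtom_fst {l : ℝ} (hl : -(1 / 2) < l) (c a : ℝ) (p q r m : ℕ) {s : ℝ}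
    (hs : 0 < s) (x y : ℝ) : HasDerivAt (fun x => heatAtom l c a p q r m (s, x, y))
      (heatAtom l (c * p) a (p - 1) q r m (s, x, y) +
        (heatAtom l (c * r) a p q (r - 1) m (s, x, y) +
        (heatAtom l (-c / 2) (a - 1) p q (r + 1) m (s, x, y) +
        heatAtom l (c / 2) (a - 1) p (q + 1) r (m + 1) (s, x, y)))) x := by
  have hw : HasDerivAt (fun x : ℝ => x * y / (2 * s)) (y / (2 * s)) x := by
    simpa using ((hasDerivAt_id x).mul_const y).div_const (2 * s)
  have hxy : HasDerivAt (fun x : ℝ => x - y) 1 x := (hasDerivAt_id x).sub_const y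
  have he := ((hxy.pow 2).neg.div_const (4 * s)).exp
  have h1 := (((((hasDerivAt_pow p x).const_mul (c * s ^ a)).mul_const (y ^ q)).mul
    (hxy.pow r)).mul he).mul
    ((hasDerivAt_iteratedDeriv_besselH hl m (x * y / (2 * s))).comp x hw)
  refine h1.congr_deriv ?_
  simp only [heatAtom, Function.comp_def, Pi.pow_apply, Pi.neg_apply, Pi.mul_apply]
  rw [Real.rpow_sub_one hs.ne']
  field_simp
  ring

lemma heatAtom_swap (l c a : ℝ) (p q r m : ℕ) (s x y : ℝ) :
    heatAtom l c a p q r m (s, x, y) = heatAtom l ((-1) ^ r * c) a q p r m (s, y, x) := by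
  simp only [heatAtom]
  rw [show (x - y) ^ r = (-1) ^ r * (y - x) ^ r by rw [← mul_pow]; ring,
    show (x - y) ^ 2 = (y - x) ^ 2 by ring, mul_comm x y]
  ring

/-- Interchange of the last two of three variables. -/
def swapXY (F : ℝ × ℝ × ℝ → ℝ) (v : ℝ × ℝ × ℝ) : ℝ := F (v.1, v.2.2, v.2.1)

lemma HeatClass.swap {l κ : ℝ} {F : ℝ × ℝ × ℝ → ℝ} (h : HeatClass l κ F) :
    HeatClass l κ (swapXY F) := by
  induction h with
  | atom c a p q r m ha hm =>
    exact (HeatClass.atom ((-1) ^ r * c) a q p r m (by rw [ha]; ring) (by omega)).congr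
      fun v _ => by rw [swapXY, ← heatAtom_swap]
  | add hF hG ihF ihG => exact ihF.add ihG
  | congr hF h ih => exact ih.congr fun v hv => h _ hv

lemma HeatClass.dS {l κ : ℝ} (hl : -(1 / 2) < l) {F : ℝ × ℝ × ℝ → ℝ} (h : HeatClass l κ F) :
    HeatClass l (κ + 1) (dS F) := by
  induction h with
  | atom c a p q r m ha hm =>
    refine HeatClass.congr (HeatClass.add (.atom (c * a) (a - 1) p q r m ?_ hm)
      (.add (.atom (c / 4) (a - 2) p q (r + 2) m ?_ hm)
        (.atom (-c / 2) (a - 2) (p + 1) (q + 1) r (m + 1) ?_ (by omega)))) ?_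
    · rw [ha]; ring
    · rw [ha]; push_cast; ring
    · rw [ha]; push_cast; ring
    · rintro ⟨s, x, y⟩ hs
      exact (hasDerivAt_heatAtom_time hl c a p q r m hs x y).unique
        (hasDerivAt_dS ((contDiffAt_heatAtom hl c a p q r m hs).differentiableAt (by simp)))
  | add hF hG ihF ihG =>
    refine (ihF.add ihG).congr fun v hv => ?_
    simp only [DunklBessel.dS]
    rw [fderiv_fun_add (hF.differentiableAt hl hv) (hG.differentiableAt hl hv)]; rfl
  | congr hF h ih =>
    refine ih.congr fun v hv => ?_
    simp only [DunklBessel.dS]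
    rw [Filter.EventuallyEq.fderiv_eq ((eventually_fst_pos hv).mono fun w hw => h w hw)]

lemma HeatClass.dX {l κ : ℝ} (hl : -(1 / 2) < l) {F : ℝ × ℝ × ℝ → ℝ} (h : HeatClass l κ F) :
    HeatClass l (κ + 1 / 2) (dX F) := by
  induction h with
  | atom c a p q r m ha hm =>
    refine HeatClass.congr (HeatClass.add (F := heatAtom l (c * p) a (p - 1) q r m) ?_
      (.add (F := heatAtom l (c * r) a p q (r - 1) m) ?_
      (.add (.atom (-c / 2) (a - 1) p q (r + 1) m ?_ hm)
        (.atom (c / 2) (a - 1) p (q + 1) r (m + 1) ?_ (by omega))))) ?_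
    -- For p = 0 the truncated exponent p - 1 would violate the homogeneity relation, but then the
    -- coefficient vanishes; likewise for r below.
    · rcases p with _ | p
      · exact (heatClass_zero l _).congr fun v _ => by simp [heatAtom]
      · exact .atom _ _ _ _ _ _ (by rw [ha]; push_cast; ring) (by omega)
    · rcases r with _ | r
      · exact (heatClass_zero l _).congr fun v _ => by simp [heatAtom]
      · exact .atom _ _ _ _ _ _ (by rw [ha]; push_cast; ring) (by omega)
    · rw [ha]; push_cast; ring
    · rw [ha]; push_cast; ring
    · rintro ⟨s, x, y⟩ hs
      exact (hasDerivAt_heatAtom_fst hl c a p q r m hs x y).unique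
        (hasDerivAt_dX ((contDiffAt_heatAtom hl c a p q r m hs).differentiableAt (by simp)))
  | add hF hG ihF ihG =>
    refine (ihF.add ihG).congr fun v hv => ?_
    simp only [DunklBessel.dX]
    rw [fderiv_fun_add (hF.differentiableAt hl hv) (hG.differentiableAt hl hv)]; rfl
  | congr hF h ih =>
    refine ih.congr fun v hv => ?_
    simp only [DunklBessel.dX]
    rw [Filter.EventuallyEq.fderiv_eq ((eventually_fst_pos hv).mono fun w hw => h w hw)]

/-- The class is invariant under exchanging x and y, so this reduces to `HeatClass.dX`. -/
lemma HeatClass.dY {l κ : ℝ} (hl : -(1 / 2) < l) {F : ℝ × ℝ × ℝ → ℝ} (h : HeatClass l κ F) :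
    HeatClass l (κ + 1 / 2) (dY F) := by
  refine (h.swap.dX hl).swap.congr ?_
  rintro ⟨s, x, y⟩ hs
  exact (hasDerivAt_dX (h.swap.differentiableAt hl (v := (s, y, x)) hs)).unique
    (hasDerivAt_dY (h.differentiableAt hl hs))

/-- Members of the class are arbitrary where s ≤ 0, so only a representative can be claimed to be
measurable. -/
lemma HeatClass.exists_measurable {l κ : ℝ} (hl : -(1 / 2) < l) {F : ℝ × ℝ × ℝ → ℝ}
    (h : HeatClass l κ F) :
    ∃ G : ℝ × ℝ × ℝ → ℝ, Measurable G ∧ ∀ v : ℝ × ℝ × ℝ, 0 < v.1 → F v = G v := by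
  induction h with
  | atom c a p q r m ha hm =>
    refine ⟨_, ?_, fun v _ => rfl⟩
    have := (contDiff_iteratedDeriv_besselH hl m).continuous.measurable
    unfold heatAtom
    fun_prop
  | add hF hG ihF ihG =>
    obtain ⟨F', mF, eF⟩ := ihF
    obtain ⟨G', mG, eG⟩ := ihG
    exact ⟨_, mF.add mG, fun v hv => by simp [eF v hv, eG v hv]⟩
  | congr hF h ih =>
    obtain ⟨F', mF, eF⟩ := ih
    exact ⟨F', mF, fun v hv => by rw [← h v hv, eF v hv]⟩

lemma exists_one_add_pow_mul_exp_le (N : ℕ) :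
    ∃ C : ℝ, 0 < C ∧ ∀ d : ℝ, 0 ≤ d → (1 + d) ^ N * Real.exp (-d ^ 2 / 8) ≤ C := by
  -- The exponent 1 + d - d^2/8 equals 3 - (d-4)^2/8.
  refine ⟨N.factorial * Real.exp 3, by positivity, fun d hd => ?_⟩
  have h := Real.pow_div_factorial_le_exp (1 + d) (by positivity) N
  rw [div_le_iff₀ (by positivity)] at h
  calc (1 + d) ^ N * Real.exp (-d ^ 2 / 8)
      ≤ Real.exp (1 + d) * N.factorial * Real.exp (-d ^ 2 / 8) := by gcongr
    _ = N.factorial * Real.exp (1 + d + -d ^ 2 / 8) := by rw [Real.exp_add (1 + d)]; ring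
    _ ≤ _ := by
      gcongr
      nlinarith [sq_nonneg (d - 4)]

/-- The case s = 1. With d = |X - Y|, the quantities 1 + XY/2 and (1+X)^2 agree up to the factor
6(1+d)^2. All powers of 1 + d are paid for by one half of the Gaussian, and p + q ≤ 2m disposes of
X^p Y^q. -/
lemma scaled_heatAtom_le (l : ℝ) {p q m : ℕ} (r : ℕ) (hm : p + q ≤ 2 * m) :
    ∃ C : ℝ, 0 < C ∧ ∀ X Y : ℝ, 0 < X → 0 < Y →
      X ^ p * Y ^ q * |X - Y| ^ r * Real.exp (-(X - Y) ^ 2 / 4) * (1 + X * Y / 2) ^ (-(l + m)) ≤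
        C * ((1 + X) ^ (-(2 * l)) * Real.exp (-(X - Y) ^ 2 / 8)) := by
  obtain ⟨N, hN⟩ := exists_nat_ge (2 * |-(l + m)| + (q + r : ℕ))
  obtain ⟨C, hC, hb⟩ := exists_one_add_pow_mul_exp_le N
  refine ⟨6 ^ |-(l + m)| * C, by positivity, fun X Y hX hY => ?_⟩
  set d := |X - Y| with hd
  have hd0 : 0 ≤ d := abs_nonneg _
  have h1 := abs_le.1 (le_refl d)
  have hXY : X - Y ≤ d := le_abs_self _
  have hYX : Y - X ≤ d := by rw [hd, abs_sub_comm]; exact le_abs_self _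
  have hXYp := mul_pos hX hY
  have hY1 : 1 + Y ≤ (1 + X) * (1 + d) := by nlinarith
  have hX1 : 1 + X ≤ (1 + Y) * (1 + d) := by nlinarith
  have hc1 : 1 + X * Y / 2 ≤ 6 * (1 + d) ^ 2 * (1 + X) ^ 2 := by
    have : X * Y ≤ (1 + X) * ((1 + X) * (1 + d)) := by nlinarith
    nlinarith [mul_nonneg (sq_nonneg (1 + X)) hd0, mul_nonneg (sq_nonneg (1 + X)) (sq_nonneg d)]
  have hc2 : (1 + X) ^ 2 ≤ 6 * (1 + d) ^ 2 * (1 + X * Y / 2) := by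
    have hsum : X + Y ≤ 2 * (1 + X * Y) + d := by
      rcases le_total X Y with h | h
      · nlinarith [sq_nonneg (X - 1)]
      · nlinarith [sq_nonneg (Y - 1)]
    have h3 : (1 + X) * (1 + Y) ≤ 6 * (1 + X * Y / 2) * (1 + d) := by
      nlinarith [mul_nonneg hXYp.le hd0]
    calc (1 + X) ^ 2 = (1 + X) * (1 + X) := by ring
      _ ≤ (1 + X) * ((1 + Y) * (1 + d)) := by gcongr
      _ = (1 + X) * (1 + Y) * (1 + d) := by ring
      _ ≤ 6 * (1 + X * Y / 2) * (1 + d) * (1 + d) := by gcongr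
      _ = _ := by ring
  have hκ : 1 ≤ 6 * (1 + d) ^ 2 := by nlinarith [sq_nonneg d]
  have hZ := rpow_le_of_le_mul (a := 1 + X * Y / 2) (b := (1 + X) ^ 2) (by positivity)
    (by positivity) hκ hc1 hc2 (-(l + m))
  have hpq : X ^ p * Y ^ q ≤ ((1 + X) ^ 2) ^ m * (1 + d) ^ q := by
    calc X ^ p * Y ^ q ≤ (1 + X) ^ p * ((1 + X) * (1 + d)) ^ q := by
          gcongr
          · linarith
          · linarith
      _ = (1 + X) ^ (p + q) * (1 + d) ^ q := by rw [mul_pow, pow_add]; ring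
      _ ≤ (1 + X) ^ (2 * m) * (1 + d) ^ q := by
          gcongr
          linarith
      _ = _ := by rw [pow_mul]
  have hr : d ^ r ≤ (1 + d) ^ r := by gcongr; linarith
  have hT : ((1 + X) ^ 2) ^ m * ((1 + X) ^ 2) ^ (-(l + m)) = (1 + X) ^ (-(2 * l)) := by
    rw [← Real.rpow_natCast ((1 + X) ^ 2) m, ← Real.rpow_add (by positivity),
      ← Real.rpow_natCast (1 + X) 2, ← Real.rpow_mul (by positivity)]
    congr 1; push_cast; ring
  have hκp : (6 * (1 + d) ^ 2) ^ |-(l + m)| * (1 + d) ^ (q + r) ≤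
      6 ^ |-(l + m)| * (1 + d) ^ N := by
    rw [Real.mul_rpow (by norm_num) (by positivity), mul_assoc]
    gcongr
    rw [← Real.rpow_natCast (1 + d) 2, ← Real.rpow_mul (by positivity), ← Real.rpow_natCast (1 + d) (q + r),
      ← Real.rpow_add (by positivity), ← Real.rpow_natCast (1 + d) N]
    refine Real.rpow_le_rpow_of_exponent_le (by linarith) ?_
    push_cast at hN ⊢; linarith
  have hexp : Real.exp (-(X - Y) ^ 2 / 4) = Real.exp (-d ^ 2 / 8) * Real.exp (-(X - Y) ^ 2 / 8) := by
    rw [← Real.exp_add, hd, sq_abs]; congr 1; ring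
  calc X ^ p * Y ^ q * d ^ r * Real.exp (-(X - Y) ^ 2 / 4) * (1 + X * Y / 2) ^ (-(l + m))
      ≤ ((1 + X) ^ 2) ^ m * (1 + d) ^ q * (1 + d) ^ r * Real.exp (-(X - Y) ^ 2 / 4) *
        ((6 * (1 + d) ^ 2) ^ |-(l + m)| * ((1 + X) ^ 2) ^ (-(l + m))) := by gcongr
    _ = (((1 + X) ^ 2) ^ m * ((1 + X) ^ 2) ^ (-(l + m))) *
        ((6 * (1 + d) ^ 2) ^ |-(l + m)| * (1 + d) ^ (q + r)) *
        (Real.exp (-d ^ 2 / 8) * Real.exp (-(X - Y) ^ 2 / 8)) := by rw [hexp, pow_add]; ring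
    _ ≤ (1 + X) ^ (-(2 * l)) * (6 ^ |-(l + m)| * (1 + d) ^ N) *
        (Real.exp (-d ^ 2 / 8) * Real.exp (-(X - Y) ^ 2 / 8)) := by rw [hT]; gcongr
    _ = 6 ^ |-(l + m)| * ((1 + d) ^ N * Real.exp (-d ^ 2 / 8)) *
        ((1 + X) ^ (-(2 * l)) * Real.exp (-(X - Y) ^ 2 / 8)) := by ring
    _ ≤ _ := by gcongr; exact hb d hd0

/-- Gaussian bounds for the kernels of the class `HeatClass`. -/
theorem HeatClass.le {l κ : ℝ} (hl : -(1 / 2) < l) {F : ℝ × ℝ × ℝ → ℝ} (h : HeatClass l κ F) :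
    ∃ C : ℝ, 0 < C ∧ ∀ s x y : ℝ, 0 < s → 0 < x → 0 < y →
      |F (s, x, y)| ≤ C * (s ^ (-κ) * (s ^ (-(1 / 2) : ℝ) * (Real.sqrt s + x) ^ (-(2 * l))) *
        Real.exp (-(x - y) ^ 2 / (8 * s))) := by
  induction h with
  | atom c a p q r m ha hm =>
    obtain ⟨C, hC, hb⟩ := scaled_heatAtom_le l (m := m) r hm
    obtain ⟨C1, hC1, hb1⟩ := iteratedDeriv_besselH_le hl m
    refine ⟨(|c| + 1) * C1 * C, by positivity, fun s x y hs hx hy => ?_⟩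
    -- Parabolic scaling x = σX, y = σY with σ = √s reduces the bound to `scaled_heatAtom_le`.
    obtain ⟨σ, hσ, rfl⟩ : ∃ σ : ℝ, 0 < σ ∧ s = σ ^ 2 :=
      ⟨Real.sqrt s, Real.sqrt_pos.2 hs, (Real.sq_sqrt hs.le).symm⟩
    obtain ⟨X, rfl⟩ : ∃ X, x = σ * X := ⟨x / σ, by field_simp⟩
    obtain ⟨Y, rfl⟩ : ∃ Y, y = σ * Y := ⟨y / σ, by field_simp⟩
    have hX : 0 < X := pos_of_mul_pos_right hx hσ.le
    have hY : 0 < Y := pos_of_mul_pos_right hy hσ.le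
    have e1 : σ * X * (σ * Y) / (2 * σ ^ 2) = X * Y / 2 := by field_simp
    have e2 : -(σ * X - σ * Y) ^ 2 / (4 * σ ^ 2) = -(X - Y) ^ 2 / 4 := by field_simp
    have e3 : -(σ * X - σ * Y) ^ 2 / (8 * σ ^ 2) = -(X - Y) ^ 2 / 8 := by field_simp
    have e4 : (σ ^ 2) ^ a = (σ ^ 2) ^ (-κ) * (σ ^ 2) ^ (-(1 / 2) : ℝ) * σ ^ (-(2 * l)) /
        (σ ^ p * σ ^ q * σ ^ r) := by
      rw [← pow_add, ← pow_add, eq_div_iff (by positivity), ← Real.rpow_natCast σ 2,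
        ← Real.rpow_natCast σ (p + q + r), ← Real.rpow_mul hσ.le, ← Real.rpow_mul hσ.le,
        ← Real.rpow_mul hσ.le, ← Real.rpow_add hσ, ← Real.rpow_add hσ, ← Real.rpow_add hσ, ha]
      congr 1; push_cast; ring
    have e5 : (Real.sqrt (σ ^ 2) + σ * X) ^ (-(2 * l)) = σ ^ (-(2 * l)) * (1 + X) ^ (-(2 * l)) := by
      rw [Real.sqrt_sq hσ.le, ← Real.mul_rpow hσ.le (by positivity)]; congr 1; ring
    have hbX := hb X Y hX hY
    have hbh := hb1 (X * Y / 2) (by positivity)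
    set P := (σ ^ 2) ^ (-κ) * (σ ^ 2) ^ (-(1 / 2) : ℝ) * σ ^ (-(2 * l)) with hP
    have hPp : 0 < P := by positivity
    have e6 : heatAtom l c a p q r m (σ ^ 2, σ * X, σ * Y) = c * P * (X ^ p * Y ^ q * (X - Y) ^ r *
        Real.exp (-(X - Y) ^ 2 / 4)) * iteratedDeriv m (besselH l) (X * Y / 2) := by
      simp only [heatAtom, e1, e2, e4]
      rw [← mul_sub, mul_pow, mul_pow, mul_pow]
      field_simp
    rw [e6, e3, e5, abs_mul, abs_mul, abs_mul, abs_of_pos hPp, abs_mul, abs_mul, abs_mul, abs_pow,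
      abs_of_pos hX, abs_pow, abs_of_pos hY, abs_pow, abs_of_pos (Real.exp_pos _)]
    calc |c| * P * (X ^ p * Y ^ q * |X - Y| ^ r * Real.exp (-(X - Y) ^ 2 / 4)) *
          |iteratedDeriv m (besselH l) (X * Y / 2)|
        ≤ |c| * P * (X ^ p * Y ^ q * |X - Y| ^ r * Real.exp (-(X - Y) ^ 2 / 4)) *
          (C1 * (1 + X * Y / 2) ^ (-(l + m))) := by gcongr
      _ = |c| * C1 * P * (X ^ p * Y ^ q * |X - Y| ^ r * Real.exp (-(X - Y) ^ 2 / 4) *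
          (1 + X * Y / 2) ^ (-(l + m))) := by ring
      _ ≤ (|c| + 1) * C1 * P * (C * ((1 + X) ^ (-(2 * l)) * Real.exp (-(X - Y) ^ 2 / 8))) := by
          gcongr
          linarith
      _ = _ := by rw [hP]; ring
  | add hF hG ihF ihG =>
    obtain ⟨C, hC, hb⟩ := ihF
    obtain ⟨C', hC', hb'⟩ := ihG
    refine ⟨C + C', by positivity, fun s x y hs hx hy => ?_⟩
    rw [add_mul]
    exact (abs_add_le _ _).trans (add_le_add (hb s x y hs hx hy) (hb' s x y hs hx hy))
  | congr hF h ih =>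
    obtain ⟨C, hC, hb⟩ := ih
    exact ⟨C, hC, fun s x y hs hx hy => by rw [← h _ hs]; exact hb s x y hs hx hy⟩

end DunklBessel

end

/-! ### Even and odd heat kernels, and the cancellation of the singular coefficients. -/

noncomputable section

namespace DunklBessel

open Filter Topology
open scoped ContDiff

/-- The one-dimensional heat-Bessel kernel, as a function of `(s, x, y)`. -/
def heatK (l : ℝ) : ℝ × ℝ × ℝ → ℝ :=
  heatAtom l (2 ^ (-(l + 1 / 2))) (-(l + 1 / 2)) 0 0 0 0

/-- The one-dimensional heat-Bessel kernel of odd type, as a function of `(s, x, y)`. -/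
def heatB (l : ℝ) (v : ℝ × ℝ × ℝ) : ℝ :=
  v.2.1 * v.2.2 / (2 * v.1) * (2 ^ (-(l + 1 / 2)) * v.1 ^ (-(l + 1 / 2)) *
    Real.exp (-(v.2.1 - v.2.2) ^ 2 / (4 * v.1)) * besselH (l + 1) (v.2.1 * v.2.2 / (2 * v.1)))

/-- By z h_{l+1} = h_l + h_l' the odd kernel, though built from the parameter l + 1, belongs to the
class of parameter l. Its bounds thus refer to the same weight as those of the even kernel. -/
lemma heatB_eq {l : ℝ} (hl : -(1 / 2) < l) (v : ℝ × ℝ × ℝ) :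
    heatB l v = heatK l v + heatAtom l (2 ^ (-(l + 1 / 2))) (-(l + 1 / 2)) 0 0 0 1 v := by
  simp only [heatB, heatK, heatAtom, iteratedDeriv_one, deriv_besselH hl, iteratedDeriv_zero]
  ring

lemma heatClass_heatK (l : ℝ) : HeatClass l 0 (heatK l) :=
  .atom _ _ 0 0 0 0 (by simp) (by simp)

lemma heatClass_heatB {l : ℝ} (hl : -(1 / 2) < l) : HeatClass l 0 (heatB l) :=
  ((heatClass_heatK l).add (.atom _ _ 0 0 0 1 (by simp) (by simp))).congr
    fun v _ => (heatB_eq hl v).symm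

lemma HeatClass.iterate_dS {l κ : ℝ} (hl : -(1 / 2) < l) {F : ℝ × ℝ × ℝ → ℝ}
    (h : HeatClass l κ F) (i : ℕ) : HeatClass l (κ + i) (DunklBessel.dS^[i] F) := by
  induction i with
  | zero => simpa using h
  | succ i ih =>
    rw [Function.iterate_succ_apply']
    have := ih.dS hl
    push_cast
    rwa [← add_assoc]

lemma HeatClass.dX_dS {l κ : ℝ} (hl : -(1 / 2) < l) {F : ℝ × ℝ × ℝ → ℝ}
    (h : HeatClass l κ F) {v : ℝ × ℝ × ℝ} (hv : 0 < v.1) :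
    DunklBessel.dX (DunklBessel.dS F) v = DunklBessel.dS (DunklBessel.dX F) v :=
  fderiv_fderiv_apply_comm (h.contDiffAt hl hv) _ _

lemma HeatClass.dY_dS {l κ : ℝ} (hl : -(1 / 2) < l) {F : ℝ × ℝ × ℝ → ℝ}
    (h : HeatClass l κ F) {v : ℝ × ℝ × ℝ} (hv : 0 < v.1) :
    DunklBessel.dY (DunklBessel.dS F) v = DunklBessel.dS (DunklBessel.dY F) v :=
  fderiv_fderiv_apply_comm (h.contDiffAt hl hv) _ _

lemma dX_congr {F G : ℝ × ℝ × ℝ → ℝ} (h : ∀ v : ℝ × ℝ × ℝ, 0 < v.1 → F v = G v)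
    {v : ℝ × ℝ × ℝ} (hv : 0 < v.1) : dX F v = dX G v := by
  simp only [dX]
  rw [Filter.EventuallyEq.fderiv_eq ((eventually_fst_pos hv).mono fun w hw => h w hw)]

/-- The coefficient c, later 2l/x, does not depend on s; this carries the identities below over to
the iterates of `dS`. -/
lemma dS_relation {P R T : ℝ × ℝ × ℝ → ℝ} {c x y : ℝ}
    (hP : ∀ s : ℝ, 0 < s → DifferentiableAt ℝ P (s, x, y))
    (hR : ∀ s : ℝ, 0 < s → DifferentiableAt ℝ R (s, x, y))
    (hT : ∀ s : ℝ, 0 < s → DifferentiableAt ℝ T (s, x, y))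
    (h : ∀ s : ℝ, 0 < s → P (s, x, y) + c * R (s, x, y) = T (s, x, y)) {s : ℝ} (hs : 0 < s) :
    dS P (s, x, y) + c * dS R (s, x, y) = dS T (s, x, y) := by
  have h1 := (hasDerivAt_dS (hP s hs)).add ((hasDerivAt_dS (hR s hs)).const_mul c)
  refine h1.unique ((hasDerivAt_dS (hT s hs)).congr_of_eventuallyEq ?_)
  filter_upwards [lt_mem_nhds hs] with t ht
  exact h t ht

lemma heatK_apply (l s x y : ℝ) : heatK l (s, x, y) = 2 ^ (-(l + 1 / 2)) * s ^ (-(l + 1 / 2)) *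
    Real.exp (-(x - y) ^ 2 / (4 * s)) * besselH l (x * y / (2 * s)) := by
  simp [heatK, heatAtom]

/-- The common factor in the derivatives of the heat-Bessel kernel. -/
def heatFactor (l s x y : ℝ) : ℝ :=
  2 ^ (-(l + 1 / 2)) * s ^ (-(l + 1 / 2)) * Real.exp (-(x - y) ^ 2 / (4 * s))

lemma hasDerivAt_heatFactor_time (l : ℝ) {s : ℝ} (hs : 0 < s) (x y : ℝ) :
    HasDerivAt (fun s => heatFactor l s x y)
      (heatFactor l s x y * (-(l + 1 / 2) / s + (x - y) ^ 2 / (4 * s ^ 2))) s := by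
  refine (((Real.hasDerivAt_rpow_const (p := -(l + 1 / 2)) (Or.inl hs.ne')).const_mul _).mul
    (hasDerivAt_exp_quot_time (w := x - y) hs)).congr_deriv ?_
  rw [Real.rpow_sub_one hs.ne', heatFactor]
  field_simp

lemma hasDerivAt_heatFactor_fst (l : ℝ) {s : ℝ} (hs : 0 < s) (x y : ℝ) :
    HasDerivAt (fun x => heatFactor l s x y) (heatFactor l s x y * (-(x - y) / (2 * s))) x := by
  have hxy : HasDerivAt (fun x : ℝ => x - y) 1 x := (hasDerivAt_id x).sub_const y
  refine (((hxy.pow 2).neg.div_const (4 * s)).exp.const_mul _).congr_deriv ?_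
  simp only [heatFactor, Pi.pow_apply, Pi.neg_apply]
  field_simp
  ring

lemma hasDerivAt_heatFactor_snd (l : ℝ) {s : ℝ} (hs : 0 < s) (x y : ℝ) :
    HasDerivAt (fun y => heatFactor l s x y) (heatFactor l s x y * ((x - y) / (2 * s))) y := by
  have hxy : HasDerivAt (fun y : ℝ => x - y) (-1) y := (hasDerivAt_id y).const_sub x
  refine (((hxy.pow 2).neg.div_const (4 * s)).exp.const_mul _).congr_deriv ?_
  simp only [heatFactor, Pi.pow_apply, Pi.neg_apply]
  field_simp
  ring

section Identities

variable {l : ℝ}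

lemma hasDerivAt_iteratedDeriv_quot_time (hl : -(1 / 2) < l) (m : ℕ) {s : ℝ} (hs : 0 < s)
    (x y : ℝ) : HasDerivAt (fun s => iteratedDeriv m (besselH l) (x * y / (2 * s)))
      (iteratedDeriv (m + 1) (besselH l) (x * y / (2 * s)) * (-(x * y) / (2 * s ^ 2))) s := by
  refine HasDerivAt.comp s (h := fun s => x * y / (2 * s))
    (hasDerivAt_iteratedDeriv_besselH hl m (x * y / (2 * s))) ?_
  refine ((hasDerivAt_const s (x * y)).div ((hasDerivAt_id s).const_mul 2)
    (by simp [hs.ne'])).congr_deriv ?_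
  simp; field_simp

lemma hasDerivAt_iteratedDeriv_quot_fst (hl : -(1 / 2) < l) (m : ℕ) (s x y : ℝ) :
    HasDerivAt (fun x => iteratedDeriv m (besselH l) (x * y / (2 * s)))
      (iteratedDeriv (m + 1) (besselH l) (x * y / (2 * s)) * (y / (2 * s))) x := by
  refine HasDerivAt.comp x (h := fun x => x * y / (2 * s))
    (hasDerivAt_iteratedDeriv_besselH hl m (x * y / (2 * s))) ?_
  simpa using ((hasDerivAt_id x).mul_const y).div_const (2 * s)

lemma hasDerivAt_iteratedDeriv_quot_snd (hl : -(1 / 2) < l) (m : ℕ) (s x y : ℝ) :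
    HasDerivAt (fun y => iteratedDeriv m (besselH l) (x * y / (2 * s)))
      (iteratedDeriv (m + 1) (besselH l) (x * y / (2 * s)) * (x / (2 * s))) y := by
  refine HasDerivAt.comp y (h := fun y => x * y / (2 * s))
    (hasDerivAt_iteratedDeriv_besselH hl m (x * y / (2 * s))) ?_
  simpa using ((hasDerivAt_id y).const_mul x).div_const (2 * s)

lemma heatK_eq_factor (s x y : ℝ) :
    heatK l (s, x, y) = heatFactor l s x y * iteratedDeriv 0 (besselH l) (x * y / (2 * s)) := by
  rw [heatK_apply, heatFactor, iteratedDeriv_zero]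

lemma heatB_eq_factor (hl : -(1 / 2) < l) (s x y : ℝ) :
    heatB l (s, x, y) = heatFactor l s x y * (iteratedDeriv 0 (besselH l) (x * y / (2 * s)) +
      iteratedDeriv 1 (besselH l) (x * y / (2 * s))) := by
  rw [heatB_eq hl, heatK_eq_factor, heatFactor, mul_add]
  simp [heatAtom]

lemma dS_heatK (hl : -(1 / 2) < l) {s : ℝ} (hs : 0 < s) (x y : ℝ) :
    dS (heatK l) (s, x, y) = heatFactor l s x y *
      ((-(l + 1 / 2) / s + (x - y) ^ 2 / (4 * s ^ 2)) *
        iteratedDeriv 0 (besselH l) (x * y / (2 * s)) -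
        x * y / (2 * s ^ 2) * iteratedDeriv 1 (besselH l) (x * y / (2 * s))) := by
  have h := (hasDerivAt_heatFactor_time l hs x y).mul
    (hasDerivAt_iteratedDeriv_quot_time hl 0 hs x y)
  have h2 := hasDerivAt_dS ((heatClass_heatK l).differentiableAt hl (v := (s, x, y)) hs)
  simp only [heatK_eq_factor] at h2
  rw [h2.unique h]
  ring

lemma dS_heatB (hl : -(1 / 2) < l) {s : ℝ} (hs : 0 < s) (x y : ℝ) :
    dS (heatB l) (s, x, y) = heatFactor l s x y *
      ((-(l + 1 / 2) / s + (x - y) ^ 2 / (4 * s ^ 2)) *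
        (iteratedDeriv 0 (besselH l) (x * y / (2 * s)) +
          iteratedDeriv 1 (besselH l) (x * y / (2 * s))) -
        x * y / (2 * s ^ 2) * (iteratedDeriv 1 (besselH l) (x * y / (2 * s)) +
          iteratedDeriv 2 (besselH l) (x * y / (2 * s)))) := by
  have h := (hasDerivAt_heatFactor_time l hs x y).mul
    ((hasDerivAt_iteratedDeriv_quot_time hl 0 hs x y).add
      (hasDerivAt_iteratedDeriv_quot_time hl 1 hs x y))
  have h2 := hasDerivAt_dS ((heatClass_heatB hl).differentiableAt hl (v := (s, x, y)) hs)
  simp only [heatB_eq_factor hl] at h2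
  rw [h2.unique h]
  simp only [Pi.add_apply]
  ring

lemma dX_heatK (hl : -(1 / 2) < l) {s : ℝ} (hs : 0 < s) (x y : ℝ) :
    dX (heatK l) (s, x, y) = heatFactor l s x y *
      (-(x - y) / (2 * s) * iteratedDeriv 0 (besselH l) (x * y / (2 * s)) +
        y / (2 * s) * iteratedDeriv 1 (besselH l) (x * y / (2 * s))) := by
  have h := (hasDerivAt_heatFactor_fst l hs x y).mul
    (hasDerivAt_iteratedDeriv_quot_fst hl 0 s x y)
  have h2 := hasDerivAt_dX ((heatClass_heatK l).differentiableAt hl (v := (s, x, y)) hs)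
  simp only [heatK_eq_factor] at h2
  rw [h2.unique h]
  ring

lemma dY_heatK (hl : -(1 / 2) < l) {s : ℝ} (hs : 0 < s) (x y : ℝ) :
    dY (heatK l) (s, x, y) = heatFactor l s x y *
      ((x - y) / (2 * s) * iteratedDeriv 0 (besselH l) (x * y / (2 * s)) +
        x / (2 * s) * iteratedDeriv 1 (besselH l) (x * y / (2 * s))) := by
  have h := (hasDerivAt_heatFactor_snd l hs x y).mul
    (hasDerivAt_iteratedDeriv_quot_snd hl 0 s x y)
  have h2 := hasDerivAt_dY ((heatClass_heatK l).differentiableAt hl (v := (s, x, y)) hs)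
  simp only [heatK_eq_factor] at h2
  rw [h2.unique h]
  ring

lemma dX_heatB (hl : -(1 / 2) < l) {s : ℝ} (hs : 0 < s) (x y : ℝ) :
    dX (heatB l) (s, x, y) = heatFactor l s x y *
      (-(x - y) / (2 * s) * (iteratedDeriv 0 (besselH l) (x * y / (2 * s)) +
          iteratedDeriv 1 (besselH l) (x * y / (2 * s))) +
        y / (2 * s) * (iteratedDeriv 1 (besselH l) (x * y / (2 * s)) +
          iteratedDeriv 2 (besselH l) (x * y / (2 * s)))) := by
  have h := (hasDerivAt_heatFactor_fst l hs x y).mul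
    ((hasDerivAt_iteratedDeriv_quot_fst hl 0 s x y).add
      (hasDerivAt_iteratedDeriv_quot_fst hl 1 s x y))
  have h2 := hasDerivAt_dX ((heatClass_heatB hl).differentiableAt hl (v := (s, x, y)) hs)
  simp only [heatB_eq_factor hl] at h2
  rw [h2.unique h]
  simp only [Pi.add_apply]
  ring

lemma dX_dX_heatK (hl : -(1 / 2) < l) {s : ℝ} (hs : 0 < s) (x y : ℝ) :
    dX (dX (heatK l)) (s, x, y) = heatFactor l s x y *
      (((x - y) ^ 2 / (4 * s ^ 2) - 1 / (2 * s)) * iteratedDeriv 0 (besselH l) (x * y / (2 * s)) -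
        2 * ((x - y) / (2 * s)) * (y / (2 * s)) * iteratedDeriv 1 (besselH l) (x * y / (2 * s)) +
        (y / (2 * s)) ^ 2 * iteratedDeriv 2 (besselH l) (x * y / (2 * s))) := by
  have hxy : HasDerivAt (fun x : ℝ => -(x - y) / (2 * s)) (-1 / (2 * s)) x :=
    ((hasDerivAt_id x).sub_const y).neg.div_const _
  have h := (hasDerivAt_heatFactor_fst l hs x y).mul
    ((hxy.mul (hasDerivAt_iteratedDeriv_quot_fst hl 0 s x y)).add
      ((hasDerivAt_iteratedDeriv_quot_fst hl 1 s x y).const_mul (y / (2 * s))))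
  have h2 := hasDerivAt_dX (((heatClass_heatK l).dX hl).differentiableAt hl (v := (s, x, y)) hs)
  simp only [dX_heatK hl hs] at h2
  rw [h2.unique h]
  simp only [Pi.add_apply, Pi.mul_apply]
  ring

lemma dX_dY_heatK (hl : -(1 / 2) < l) {s : ℝ} (hs : 0 < s) (x y : ℝ) :
    dX (dY (heatK l)) (s, x, y) = heatFactor l s x y *
      ((-(x - y) ^ 2 / (4 * s ^ 2) + 1 / (2 * s)) * iteratedDeriv 0 (besselH l) (x * y / (2 * s)) +
        ((x - y) / (2 * s) * (y / (2 * s)) + 1 / (2 * s) - (x - y) / (2 * s) * (x / (2 * s))) *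
          iteratedDeriv 1 (besselH l) (x * y / (2 * s)) +
        (x / (2 * s)) * (y / (2 * s)) * iteratedDeriv 2 (besselH l) (x * y / (2 * s))) := by
  have hxy : HasDerivAt (fun x : ℝ => (x - y) / (2 * s)) (1 / (2 * s)) x :=
    ((hasDerivAt_id x).sub_const y).div_const _
  have hx : HasDerivAt (fun x : ℝ => x / (2 * s)) (1 / (2 * s)) x := (hasDerivAt_id x).div_const _
  have h := (hasDerivAt_heatFactor_fst l hs x y).mul
    ((hxy.mul (hasDerivAt_iteratedDeriv_quot_fst hl 0 s x y)).add
      (hx.mul (hasDerivAt_iteratedDeriv_quot_fst hl 1 s x y)))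
  have h2 := hasDerivAt_dX (((heatClass_heatK l).dY hl).differentiableAt hl (v := (s, x, y)) hs)
  simp only [dY_heatK hl hs] at h2
  rw [h2.unique h]
  simp only [Pi.add_apply, Pi.mul_apply]
  ring

/-- The equation of `besselH` cleared of denominators. The next three identities are multiples of
it. -/
lemma besselH_ode_quot (hl : -(1 / 2) < l) {s : ℝ} (hs : 0 < s) (x y : ℝ) :
    x * y * iteratedDeriv 2 (besselH l) (x * y / (2 * s)) +
      (4 * l * s + 2 * (x * y)) * iteratedDeriv 1 (besselH l) (x * y / (2 * s)) +
      4 * l * s * iteratedDeriv 0 (besselH l) (x * y / (2 * s)) = 0 := by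
  have h := besselH_ode hl 0 (x * y / (2 * s))
  simp only [zero_add, Nat.cast_zero, add_zero] at h
  field_simp at h
  linear_combination h

lemma heat_equation (hl : -(1 / 2) < l) {s x : ℝ} (hs : 0 < s) (hx : 0 < x) (y : ℝ) :
    dX (dX (heatK l)) (s, x, y) + 2 * l / x * dX (heatK l) (s, x, y) = dS (heatK l) (s, x, y) := by
  rw [dX_dX_heatK hl hs, dX_heatK hl hs, dS_heatK hl hs]
  have h := besselH_ode_quot hl hs x y
  generalize iteratedDeriv 0 (besselH l) (x * y / (2 * s)) = h0 at h ⊢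
  generalize iteratedDeriv 1 (besselH l) (x * y / (2 * s)) = h1 at h ⊢
  generalize iteratedDeriv 2 (besselH l) (x * y / (2 * s)) = h2 at h ⊢
  field_simp
  linear_combination (4 * heatFactor l s x y * y) * h

/-- Applying δ* to the odd kernel produces a y-derivative of the even kernel, where no factor 1/x is
left. -/
lemma star_heatB (hl : -(1 / 2) < l) {s x : ℝ} (hs : 0 < s) (hx : 0 < x) (y : ℝ) :
    dX (heatB l) (s, x, y) + 2 * l / x * heatB l (s, x, y) = -dY (heatK l) (s, x, y) := by
  rw [dX_heatB hl hs, dY_heatK hl hs, heatB_eq_factor hl]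
  have h := besselH_ode_quot hl hs x y
  generalize iteratedDeriv 0 (besselH l) (x * y / (2 * s)) = h0 at h ⊢
  generalize iteratedDeriv 1 (besselH l) (x * y / (2 * s)) = h1 at h ⊢
  generalize iteratedDeriv 2 (besselH l) (x * y / (2 * s)) = h2 at h ⊢
  field_simp
  linear_combination (heatFactor l s x y) * h

/-- Combined with `star_heatB` it gives δδ* B = ∂_s B, the heat equation of the odd kernel. -/
lemma dX_dY_heatK_eq (hl : -(1 / 2) < l) {s : ℝ} (hs : 0 < s) (x y : ℝ) :
    dX (dY (heatK l)) (s, x, y) = -dS (heatB l) (s, x, y) := by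
  rw [dX_dY_heatK hl hs, dS_heatB hl hs]
  have h := besselH_ode_quot hl hs x y
  generalize iteratedDeriv 0 (besselH l) (x * y / (2 * s)) = h0 at h ⊢
  generalize iteratedDeriv 1 (besselH l) (x * y / (2 * s)) = h1 at h ⊢
  generalize iteratedDeriv 2 (besselH l) (x * y / (2 * s)) = h2 at h ⊢
  field_simp
  linear_combination (-4 * heatFactor l s x y) * h

lemma heat_equation_iterate (hl : -(1 / 2) < l) (i : ℕ) {s x : ℝ} (hs : 0 < s) (hx : 0 < x)
    (y : ℝ) : dX (dX (dS^[i] (heatK l))) (s, x, y) + 2 * l / x * dX (dS^[i] (heatK l)) (s, x, y) =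
      dS^[i + 1] (heatK l) (s, x, y) := by
  induction i generalizing s with
  | zero => exact heat_equation hl hs hx y
  | succ i ih =>
    have hK := (heatClass_heatK l).iterate_dS hl i
    rw [Function.iterate_succ_apply' _ i, Function.iterate_succ_apply' _ (i + 1), hK.dX_dS hl hs,
      dX_congr (fun v hv => hK.dX_dS hl hv) hs, (hK.dX hl).dX_dS hl hs]
    exact dS_relation (fun s hs => ((hK.dX hl).dX hl).differentiableAt hl hs)
      (fun s hs => (hK.dX hl).differentiableAt hl hs)
      (fun s hs => ((heatClass_heatK l).iterate_dS hl (i + 1)).differentiableAt hl hs)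
      (fun s hs => ih hs) hs

lemma star_heatB_iterate (hl : -(1 / 2) < l) (i : ℕ) {s x : ℝ} (hs : 0 < s) (hx : 0 < x)
    (y : ℝ) : dX (dS^[i] (heatB l)) (s, x, y) + 2 * l / x * dS^[i] (heatB l) (s, x, y) =
      -dY (dS^[i] (heatK l)) (s, x, y) := by
  induction i generalizing s with
  | zero => exact star_heatB hl hs hx y
  | succ i ih =>
    have hK := (heatClass_heatK l).iterate_dS hl i
    have hB := (heatClass_heatB hl).iterate_dS hl i
    rw [Function.iterate_succ_apply' _ i, Function.iterate_succ_apply' _ i, hB.dX_dS hl hs,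
      hK.dY_dS hl hs]
    have h := dS_relation (c := 2 * l / x) (x := x) (y := y)
      (T := fun v => -dY (dS^[i] (heatK l)) v)
      (fun s hs => (hB.dX hl).differentiableAt hl hs)
      (fun s hs => hB.differentiableAt hl hs)
      (fun s hs => (hK.dY hl).neg.differentiableAt hl hs)
      (fun s hs => ih hs) hs
    rw [h]
    simp only [dS]
    rw [fderiv_fun_neg]; rfl

lemma dX_dY_iterate (hl : -(1 / 2) < l) (i : ℕ) {s : ℝ} (hs : 0 < s) (x y : ℝ) :
    dX (dY (dS^[i] (heatK l))) (s, x, y) = -dS^[i + 1] (heatB l) (s, x, y) := by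
  induction i generalizing s with
  | zero => exact dX_dY_heatK_eq hl hs x y
  | succ i ih =>
    have hK := (heatClass_heatK l).iterate_dS hl i
    have hB := (heatClass_heatB hl).iterate_dS hl (i + 1)
    rw [Function.iterate_succ_apply' _ i, Function.iterate_succ_apply' _ (i + 1),
      dX_congr (fun v hv => hK.dY_dS hl hv) hs, (hK.dY hl).dX_dS hl hs]
    have h := dS_relation (c := 0) (x := x) (y := y) (R := heatK l)
      (T := fun v => -dS^[i + 1] (heatB l) v)
      (fun s hs => ((hK.dY hl).dX hl).differentiableAt hl hs)
      (fun s hs => (heatClass_heatK l).differentiableAt hl hs)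
      (fun s hs => hB.neg.differentiableAt hl hs)
      (fun s hs => by rw [ih hs]; ring) hs
    rw [zero_mul, add_zero] at h
    rw [h]
    simp only [dS]
    rw [fderiv_fun_neg]; rfl

end Identities

/-- The one-dimensional derivatives `δ_{e, m}` of the heat-Bessel kernels. -/
def heatD (l : ℝ) (e : Fin 2) (m : ℕ) : ℝ × ℝ × ℝ → ℝ :=
  if e = 0 then
    if Even m then dS^[m / 2] (heatK l) else dX (dS^[(m - 1) / 2] (heatK l))
  else
    if Even m then dS^[m / 2] (heatB l) else fun v => -dY (dS^[(m - 1) / 2] (heatK l)) v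

/-- A pair of space derivatives has become one derivative in s, of weight 1; an unpaired one is a
single x- or y-derivative, of weight 1/2. -/
lemma heatClass_heatD {l : ℝ} (hl : -(1 / 2) < l) (e : Fin 2) (m : ℕ) :
    HeatClass l ((m : ℝ) / 2) (heatD l e m) := by
  unfold heatD
  have hE : Even m → (0 : ℝ) + ((m / 2 : ℕ) : ℝ) = (m : ℝ) / 2 := by
    rintro ⟨k, rfl⟩
    rw [show (k + k) / 2 = k by omega]; push_cast; ring
  have hO : ¬Even m → (0 : ℝ) + (((m - 1) / 2 : ℕ) : ℝ) + 1 / 2 = (m : ℝ) / 2 := by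
    intro h
    obtain ⟨k, rfl⟩ := Nat.not_even_iff_odd.1 h
    rw [show (2 * k + 1 - 1) / 2 = k by omega]; push_cast; ring
  split_ifs with h1 h2 h2
  · rw [← hE h2]; exact (heatClass_heatK l).iterate_dS hl _
  · rw [← hO h2]; exact ((heatClass_heatK l).iterate_dS hl _).dX hl
  · rw [← hE h2]; exact (heatClass_heatB hl).iterate_dS hl _
  · rw [← hO h2]; exact (((heatClass_heatK l).iterate_dS hl _).dY hl).neg

end DunklBessel

end

/-! ### Growth of the measure of balls, and pointwise bounds for the subordination integrand. -/

noncomputable section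

namespace DunklBessel

open Filter Topology
open scoped ContDiff

/-- Up to constants, the `wPlus lam` measure of a ball of centre `x` and radius `r`. -/
def bulk {n : ℕ} (lam : Fin n → ℝ) (x : EuclideanSpace ℝ (Fin n)) (r : ℝ) : ℝ :=
  ∏ j, r * (r + x j) ^ (2 * lam j)

/-- The two sides have ratio (R/r) ρ^(2l), where ρ = (R+x)/(r+x) lies between 1 and R/r. The sign of
l decides which end is extremal, and a positive ε is available because 1 + 2l > 0. -/
lemma bulkOne_growth {l ε A x r R : ℝ} (hx : 0 < x) (hr : 0 < r) (hrR : r ≤ R)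
    (hε1 : ε ≤ 1) (hε2 : ε ≤ 1 + 2 * l) (hA1 : 1 ≤ A) (hA2 : 1 + 2 * l ≤ A) :
    (R / r) ^ ε * (r * (r + x) ^ (2 * l)) ≤ R * (R + x) ^ (2 * l) ∧
      R * (R + x) ^ (2 * l) ≤ (R / r) ^ A * (r * (r + x) ^ (2 * l)) := by
  have hR : 0 < R := hr.trans_le hrR
  have hq : 1 ≤ R / r := by rwa [one_le_div hr]
  have hq0 : 0 < R / r := by positivity
  set ρ := (R + x) / (r + x) with hρ
  have hρ1 : 1 ≤ ρ := by rw [hρ, one_le_div (by positivity)]; linarith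
  have hρ0 : 0 < ρ := by linarith
  have hρq : ρ ≤ R / r := by
    rw [hρ, div_le_div_iff₀ (by positivity) hr]; nlinarith
  have e : R * (R + x) ^ (2 * l) = (R / r * ρ ^ (2 * l)) * (r * (r + x) ^ (2 * l)) := by
    rw [hρ, Real.div_rpow (by positivity) (by positivity)]
    have : (r + x) ^ (2 * l) ≠ 0 := by positivity
    field_simp
  have hpow : (R / r) ^ (1 + 2 * l) = R / r * (R / r) ^ (2 * l) := by
    rw [Real.rpow_add hq0, Real.rpow_one]
  rw [e]
  rcases le_total 0 l with h | h
  · constructor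
    · gcongr
      calc (R / r) ^ ε ≤ (R / r) ^ (1 : ℝ) := Real.rpow_le_rpow_of_exponent_le hq hε1
        _ = R / r * 1 := by rw [Real.rpow_one, mul_one]
        _ ≤ _ := by gcongr; exact Real.one_le_rpow hρ1 (by linarith)
    · gcongr
      calc R / r * ρ ^ (2 * l) ≤ R / r * (R / r) ^ (2 * l) := by gcongr
        _ = (R / r) ^ (1 + 2 * l) := hpow.symm
        _ ≤ _ := Real.rpow_le_rpow_of_exponent_le hq hA2
  · constructor
    · gcongr
      calc (R / r) ^ ε ≤ (R / r) ^ (1 + 2 * l) := Real.rpow_le_rpow_of_exponent_le hq hε2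
        _ = R / r * (R / r) ^ (2 * l) := hpow
        _ ≤ _ := mul_le_mul_of_nonneg_left
          (Real.rpow_le_rpow_of_nonpos hρ0 hρq (by linarith)) hq0.le
    · gcongr
      calc R / r * ρ ^ (2 * l) ≤ R / r * 1 := by
            gcongr
            exact Real.rpow_le_one_of_one_le_of_nonpos hρ1 (by linarith)
        _ = (R / r) ^ (1 : ℝ) := by rw [Real.rpow_one, mul_one]
        _ ≤ _ := Real.rpow_le_rpow_of_exponent_le hq hA1

variable {n : ℕ} {lam : Fin n → ℝ}

lemma bulk_pos {x : EuclideanSpace ℝ (Fin n)} (hx : x ∈ posOrthant n) {r : ℝ} (hr : 0 < r) :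
    0 < bulk lam x r :=
  Finset.prod_pos fun j _ => mul_pos hr (Real.rpow_pos_of_pos (add_pos hr (hx j)) _)

lemma exists_pos_le_of_fin (f : Fin n → ℝ) (hf : ∀ j, 0 < f j) :
    ∃ ε : ℝ, 0 < ε ∧ ε ≤ 1 ∧ ∀ j, ε ≤ f j := by
  rcases isEmpty_or_nonempty (Fin n) with h | h
  · exact ⟨1, one_pos, le_rfl, fun j => (h.false j).elim⟩
  · obtain ⟨i, hi⟩ := Finite.exists_min f
    exact ⟨min 1 (f i), lt_min one_pos (hf i), min_le_left _ _,
      fun j => (min_le_right _ _).trans (hi j)⟩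

/-- Reverse doubling and doubling for `bulk`. -/
lemma bulk_growth (hn : 1 ≤ n) (hlam : ∀ j, -(1 / 2) < lam j) :
    ∃ ε A : ℝ, 0 < ε ∧ 0 < A ∧ ∀ x ∈ posOrthant n, ∀ r R : ℝ, 0 < r → r ≤ R →
      (R / r) ^ ε * bulk lam x r ≤ bulk lam x R ∧ bulk lam x R ≤ (R / r) ^ A * bulk lam x r := by
  obtain ⟨ε, hε, hε1, hεj⟩ := exists_pos_le_of_fin (fun j => 1 + 2 * lam j)
    (fun j => by linarith [hlam j])
  set A := 1 + ∑ j, |2 * lam j| with hA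
  have hA1 : 1 ≤ A := by
    have : 0 ≤ ∑ j, |2 * lam j| := Finset.sum_nonneg fun j _ => abs_nonneg _
    linarith
  have hAj : ∀ j, 1 + 2 * lam j ≤ A := fun j => by
    have := Finset.single_le_sum (f := fun j => |2 * lam j|) (fun j _ => abs_nonneg _)
      (Finset.mem_univ j)
    have h2 := le_abs_self (2 * lam j)
    linarith
  have hn' : (0 : ℝ) < n := by exact_mod_cast hn
  -- Each of the n factors contributes once to the exponents; n ≥ 1 makes them positive.
  refine ⟨ε * n, A * n, by positivity, by positivity, fun x hx r R hr hrR => ?_⟩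
  have hq : 0 < R / r := div_pos (hr.trans_le hrR) hr
  have e : ∀ p : ℝ, (R / r) ^ (p * n) * bulk lam x r =
      ∏ j, (R / r) ^ p * (r * (r + x j) ^ (2 * lam j)) := by
    intro p
    rw [Finset.prod_mul_distrib, Finset.prod_const, Finset.card_univ, Fintype.card_fin,
      Real.rpow_mul_natCast hq.le]
    rfl
  have hj := fun j => bulkOne_growth (hx j) hr hrR hε1 (hεj j) hA1 (hAj j)
  have hRp := hr.trans_le hrR
  constructor
  · rw [e]
    refine Finset.prod_le_prod (fun j _ => ?_) fun j _ => (hj j).1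
    have := hx j
    positivity
  · rw [e]
    refine Finset.prod_le_prod (fun j _ => ?_) fun j _ => (hj j).2
    have := hx j
    positivity

/-- Comparison of `bulk` at two centres. -/
lemma bulk_le_of_close (lam : Fin n → ℝ) {c : ℝ} (hc : 1 ≤ c) :
    ∃ C : ℝ, 0 < C ∧ ∀ x ∈ posOrthant n, ∀ x' ∈ posOrthant n, ∀ r : ℝ, 0 < r →
      (∀ j, r + x j ≤ c * (r + x' j) ∧ r + x' j ≤ c * (r + x j)) →
      bulk lam x r ≤ C * bulk lam x' r := by
  refine ⟨∏ j, c ^ |2 * lam j|, by positivity, fun x hx x' hx' r hr h => ?_⟩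
  rw [bulk, bulk, ← Finset.prod_mul_distrib]
  refine Finset.prod_le_prod (fun j _ => ?_) fun j _ => ?_
  · have := hx j
    positivity
  · have h1 := hx j
    have h2 := hx' j
    rw [mul_left_comm]
    gcongr
    exact rpow_le_of_le_mul (by positivity) (by positivity) hc (h j).1 (h j).2 _

/-- The profile of the subordination density. -/
def subProfile (v : ℝ) : ℝ := v * Real.exp (-v ^ 2 / 4) / (2 * Real.sqrt Real.pi)

lemma iteratedDeriv_subProfile (K : ℕ) : ∃ p : Polynomial ℝ,
    iteratedDeriv K subProfile = fun v => p.eval v * Real.exp (-v ^ 2 / 4) := by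
  induction K with
  | zero =>
    refine ⟨Polynomial.C (1 / (2 * Real.sqrt Real.pi)) * Polynomial.X, funext fun v => ?_⟩
    simp [subProfile]; ring
  | succ K ih =>
    obtain ⟨p, hp⟩ := ih
    refine ⟨p.derivative - Polynomial.C (1 / 2) * Polynomial.X * p, ?_⟩
    rw [iteratedDeriv_succ, hp]
    funext v
    have h1 := (((hasDerivAt_id v).pow 2).neg.div_const 4).exp
    refine HasDerivAt.deriv (((p.hasDerivAt v).mul h1).congr_deriv ?_)
    simp
    ring

lemma contDiff_iteratedDeriv_subProfile (K : ℕ) : ContDiff ℝ ∞ (iteratedDeriv K subProfile) := by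
  obtain ⟨p, hp⟩ := iteratedDeriv_subProfile K
  have h : (fun v : ℝ => p.eval v) = fun v => Polynomial.aeval v p := by
    funext v; rw [Polynomial.coe_aeval_eq_eval]
  rw [hp]
  refine ContDiff.mul (by rw [h]; exact p.contDiff_aeval ∞) (Real.contDiff_exp.comp ((contDiff_id.pow 2).neg.div_const 4))

lemma iteratedDeriv_subProfile_le (K : ℕ) :
    ∃ C : ℝ, 0 < C ∧ ∀ v : ℝ, 0 ≤ v → |iteratedDeriv K subProfile v| ≤ C * Real.exp (-v ^ 2 / 8) := by
  obtain ⟨p, hp⟩ := iteratedDeriv_subProfile K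
  obtain ⟨C, hC, hb⟩ := exists_one_add_pow_mul_exp_le p.natDegree
  set S := ∑ i ∈ Finset.range (p.natDegree + 1), |p.coeff i| with hS
  have hS0 : 0 ≤ S := Finset.sum_nonneg fun i _ => abs_nonneg _
  refine ⟨(S + 1) * C, by positivity, fun v hv => ?_⟩
  have h1 : |p.eval v| ≤ S * (1 + v) ^ p.natDegree := by
    rw [Polynomial.eval_eq_sum_range, hS, Finset.sum_mul]
    refine (Finset.abs_sum_le_sum_abs _ _).trans (Finset.sum_le_sum fun i hi => ?_)
    rw [abs_mul, abs_pow, abs_of_nonneg hv]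
    gcongr
    calc v ^ i ≤ (1 + v) ^ i := by gcongr; linarith
      _ ≤ _ := pow_le_pow_right₀ (by linarith) (by rw [Finset.mem_range] at hi; omega)
  rw [hp]
  simp only
  rw [abs_mul, abs_of_pos (Real.exp_pos _)]
  have e : Real.exp (-v ^ 2 / 4) = Real.exp (-v ^ 2 / 8) * Real.exp (-v ^ 2 / 8) := by
    rw [← Real.exp_add]; congr 1; ring
  calc |p.eval v| * Real.exp (-v ^ 2 / 4)
      ≤ S * (1 + v) ^ p.natDegree * (Real.exp (-v ^ 2 / 8) * Real.exp (-v ^ 2 / 8)) := by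
        rw [e]; gcongr
    _ = S * ((1 + v) ^ p.natDegree * Real.exp (-v ^ 2 / 8)) * Real.exp (-v ^ 2 / 8) := by ring
    _ ≤ (S + 1) * C * Real.exp (-v ^ 2 / 8) := by
        gcongr
        · linarith
        · exact hb v hv

/-- The `K`th time derivative of the subordination density. -/
def subDens (K : ℕ) (t s : ℝ) : ℝ :=
  s ^ (-(1 + (K : ℝ) / 2)) * iteratedDeriv K subProfile (t / Real.sqrt s)

lemma hasDerivAt_subDens (K : ℕ) (t : ℝ) {s : ℝ} (hs : 0 < s) :
    HasDerivAt (fun t => subDens K t s) (subDens (K + 1) t s) t := by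
  have h1 : HasDerivAt (iteratedDeriv K subProfile)
      (iteratedDeriv (K + 1) subProfile (t / Real.sqrt s)) (t / Real.sqrt s) := by
    rw [iteratedDeriv_succ]
    exact ((contDiff_iteratedDeriv_subProfile K).differentiable (by simp) _).hasDerivAt
  refine ((HasDerivAt.comp t (h := fun t => t / Real.sqrt s) h1
    ((hasDerivAt_id t).div_const (Real.sqrt s))).const_mul _).congr_deriv ?_
  rw [subDens, Real.sqrt_eq_rpow,
    show -(1 + ((K + 1 : ℕ) : ℝ) / 2) = -(1 + (K : ℝ) / 2) - 1 / 2 by push_cast; ring,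
    Real.rpow_sub hs]
  ring

/-- The integrand defining the Poisson-type kernels. -/
def kerInt (K : ℕ) (F : Fin n → ℝ × ℝ × ℝ → ℝ) (t : ℝ) (x y : EuclideanSpace ℝ (Fin n))
    (s : ℝ) : ℝ := subDens K t s * ∏ j, F j (s, x j, y j)

/-- Kernels subordinated to products of one-dimensional kernels. -/
def subKer (K : ℕ) (F : Fin n → ℝ × ℝ × ℝ → ℝ) (t : ℝ) (x y : EuclideanSpace ℝ (Fin n)) : ℝ :=
  ∫ s in Ioi (0 : ℝ), kerInt K F t x y s

/-- An integrable majorant on the half-line, concentrated around `b`. -/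
def majorant (ε b s : ℝ) : ℝ := if s ≤ b then b ^ (-ε) * s ^ (ε - 1) else b ^ ε * s ^ (-ε - 1)

lemma integrable_majorant {ε b : ℝ} (hε : 0 < ε) (hb : 0 < b) :
    IntegrableOn (majorant ε b) (Ioi 0) ∧ ∫ s in Ioi (0 : ℝ), majorant ε b s = 2 / ε := by
  have e1 : EqOn (majorant ε b) (fun s => b ^ (-ε) * s ^ (ε - 1)) (Ioc 0 b) := fun s hs => by
    simp [majorant, hs.2]
  have e2 : EqOn (majorant ε b) (fun s => b ^ ε * s ^ (-ε - 1)) (Ioi b) := fun s hs => by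
    simp [majorant, not_le.2 (mem_Ioi.1 hs)]
  have i1 : IntegrableOn (majorant ε b) (Ioc 0 b) := by
    refine IntegrableOn.congr_fun ?_ e1.symm measurableSet_Ioc
    exact ((intervalIntegrable_iff_integrableOn_Ioc_of_le hb.le).1
      (intervalIntegral.intervalIntegrable_rpow' (by linarith))).const_mul _
  have i2 : IntegrableOn (majorant ε b) (Ioi b) := by
    refine IntegrableOn.congr_fun ?_ e2.symm measurableSet_Ioi
    exact (integrableOn_Ioi_rpow_of_lt (by linarith) hb).const_mul _
  have hU : Ioc 0 b ∪ Ioi b = Ioi 0 := Ioc_union_Ioi_eq_Ioi hb.le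
  refine ⟨hU ▸ i1.union i2, ?_⟩
  rw [← hU, setIntegral_union (Ioc_disjoint_Ioi le_rfl) measurableSet_Ioi i1 i2,
    setIntegral_congr_fun measurableSet_Ioc e1, setIntegral_congr_fun measurableSet_Ioi e2,
    integral_const_mul, integral_const_mul, ← intervalIntegral.integral_of_le hb.le,
    integral_rpow (Or.inl (by linarith)), integral_Ioi_rpow_of_lt (by linarith) hb,
    sub_add_cancel, sub_add_cancel, Real.zero_rpow hε.ne', Real.rpow_neg hb.le]
  have : b ^ ε ≠ 0 := by positivity
  field_simp
  norm_num
  ring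

/-- The exponential is flat at u = 0 and beats every negative power. -/
lemma exp_neg_inv_mul_rpow_le (p q : ℝ) : ∃ C : ℝ, 0 < C ∧ ∀ u : ℝ, 0 < u → u ≤ 1 →
    u ^ (-p) * Real.exp (-(1 / (16 * u))) ≤ C * u ^ q := by
  obtain ⟨k, hk⟩ := exists_nat_ge (p + q)
  refine ⟨k.factorial * 16 ^ k, by positivity, fun u hu hu1 => ?_⟩
  have h := Real.pow_div_factorial_le_exp (1 / (16 * u)) (by positivity) k
  have h2 : Real.exp (-(1 / (16 * u))) ≤ k.factorial * 16 ^ k * u ^ k := by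
    rw [Real.exp_neg, inv_le_comm₀ (Real.exp_pos _) (by positivity)]
    refine le_trans (le_of_eq ?_) h
    rw [div_pow, one_pow, mul_pow]
    field_simp
  calc u ^ (-p) * Real.exp (-(1 / (16 * u))) ≤ u ^ (-p) * (k.factorial * 16 ^ k * u ^ k) := by gcongr
    _ = k.factorial * 16 ^ k * u ^ ((k : ℝ) - p) := by
        rw [sub_eq_add_neg, Real.rpow_add hu, Real.rpow_natCast]; ring
    _ ≤ _ := by
        gcongr ?_ * ?_
        exact Real.rpow_le_rpow_of_exponent_ge hu hu1 (by linarith)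

lemma euclid_sq_eq (x y : EuclideanSpace ℝ (Fin n)) : ‖x - y‖ ^ 2 = ∑ j, (x j - y j) ^ 2 := by
  rw [EuclideanSpace.real_norm_sq_eq]; rfl

/-- The pointwise bound for the integrands, in terms of `bulk`. -/
theorem kerInt_le (hn : 1 ≤ n) (hlam : ∀ j, -(1 / 2) < lam j) :
    ∃ ε : ℝ, 0 < ε ∧ ∀ (K : ℕ) (κ : Fin n → ℝ) (F : Fin n → ℝ × ℝ × ℝ → ℝ),
      (∀ j, 0 ≤ κ j) → (∀ j, HeatClass (lam j) (κ j) (F j)) →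
      ∃ C : ℝ, 0 < C ∧ ∀ (t r s : ℝ), ∀ x ∈ posOrthant n, ∀ y ∈ posOrthant n,
        0 < t → 0 < s → 0 < r → r ≤ t + ‖x - y‖ →
        |kerInt K F t x y s| ≤
          C * (r ^ (-(K + 2 * ∑ j, κ j)) / bulk lam x r) * majorant ε (r ^ 2) s := by
  obtain ⟨ε, A, hε, hA, hbulk⟩ := bulk_growth hn hlam
  refine ⟨ε / 2, by positivity, fun K κ F hκ hF => ?_⟩
  choose C hC hCb using fun j => (hF j).le (hlam j)
  obtain ⟨C0, hC0, hCb0⟩ := iteratedDeriv_subProfile_le K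
  set N : ℝ := K + 2 * ∑ j, κ j with hN
  have hN0 : 0 ≤ N := by
    have := Finset.sum_nonneg fun j (_ : j ∈ Finset.univ) => hκ j
    positivity
  -- N/2 is the homogeneity, A/2 the doubling loss, and ε/2 the decay that `majorant` asks for.
  obtain ⟨C1, hC1, hCb1⟩ := exp_neg_inv_mul_rpow_le (N / 2 + A / 2) (ε / 2)
  refine ⟨C0 * (∏ j, C j) * (C1 + 1), by
    have : 0 < ∏ j, C j := Finset.prod_pos fun j _ => hC j
    positivity, fun t r s x hx y hy ht hs hr hrt => ?_⟩
  set P := ∏ j, C j with hP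
  have hPpos : 0 < P := Finset.prod_pos fun j _ => hC j
  have hσ : 0 < Real.sqrt s := Real.sqrt_pos.2 hs
  have hb0 := bulk_pos (lam := lam) hx hσ
  have hbr := bulk_pos (lam := lam) hx hr
  have hprod : |∏ j, F j (s, x j, y j)| ≤
      P * (s ^ (-∑ j, κ j) / bulk lam x (Real.sqrt s)) * Real.exp (-‖x - y‖ ^ 2 / (8 * s)) := by
    rw [Finset.abs_prod]
    refine (Finset.prod_le_prod (fun j _ => abs_nonneg _)
      fun j _ => hCb j s (x j) (y j) hs (hx j) (hy j)).trans (le_of_eq ?_)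
    rw [Finset.prod_mul_distrib, Finset.prod_mul_distrib, Finset.prod_mul_distrib, ← Real.exp_sum,
      mul_assoc P, div_eq_mul_inv (s ^ (-∑ j, κ j)), bulk, ← Finset.prod_inv_distrib]
    congr 1
    congr 1
    · congr 1
      · rw [← Finset.sum_neg_distrib, Real.rpow_sum_of_pos hs]
      · refine Finset.prod_congr rfl fun j _ => ?_
        rw [mul_inv, Real.rpow_neg hs.le, ← Real.sqrt_eq_rpow,
          Real.rpow_neg (by have := hx j; positivity)]
    · rw [euclid_sq_eq, ← Finset.sum_div, Finset.sum_neg_distrib]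
  have hdens : |subDens K t s| ≤ s ^ (-(1 + (K : ℝ) / 2)) * (C0 * Real.exp (-t ^ 2 / (8 * s))) := by
    rw [subDens, abs_mul, abs_of_pos (Real.rpow_pos_of_pos hs _)]
    gcongr
    refine (hCb0 _ (by positivity)).trans (le_of_eq ?_)
    rw [div_pow, Real.sq_sqrt hs.le]
    congr 2
    field_simp
  set u := s / r ^ 2 with hu
  have hu0 : 0 < u := by positivity
  have hsu : s = u * r ^ 2 := by rw [hu]; field_simp
  -- Since r ≤ t + |x-y|, one has t^2 + |x-y|^2 ≥ r^2/2.
  have hexp : Real.exp (-t ^ 2 / (8 * s)) * Real.exp (-‖x - y‖ ^ 2 / (8 * s)) ≤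
      Real.exp (-(1 / (16 * u))) := by
    rw [← Real.exp_add]
    gcongr
    rw [hsu, ← add_div, div_le_iff₀ (by positivity)]
    have : -(1 / (16 * u)) * (8 * (u * r ^ 2)) = -(r ^ 2 / 2) := by field_simp; norm_num
    rw [this]
    nlinarith [sq_nonneg (t - ‖x - y‖), norm_nonneg (x - y)]
  have hpow : s ^ (-(1 + (K : ℝ) / 2)) * s ^ (-∑ j, κ j) = r ^ (-N) * (s⁻¹ * u ^ (-(N / 2))) := by
    have e1 : u ^ (-(N / 2)) = s ^ (-(N / 2)) * r ^ N := by
      rw [hu, Real.div_rpow hs.le (by positivity), ← Real.rpow_natCast r 2, ← Real.rpow_mul hr.le,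
        div_eq_mul_inv, ← Real.rpow_neg hr.le]
      congr 2; push_cast; ring
    rw [e1, ← Real.rpow_neg_one s, ← Real.rpow_add hs]
    rw [show r ^ (-N) * (s ^ (-1 : ℝ) * (s ^ (-(N / 2)) * r ^ N)) =
      (s ^ (-1 : ℝ) * s ^ (-(N / 2))) * (r ^ (-N) * r ^ N) by ring, ← Real.rpow_add hs,
      ← Real.rpow_add hr]
    rw [neg_add_cancel, Real.rpow_zero, mul_one]
    congr 1; rw [hN]; ring
  have hsq : Real.sqrt s / r = u ^ (1 / 2 : ℝ) := by
    rw [hu, ← Real.sqrt_eq_rpow, Real.sqrt_div hs.le, Real.sqrt_sq hr.le]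
  -- For s ≤ r^2 the exponential outweighs the doubling loss. For s ≥ r^2 reverse doubling gives
  -- decay, and it does so even when N = 0.
  have hkey : s⁻¹ * u ^ (-(N / 2)) * Real.exp (-(1 / (16 * u))) / bulk lam x (Real.sqrt s) ≤
      (C1 + 1) * (majorant (ε / 2) (r ^ 2) s / bulk lam x r) := by
    rw [majorant]
    split_ifs with hle
    · have hu1 : u ≤ 1 := by rw [hu, div_le_one (by positivity)]; exact hle
      have hrs : Real.sqrt s ≤ r := by
        rw [← Real.sqrt_sq hr.le]; exact Real.sqrt_le_sqrt hle
      have h1 := (hbulk x hx _ _ hσ hrs).2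
      have e2 : (r / Real.sqrt s) ^ A = u ^ (-(A / 2)) := by
        rw [← inv_div, hsq, Real.inv_rpow (by positivity), ← Real.rpow_mul hu0.le,
          ← Real.rpow_neg hu0.le]
        congr 1; ring
      rw [e2] at h1
      have e3 : (r ^ 2) ^ (-(ε / 2)) * s ^ (ε / 2 - 1) = s⁻¹ * u ^ (ε / 2) := by
        rw [hu, Real.div_rpow hs.le (by positivity), Real.rpow_neg (by positivity),
          Real.rpow_sub_one hs.ne']
        ring
      rw [e3]
      have h2 : 1 / bulk lam x (Real.sqrt s) ≤ u ^ (-(A / 2)) / bulk lam x r := by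
        rw [div_le_div_iff₀ hb0 hbr]; linarith
      have h3 := hCb1 u hu0 hu1
      calc s⁻¹ * u ^ (-(N / 2)) * Real.exp (-(1 / (16 * u))) / bulk lam x (Real.sqrt s)
          = s⁻¹ * u ^ (-(N / 2)) * Real.exp (-(1 / (16 * u))) * (1 / bulk lam x (Real.sqrt s)) := by
            ring
        _ ≤ s⁻¹ * u ^ (-(N / 2)) * Real.exp (-(1 / (16 * u))) * (u ^ (-(A / 2)) / bulk lam x r) := by
            gcongr
        _ = s⁻¹ * (u ^ (-(N / 2 + A / 2)) * Real.exp (-(1 / (16 * u)))) / bulk lam x r := by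
            rw [neg_add, Real.rpow_add hu0]; ring
        _ ≤ s⁻¹ * (C1 * u ^ (ε / 2)) / bulk lam x r := by gcongr
        _ = C1 * (s⁻¹ * u ^ (ε / 2) / bulk lam x r) := by ring
        _ ≤ _ := by gcongr; linarith
    · have hle' : r ^ 2 ≤ s := (not_le.1 hle).le
      have hu1 : 1 ≤ u := by rw [hu, one_le_div (by positivity)]; exact hle'
      have hrs : r ≤ Real.sqrt s := Real.le_sqrt_of_sq_le hle'
      have h1 := (hbulk x hx _ _ hr hrs).1
      have e2 : (Real.sqrt s / r) ^ ε = u ^ (ε / 2) := by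
        rw [hsq, ← Real.rpow_mul hu0.le]
        congr 1; ring
      rw [e2] at h1
      have e3 : (r ^ 2) ^ (ε / 2) * s ^ (-(ε / 2) - 1) = s⁻¹ * u ^ (-(ε / 2)) := by
        rw [hu, Real.div_rpow hs.le (by positivity), Real.rpow_neg (by positivity : 0 ≤ r ^ 2),
          Real.rpow_sub_one hs.ne']
        field_simp
      rw [e3]
      have h2 : 1 / bulk lam x (Real.sqrt s) ≤ u ^ (-(ε / 2)) / bulk lam x r := by
        rw [Real.rpow_neg hu0.le, div_le_div_iff₀ hb0 hbr, one_mul]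
        rw [← div_eq_inv_mul, le_div_iff₀ (by positivity)]; linarith
      have h3 : u ^ (-(N / 2)) ≤ 1 := Real.rpow_le_one_of_one_le_of_nonpos hu1 (by linarith)
      have h4 : Real.exp (-(1 / (16 * u))) ≤ 1 := by
        rw [Real.exp_le_one_iff]
        have : 0 < 1 / (16 * u) := by positivity
        linarith
      calc s⁻¹ * u ^ (-(N / 2)) * Real.exp (-(1 / (16 * u))) / bulk lam x (Real.sqrt s)
          = s⁻¹ * u ^ (-(N / 2)) * Real.exp (-(1 / (16 * u))) * (1 / bulk lam x (Real.sqrt s)) := by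
            ring
        _ ≤ s⁻¹ * 1 * 1 * (u ^ (-(ε / 2)) / bulk lam x r) := by gcongr
        _ = 1 * (s⁻¹ * u ^ (-(ε / 2)) / bulk lam x r) := by ring
        _ ≤ _ := by gcongr; linarith
  rw [kerInt, abs_mul]
  calc |subDens K t s| * |∏ j, F j (s, x j, y j)|
      ≤ s ^ (-(1 + (K : ℝ) / 2)) * (C0 * Real.exp (-t ^ 2 / (8 * s))) *
        (P * (s ^ (-∑ j, κ j) / bulk lam x (Real.sqrt s)) * Real.exp (-‖x - y‖ ^ 2 / (8 * s))) := by
        gcongr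
    _ = C0 * P * (s ^ (-(1 + (K : ℝ) / 2)) * s ^ (-∑ j, κ j)) / bulk lam x (Real.sqrt s) *
        (Real.exp (-t ^ 2 / (8 * s)) * Real.exp (-‖x - y‖ ^ 2 / (8 * s))) := by ring
    _ ≤ C0 * P * (s ^ (-(1 + (K : ℝ) / 2)) * s ^ (-∑ j, κ j)) / bulk lam x (Real.sqrt s) *
        Real.exp (-(1 / (16 * u))) := by gcongr
    _ = C0 * P * r ^ (-N) *
        (s⁻¹ * u ^ (-(N / 2)) * Real.exp (-(1 / (16 * u))) / bulk lam x (Real.sqrt s)) := by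
        rw [hpow]; ring
    _ ≤ C0 * P * r ^ (-N) * ((C1 + 1) * (majorant (ε / 2) (r ^ 2) s / bulk lam x r)) := by gcongr
    _ = _ := by ring

end DunklBessel

end

/-! ### Size and differentiability of the subordinated kernels. -/

noncomputable section

namespace DunklBessel

open Filter Topology
open scoped ContDiff
variable {n : ℕ} {lam : Fin n → ℝ}

lemma exists_measurable_kerInt (hlam : ∀ j, -(1 / 2) < lam j) (K : ℕ) {κ : Fin n → ℝ}
    {F : Fin n → ℝ × ℝ × ℝ → ℝ} (hF : ∀ j, HeatClass (lam j) (κ j) (F j)) :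
    ∃ H : (ℝ × EuclideanSpace ℝ (Fin n) × EuclideanSpace ℝ (Fin n)) × ℝ → ℝ, Measurable H ∧
      ∀ t x y s, 0 < s → kerInt K F t x y s = H ((t, x, y), s) := by
  choose G hGm hGe using fun j => (hF j).exists_measurable (hlam j)
  refine ⟨fun p => subDens K p.1.1 p.2 * ∏ j, G j (p.2, p.1.2.1 j, p.1.2.2 j), ?_,
    fun t x y s hs => ?_⟩
  · have h1 := (contDiff_iteratedDeriv_subProfile K).continuous.measurable
    refine Measurable.mul ?_ (Finset.measurable_prod _ fun j _ => (hGm j).comp ?_)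
    · unfold subDens
      fun_prop
    · fun_prop
  · rw [kerInt]
    congr 1
    exact Finset.prod_congr rfl fun j _ => hGe j _ hs

lemma measurable_subKer (hlam : ∀ j, -(1 / 2) < lam j) (K : ℕ) {κ : Fin n → ℝ}
    {F : Fin n → ℝ × ℝ × ℝ → ℝ} (hF : ∀ j, HeatClass (lam j) (κ j) (F j)) :
    Measurable fun p : ℝ × EuclideanSpace ℝ (Fin n) × EuclideanSpace ℝ (Fin n) =>
      subKer K F p.1 p.2.1 p.2.2 := by
  obtain ⟨H, hH, he⟩ := exists_measurable_kerInt hlam K hF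
  have : (fun p : ℝ × EuclideanSpace ℝ (Fin n) × EuclideanSpace ℝ (Fin n) =>
      subKer K F p.1 p.2.1 p.2.2) = fun p => ∫ s in Ioi (0 : ℝ), H (p, s) := by
    funext p
    exact setIntegral_congr_fun measurableSet_Ioi fun s hs => he _ _ _ s hs
  rw [this]
  exact hH.stronglyMeasurable.integral_prod_right'.measurable

lemma aestronglyMeasurable_kerInt (hlam : ∀ j, -(1 / 2) < lam j) (K : ℕ) {κ : Fin n → ℝ}
    {F : Fin n → ℝ × ℝ × ℝ → ℝ} (hF : ∀ j, HeatClass (lam j) (κ j) (F j)) (t : ℝ)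
    (x y : EuclideanSpace ℝ (Fin n)) :
    AEStronglyMeasurable (kerInt K F t x y) (volume.restrict (Ioi 0)) := by
  obtain ⟨H, hH, he⟩ := exists_measurable_kerInt hlam K hF
  refine ⟨fun s => H ((t, x, y), s), (hH.comp (by fun_prop)).stronglyMeasurable, ?_⟩
  filter_upwards [ae_restrict_mem measurableSet_Ioi] with s hs
  exact he t x y s hs

/-- Local uniform domination of the integrands. -/
lemma exists_local_bound (hn : 1 ≤ n) (hlam : ∀ j, -(1 / 2) < lam j) (K : ℕ) {κ : Fin n → ℝ}
    {F : Fin n → ℝ × ℝ × ℝ → ℝ} (hκ : ∀ j, 0 ≤ κ j) (hF : ∀ j, HeatClass (lam j) (κ j) (F j))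
    {t : ℝ} (ht : 0 < t) {x : EuclideanSpace ℝ (Fin n)} (hx : x ∈ posOrthant n) :
    ∃ g : ℝ → ℝ, IntegrableOn g (Ioi 0) ∧ ∀ t' : ℝ, ∀ x' ∈ posOrthant n, ∀ y' ∈ posOrthant n,
      t / 2 ≤ t' → (∀ j, x j ≤ 2 * x' j ∧ x' j ≤ 2 * x j) → ∀ s, 0 < s →
      |kerInt K F t' x' y' s| ≤ g s := by
  obtain ⟨ε, hε, h⟩ := kerInt_le hn hlam
  obtain ⟨C, hC, hb⟩ := h K κ F hκ hF
  obtain ⟨D, hD, hDb⟩ := bulk_le_of_close lam one_le_two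
  -- The scale r = t/2 is admissible in `kerInt_le` for all the points concerned, uniformly in y'.
  have hr : 0 < t / 2 := by positivity
  refine ⟨fun s => C * ((t / 2) ^ (-(K + 2 * ∑ j, κ j)) * (D / bulk lam x (t / 2))) *
    majorant ε ((t / 2) ^ 2) s, (integrable_majorant hε (by positivity)).1.const_mul _,
    fun t' x' hx' y' hy' ht' hxx s hs => ?_⟩
  refine (hb t' (t / 2) s x' hx' y' hy' (by linarith) hs hr
    (by linarith [norm_nonneg (x' - y')])).trans ?_
  have hm : 0 ≤ majorant ε ((t / 2) ^ 2) s := by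
    rw [majorant]; split_ifs <;> positivity
  have h1 := hDb x hx x' hx' (t / 2) hr fun j => by
    have := hxx j
    constructor <;> linarith
  have p1 := bulk_pos (lam := lam) hx hr
  have p2 := bulk_pos (lam := lam) hx' hr
  have h2 : 1 / bulk lam x' (t / 2) ≤ D / bulk lam x (t / 2) := by
    rw [div_le_div_iff₀ p2 p1]; linarith
  beta_reduce
  rw [div_eq_mul_one_div ((t / 2) ^ (-(K + 2 * ∑ j, κ j)))]
  gcongr

lemma integrableOn_kerInt (hn : 1 ≤ n) (hlam : ∀ j, -(1 / 2) < lam j) (K : ℕ) {κ : Fin n → ℝ}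
    {F : Fin n → ℝ × ℝ × ℝ → ℝ} (hκ : ∀ j, 0 ≤ κ j) (hF : ∀ j, HeatClass (lam j) (κ j) (F j))
    {t : ℝ} (ht : 0 < t) {x y : EuclideanSpace ℝ (Fin n)} (hx : x ∈ posOrthant n)
    (hy : y ∈ posOrthant n) : IntegrableOn (kerInt K F t x y) (Ioi 0) := by
  obtain ⟨g, hg, hb⟩ := exists_local_bound hn hlam K hκ hF ht hx
  refine Integrable.mono' hg (aestronglyMeasurable_kerInt hlam K hF t x y) ?_
  filter_upwards [ae_restrict_mem measurableSet_Ioi] with s hs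
  exact hb t x hx y hy (by linarith) (fun j => by have := hx j; constructor <;> linarith) s hs

/-- Size estimate for the subordinated kernels. -/
theorem subKer_le (hn : 1 ≤ n) (hlam : ∀ j, -(1 / 2) < lam j) (K : ℕ) {κ : Fin n → ℝ}
    {F : Fin n → ℝ × ℝ × ℝ → ℝ} (hκ : ∀ j, 0 ≤ κ j) (hF : ∀ j, HeatClass (lam j) (κ j) (F j)) :
    ∃ C : ℝ, 0 < C ∧ ∀ (t r : ℝ), ∀ x ∈ posOrthant n, ∀ y ∈ posOrthant n,
      0 < t → 0 < r → r ≤ t + ‖x - y‖ →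
      |subKer K F t x y| ≤ C * (r ^ (-(K + 2 * ∑ j, κ j)) / bulk lam x r) := by
  obtain ⟨ε, hε, h⟩ := kerInt_le hn hlam
  obtain ⟨C, hC, hb⟩ := h K κ F hκ hF
  refine ⟨C * (2 / ε), by positivity, fun t r x hx y hy ht hr hrt => ?_⟩
  have hm := integrable_majorant (b := r ^ 2) hε (by positivity)
  have h1 := norm_integral_le_of_norm_le (hm.1.const_mul
    (C * (r ^ (-(K + 2 * ∑ j, κ j)) / bulk lam x r))) (f := kerInt K F t x y) (by
      filter_upwards [ae_restrict_mem measurableSet_Ioi] with s hs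
      exact hb t r s x hx y hy ht hs hr hrt)
  rw [integral_const_mul, hm.2] at h1
  refine h1.trans (le_of_eq ?_)
  ring

lemma prod_update_apply (F : Fin n → ℝ × ℝ × ℝ → ℝ) (j : Fin n) (G : ℝ × ℝ × ℝ → ℝ)
    (p : Fin n → ℝ × ℝ × ℝ) :
    ∏ i, Function.update F j G i (p i) = (∏ i ∈ Finset.univ.erase j, F i (p i)) * G (p j) := by
  rw [← Finset.prod_erase_mul _ _ (Finset.mem_univ j), Function.update_self]
  congr 1
  refine Finset.prod_congr rfl fun i hi => ?_
  rw [Function.update_of_ne (Finset.ne_of_mem_erase hi)]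

lemma heatClass_update {κ : Fin n → ℝ} {F : Fin n → ℝ × ℝ × ℝ → ℝ}
    (hF : ∀ j, HeatClass (lam j) (κ j) (F j)) (j : Fin n) {a : ℝ} {G : ℝ × ℝ × ℝ → ℝ}
    (hG : HeatClass (lam j) a G) (i : Fin n) :
    HeatClass (lam i) (Function.update κ j a i) (Function.update F j G i) := by
  rcases eq_or_ne i j with rfl | h
  · simpa using hG
  · simpa [h] using hF i

lemma update_nonneg {κ : Fin n → ℝ} (hκ : ∀ j, 0 ≤ κ j) (j : Fin n) {a : ℝ} (ha : 0 ≤ a)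
    (i : Fin n) : 0 ≤ Function.update κ j a i := by
  rcases eq_or_ne i j with rfl | h
  · simpa using ha
  · simpa [h] using hκ i

/-- The derivative of a subordinated kernel along a line in all its variables. -/
theorem hasDerivAt_subKer (hn : 1 ≤ n) (hlam : ∀ j, -(1 / 2) < lam j) (K : ℕ) {κ : Fin n → ℝ}
    {F : Fin n → ℝ × ℝ × ℝ → ℝ} (hκ : ∀ j, 0 ≤ κ j) (hF : ∀ j, HeatClass (lam j) (κ j) (F j))
    {t : ℝ} (ht : 0 < t) {x y : EuclideanSpace ℝ (Fin n)} (hx : x ∈ posOrthant n)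
    (hy : y ∈ posOrthant n) (a : ℝ) (v w : EuclideanSpace ℝ (Fin n)) :
    HasDerivAt (fun τ : ℝ => subKer K F (t + τ * a) (x + τ • v) (y + τ • w))
      (a * subKer (K + 1) F t x y +
        ∑ j, (v j * subKer K (Function.update F j (dX (F j))) t x y +
          w j * subKer K (Function.update F j (dY (F j))) t x y)) 0 := by
  have hFX := fun j => heatClass_update hF j ((hF j).dX (hlam j))
  have hFY := fun j => heatClass_update hF j ((hF j).dY (hlam j))
  have hκ' := fun j => update_nonneg hκ j (a := κ j + 1 / 2) (by linarith [hκ j])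
  obtain ⟨g0, hg0, hb0⟩ := exists_local_bound hn hlam (K + 1) hκ hF ht hx
  choose gX hgX hbX using fun j => exists_local_bound hn hlam K (hκ' j) (hFX j) ht hx
  choose gY hgY hbY using fun j => exists_local_bound hn hlam K (hκ' j) (hFY j) ht hx
  set D : ℝ → ℝ → ℝ := fun τ s => a * kerInt (K + 1) F (t + τ * a) (x + τ • v) (y + τ • w) s +
    ∑ j, (v j * kerInt K (Function.update F j (dX (F j))) (t + τ * a) (x + τ • v) (y + τ • w) s +
      w j * kerInt K (Function.update F j (dY (F j))) (t + τ * a) (x + τ • v) (y + τ • w) s)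
    with hD
  -- For small τ both points stay in the orthant, and those near x keep coordinates within a factor
  -- two, as the local majorants require.
  have hnear : ∀ᶠ τ : ℝ in 𝓝 0, t / 2 ≤ t + τ * a ∧
      ∀ j, x j / 2 ≤ x j + τ * v j ∧ x j + τ * v j ≤ 2 * x j ∧ y j / 2 ≤ y j + τ * w j := by
    have hc : ∀ b c : ℝ, Tendsto (fun τ : ℝ => b + τ * c) (𝓝 0) (𝓝 b) := by
      intro b c
      have : ContinuousAt (fun τ : ℝ => b + τ * c) 0 := by fun_prop
      simpa using this.tendsto
    refine ((hc t a).eventually_const_le (by linarith)).and (eventually_all.2 fun j => ?_)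
    have h1 := hx j
    have h2 := hy j
    exact ((hc _ _).eventually_const_le (by linarith)).and
      (((hc _ _).eventually_le_const (by linarith)).and
        ((hc _ _).eventually_const_le (by linarith)))
  have hX : ∀ τ : ℝ, (∀ j, x j / 2 ≤ x j + τ * v j ∧ x j + τ * v j ≤ 2 * x j ∧
      y j / 2 ≤ y j + τ * w j) → x + τ • v ∈ posOrthant n ∧ y + τ • w ∈ posOrthant n := by
    intro τ h
    constructor <;> intro j
    · have := hx j; have := (h j).1
      simp only [PiLp.add_apply, PiLp.smul_apply, smul_eq_mul]; linarith
    · have := hy j; have := (h j).2.2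
      simp only [PiLp.add_apply, PiLp.smul_apply, smul_eq_mul]; linarith
  have hder : ∀ τ : ℝ, ∀ s : ℝ, 0 < s →
      HasDerivAt (fun τ => kerInt K F (t + τ * a) (x + τ • v) (y + τ • w) s) (D τ s) τ := by
    intro τ s hs
    have hline : ∀ b c : ℝ, HasDerivAt (fun τ : ℝ => b + τ * c) c τ := fun b c => by
      simpa using ((hasDerivAt_id τ).mul_const c).const_add b
    have h1 := HasDerivAt.comp τ (h := fun τ : ℝ => t + τ * a)
      (hasDerivAt_subDens K (t + τ * a) hs) (hline t a)
    have h2 : ∀ j, HasDerivAt (fun τ => F j (s, (x + τ • v) j, (y + τ • w) j))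
        (v j * dX (F j) (s, (x + τ • v) j, (y + τ • w) j) +
          w j * dY (F j) (s, (x + τ • v) j, (y + τ • w) j)) τ := by
      intro j
      simp only [PiLp.add_apply, PiLp.smul_apply, smul_eq_mul]
      have hd := ((hF j).differentiableAt (hlam j)
        (v := (s, x j + τ * v j, y j + τ * w j)) hs).hasFDerivAt
      have hp := (hasDerivAt_const τ s).prodMk ((hline (x j) (v j)).prodMk (hline (y j) (w j)))
      refine (HasFDerivAt.comp_hasDerivAt τ (f := fun τ => (s, x j + τ * v j, y j + τ * w j))
        hd hp).congr_deriv ?_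
      rw [show ((0 : ℝ), v j, w j) = v j • ((0 : ℝ), (1 : ℝ), (0 : ℝ)) +
        w j • ((0 : ℝ), (0 : ℝ), (1 : ℝ)) by simp, map_add, map_smul, map_smul]
      rfl
    refine (h1.mul (HasDerivAt.fun_finsetProd fun j _ => h2 j)).congr_deriv ?_
    simp only [hD, kerInt, prod_update_apply, Function.comp_apply, smul_eq_mul, Finset.mul_sum]
    congr 1
    · ring
    · refine Finset.sum_congr rfl fun j _ => ?_
      ring
  have key := hasDerivAt_integral_of_dominated_loc_of_deriv_le (μ := volume.restrict (Ioi (0 : ℝ)))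
    (F := fun τ s => kerInt K F (t + τ * a) (x + τ • v) (y + τ • w) s) (F' := D) (x₀ := (0 : ℝ))
    (bound := fun s => |a| * g0 s + ∑ j, (|v j| * gX j s + |w j| * gY j s)) hnear
    (Eventually.of_forall fun τ => aestronglyMeasurable_kerInt hlam K hF _ _ _)
    (by simpa only [zero_mul, add_zero, zero_smul] using!
      integrableOn_kerInt hn hlam K hκ hF ht hx hy) ?_ ?_ ?_ ?_
  · refine key.2.congr_deriv ?_
    have i0 := integrableOn_kerInt hn hlam (K + 1) hκ hF ht hx hy
    have iX := fun j => integrableOn_kerInt hn hlam K (hκ' j) (hFX j) ht hx hy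
    have iY := fun j => integrableOn_kerInt hn hlam K (hκ' j) (hFY j) ht hx hy
    simp only [hD, zero_mul, add_zero, zero_smul]
    have iS : ∀ j, Integrable (fun s => v j * kerInt K (Function.update F j (dX (F j))) t x y s +
        w j * kerInt K (Function.update F j (dY (F j))) t x y s) (volume.restrict (Ioi 0)) :=
      fun j => ((iX j).const_mul _).add ((iY j).const_mul _)
    rw [integral_add (i0.const_mul a) (integrable_finsetSum _ fun j _ => iS j),
      integral_finsetSum _ fun j _ => iS j, integral_const_mul]
    congr 1
    refine Finset.sum_congr rfl fun j _ => ?_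
    rw [integral_add ((iX j).const_mul _) ((iY j).const_mul _), integral_const_mul,
      integral_const_mul]
    rfl
  · simp only [hD]
    refine ((aestronglyMeasurable_kerInt hlam (K + 1) hF _ _ _).const_mul a).add
      (Finset.aestronglyMeasurable_fun_sum _ fun j _ => ?_)
    exact ((aestronglyMeasurable_kerInt hlam K (hFX j) _ _ _).const_mul _).add
      ((aestronglyMeasurable_kerInt hlam K (hFY j) _ _ _).const_mul _)
  · filter_upwards [ae_restrict_mem measurableSet_Ioi] with s hs τ hτ
    obtain ⟨p1, p2⟩ := hX τ hτ.2
    have hj : ∀ j, x j ≤ 2 * (x + τ • v) j ∧ (x + τ • v) j ≤ 2 * x j := fun j => by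
      have := hτ.2 j
      simp only [PiLp.add_apply, PiLp.smul_apply, smul_eq_mul]
      constructor <;> linarith
    simp only [hD, Real.norm_eq_abs]
    refine (abs_add_le _ _).trans (add_le_add ?_ ((Finset.abs_sum_le_sum_abs _ _).trans
      (Finset.sum_le_sum fun j _ => (abs_add_le _ _).trans (add_le_add ?_ ?_))))
    · rw [abs_mul]
      gcongr
      exact hb0 _ _ p1 _ p2 hτ.1 hj s hs
    · rw [abs_mul]
      gcongr
      exact hbX j _ _ p1 _ p2 hτ.1 hj s hs
    · rw [abs_mul]
      gcongr
      exact hbY j _ _ p1 _ p2 hτ.1 hj s hs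
  · exact (hg0.const_mul _).add (integrable_finsetSum _ fun j _ =>
      ((hgX j).const_mul _).add ((hgY j).const_mul _))
  · filter_upwards [ae_restrict_mem measurableSet_Ioi] with s hs τ _
    exact hder τ s hs

end DunklBessel

end

/-! ### The Lusin kernel as a subordinated kernel. -/

noncomputable section

namespace DunklBessel

open Filter Topology
open scoped ContDiff
variable {n : ℕ} {lam : Fin n → ℝ}

/-- Writing x^2 + y^2 = (x-y)^2 + 2xy, the factor exp(-xy/2s) is exactly the scaling in `besselH`.
-/
lemma heatK_eq_besselI (l : ℝ) {s x y : ℝ} (hs : 0 < s) (hx : 0 < x) (hy : 0 < y) :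
    1 / (2 * s) * Real.exp (-(1 / (4 * s)) * (x ^ 2 + y ^ 2)) *
      ((x * y) ^ (-l + 1 / 2) * besselI (l - 1 / 2) (x * y / (2 * s))) = heatK l (s, x, y) := by
  have hw : 0 < x * y / (2 * s) := by positivity
  have h2s : 0 < 2 * s := by positivity
  have e1 : Real.exp (-(1 / (4 * s)) * (x ^ 2 + y ^ 2)) =
      Real.exp (-(x - y) ^ 2 / (4 * s)) * Real.exp (-(x * y / (2 * s))) := by
    rw [← Real.exp_add]; congr 1; field_simp; ring
  have e2 : (x * y) ^ (-l + 1 / 2) = ((x * y) ^ (l - 1 / 2))⁻¹ := by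
    rw [← Real.rpow_neg (by positivity)]; congr 1; ring
  have e3 : (2 : ℝ) ^ (-(l + 1 / 2)) * s ^ (-(l + 1 / 2)) =
      1 / (2 * s) * ((2 * s) ^ (l - 1 / 2))⁻¹ := by
    rw [← Real.mul_rpow (by norm_num) hs.le, ← Real.rpow_neg h2s.le, one_div (2 * s),
      ← Real.rpow_neg_one (2 * s),
      ← Real.rpow_add h2s]
    congr 1; ring
  rw [besselI_eq hw, heatK_apply, besselH, e1, e2, e3, Real.div_rpow (by positivity) h2s.le]
  have : (x * y) ^ (l - 1 / 2) ≠ 0 := by positivity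
  field_simp

lemma heatB_eq_heatK (l : ℝ) {s : ℝ} (hs : 0 < s) (x y : ℝ) :
    heatB l (s, x, y) = x * y * heatK (l + 1) (s, x, y) := by
  rw [heatK_apply, heatB, show -(l + 1 + 1 / 2) = -(l + 1 / 2) - 1 by ring,
    Real.rpow_sub_one hs.ne', Real.rpow_sub_one two_ne_zero]
  field_simp

lemma heatBessel_eq (lam : Fin n → ℝ) {s : ℝ} (hs : 0 < s) {x y : EuclideanSpace ℝ (Fin n)}
    (hx : x ∈ posOrthant n) (hy : y ∈ posOrthant n) :
    heatBessel lam s x y = ∏ j, heatK (lam j) (s, x j, y j) := by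
  rw [heatBessel, ← Finset.prod_congr rfl fun j _ => heatK_eq_besselI (lam j) hs (hx j) (hy j)]
  simp only [Finset.prod_mul_distrib, Finset.prod_const, Finset.card_univ, Fintype.card_fin,
    ← Real.exp_sum, ← Finset.mul_sum, Finset.sum_add_distrib, EuclideanSpace.real_norm_sq_eq,
    one_div_pow]

lemma heatKer_eq (lam : Fin n → ℝ) (η : Fin n → Fin 2) {s : ℝ} (hs : 0 < s)
    {x y : EuclideanSpace ℝ (Fin n)} (hx : x ∈ posOrthant n) (hy : y ∈ posOrthant n) :
    heatKer lam η s x y = ∏ j, heatD (lam j) (η j) 0 (s, x j, y j) := by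
  rw [heatKer, heatBessel_eq _ hs hx hy, ← Finset.prod_mul_distrib]
  refine Finset.prod_congr rfl fun j _ => ?_
  rcases Fin.exists_fin_two.1 ⟨η j, rfl⟩ with h | h
  · simp [heatD, h]
  · simp [heatD, h, heatB_eq_heatK _ hs]

/-- The substitution u = t^2/(4s), carried out as a dilation followed by an inversion, makes the
heat time s the variable of integration. -/
lemma poissonKer_eq (lam : Fin n → ℝ) (η : Fin n → Fin 2) {t : ℝ} (ht : 0 < t)
    {x y : EuclideanSpace ℝ (Fin n)} (hx : x ∈ posOrthant n) (hy : y ∈ posOrthant n) :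
    poissonKer lam η t x y = subKer 0 (fun j => heatD (lam j) (η j) 0) t x y := by
  have hb : 0 < t ^ 2 / 4 := by positivity
  rw [poissonKer, subKer]
  set g := fun u : ℝ => heatKer lam η (t ^ 2 / (4 * u)) x y *
    (Real.exp (-u) / Real.sqrt (Real.pi * u)) with hg
  have h1 := integral_comp_mul_left_Ioi g 0 hb
  have h2 := integral_comp_rpow_Ioi (fun v => g (t ^ 2 / 4 * v)) (p := -1) (by norm_num)
  rw [mul_zero] at h1
  rw [h1, smul_eq_mul, eq_inv_mul_iff_mul_eq₀ hb.ne', ← integral_const_mul] at h2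
  rw [← h2]
  refine setIntegral_congr_fun measurableSet_Ioi fun s hs => ?_
  have hs : 0 < s := hs
  simp only [hg, kerInt, subDens, iteratedDeriv_zero, subProfile, smul_eq_mul]
  rw [Real.rpow_neg_one, ← heatKer_eq lam η hs hx hy]
  have e1 : t ^ 2 / (4 * (t ^ 2 / 4 * s⁻¹)) = s := by field_simp
  have e2 : -(t ^ 2 / 4 * s⁻¹) = -(t / Real.sqrt s) ^ 2 / 4 := by
    rw [div_pow, Real.sq_sqrt hs.le]; field_simp
  have e3 : Real.sqrt (Real.pi * (t ^ 2 / 4 * s⁻¹)) =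
      Real.sqrt Real.pi * (t / 2) / Real.sqrt s := by
    rw [show Real.pi * (t ^ 2 / 4 * s⁻¹) = Real.pi * (t / 2) ^ 2 / s by field_simp; ring,
      Real.sqrt_div (by positivity), Real.sqrt_mul Real.pi_pos.le, Real.sqrt_sq (by positivity)]
  have e4 : s ^ (-1 - 1 : ℝ) = 1 / s ^ 2 := by
    rw [show (-1 - 1 : ℝ) = -(2 : ℕ) by norm_num, Real.rpow_neg hs.le, Real.rpow_natCast, one_div]
  have e5 : s ^ (-(1 + ((0 : ℕ) : ℝ) / 2)) = s⁻¹ := by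
    rw [← Real.rpow_neg_one]; norm_num
  have hpi : Real.sqrt Real.pi ≠ 0 := (Real.sqrt_pos.2 Real.pi_pos).ne'
  have hsq : Real.sqrt s ≠ 0 := (Real.sqrt_pos.2 hs).ne'
  have hsq2 : s = Real.sqrt s ^ 2 := (Real.sq_sqrt hs.le).symm
  rw [e1, e2, e3, e4, e5, abs_neg, abs_one]
  generalize heatKer lam η s x y = H
  generalize Real.exp (-(t / Real.sqrt s) ^ 2 / 4) = E
  generalize Real.sqrt s = q at *
  subst hsq2
  field_simp
  norm_num
  ring

lemma isOpen_posOrthant (n : ℕ) : IsOpen (posOrthant n) := by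
  have : posOrthant n = ⋂ j, {x : EuclideanSpace ℝ (Fin n) | 0 < x j} := by
    ext x; simp [posOrthant]
  rw [this]
  exact isOpen_iInter_of_finite fun j => isOpen_lt continuous_const (by fun_prop)

/-- Families of one-dimensional kernels to which subordination can be applied. -/
def Admissible (lam : Fin n → ℝ) (F : Fin n → ℝ × ℝ × ℝ → ℝ) : Prop :=
  ∃ κ : Fin n → ℝ, (∀ j, 0 ≤ κ j) ∧ ∀ j, HeatClass (lam j) (κ j) (F j)

lemma Admissible.update {F : Fin n → ℝ × ℝ × ℝ → ℝ} (hF : Admissible lam F) (j : Fin n)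
    {a : ℝ} (ha : 0 ≤ a) {G : ℝ × ℝ × ℝ → ℝ} (hG : HeatClass (lam j) a G) :
    Admissible lam (Function.update F j G) := by
  obtain ⟨κ, hκ, h⟩ := hF
  exact ⟨Function.update κ j a, update_nonneg hκ j ha, heatClass_update h j hG⟩

/-- Agreement on the orthant is enough, because the orthant is open and the derivative is local.
This lets the operators be applied one after another. -/
lemma deltaJ_of_eqOn (hn : 1 ≤ n) (hlam : ∀ j, -(1 / 2) < lam j) {F : Fin n → ℝ × ℝ × ℝ → ℝ}
    (hF : Admissible lam F) {t : ℝ} (ht : 0 < t) {y : EuclideanSpace ℝ (Fin n)}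
    (hy : y ∈ posOrthant n) {f : EuclideanSpace ℝ (Fin n) → ℝ}
    (hf : EqOn f (fun x => subKer 0 F t x y) (posOrthant n)) (j : Fin n) :
    EqOn (deltaJ j f) (fun x => subKer 0 (Function.update F j (dX (F j))) t x y)
      (posOrthant n) := by
  obtain ⟨κ, hκ, h⟩ := hF
  intro x hx
  have h1 := hasDerivAt_subKer hn hlam 0 hκ h ht hx hy 0 (EuclideanSpace.single j (1 : ℝ)) 0
  simp only [mul_zero, add_zero, smul_zero, zero_mul, zero_add, PiLp.zero_apply,
    PiLp.single_apply, ite_mul, one_mul, Finset.sum_ite_eq', Finset.mem_univ,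
    if_true] at h1
  have h2 : HasLineDerivAt ℝ f (subKer 0 (Function.update F j (dX (F j))) t x y) x
      (EuclideanSpace.single j (1 : ℝ)) := by
    refine HasDerivAt.congr_of_eventuallyEq h1 ?_
    have hc : ContinuousAt (fun τ : ℝ => x + τ • EuclideanSpace.single j (1 : ℝ)) 0 := by fun_prop
    have hm : posOrthant n ∈ 𝓝 (x + (0 : ℝ) • EuclideanSpace.single j (1 : ℝ)) := by
      simpa using (isOpen_posOrthant n).mem_nhds hx
    filter_upwards [hc hm] with τ hτ
    exact hf hτ
  exact h2.lineDeriv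

/-- The singular term is combined with the derivative under the integral sign, where `hG` replaces
the sum by a regular kernel. -/
lemma deltaStarJ_of_eqOn (hn : 1 ≤ n) (hlam : ∀ j, -(1 / 2) < lam j)
    {F : Fin n → ℝ × ℝ × ℝ → ℝ} (hF : Admissible lam F) {t : ℝ} (ht : 0 < t)
    {y : EuclideanSpace ℝ (Fin n)} (hy : y ∈ posOrthant n) {f : EuclideanSpace ℝ (Fin n) → ℝ}
    (hf : EqOn f (fun x => subKer 0 F t x y) (posOrthant n)) (j : Fin n) {G : ℝ × ℝ × ℝ → ℝ}
    (hG : ∀ s x y : ℝ, 0 < s → 0 < x →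
      dX (F j) (s, x, y) + 2 * lam j / x * F j (s, x, y) = G (s, x, y)) :
    EqOn (deltaStarJ lam j f) (fun x => subKer 0 (Function.update F j G) t x y)
      (posOrthant n) := by
  intro x hx
  have h1 := deltaJ_of_eqOn hn hlam hF ht hy hf j hx
  simp only [deltaJ] at h1
  obtain ⟨κ, hκ, h⟩ := hF
  have i1 := integrableOn_kerInt hn hlam 0 (update_nonneg hκ j (a := κ j + 1 / 2)
    (by linarith [hκ j])) (heatClass_update h j ((h j).dX (hlam j))) ht hx hy
  have i2 := integrableOn_kerInt hn hlam 0 hκ h ht hx hy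
  simp only [deltaStarJ]
  rw [h1, hf hx]
  simp only [subKer]
  rw [← integral_const_mul, ← integral_add i1 (i2.const_mul _)]
  refine setIntegral_congr_fun measurableSet_Ioi fun s hs => ?_
  simp only [kerInt, prod_update_apply]
  rw [← hG s (x j) (y j) hs (hx j), ← Finset.prod_erase_mul _ _ (Finset.mem_univ j)]
  ring

lemma subKer_congr {F G : Fin n → ℝ × ℝ × ℝ → ℝ}
    {t : ℝ} {x y : EuclideanSpace ℝ (Fin n)} (K : ℕ)
    (h : ∀ j, ∀ s : ℝ, 0 < s → F j (s, x j, y j) = G j (s, x j, y j)) :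
    subKer K F t x y = subKer K G t x y := by
  refine setIntegral_congr_fun measurableSet_Ioi fun s hs => ?_
  simp only [kerInt]
  rw [Finset.prod_congr rfl fun j _ => h j s hs]

/-- The operators alternate, so two transitions suffice for each parity type: K to ∂_x K to ∂_s K in
the even case, B to -∂_y K to ∂_s B in the odd case, all after any number of s-derivatives. -/
lemma deltaOne_of_eqOn (hn : 1 ≤ n) (hlam : ∀ j, -(1 / 2) < lam j)
    {F : Fin n → ℝ × ℝ × ℝ → ℝ} (hF : Admissible lam F) {t : ℝ} (ht : 0 < t)
    {y : EuclideanSpace ℝ (Fin n)} (hy : y ∈ posOrthant n) {f : EuclideanSpace ℝ (Fin n) → ℝ}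
    (hf : EqOn f (fun x => subKer 0 F t x y) (posOrthant n)) (j : Fin n) (e : Fin 2) (m : ℕ)
    (hFj : F j = heatD (lam j) e 0) :
    EqOn (deltaOne lam j e m f) (fun x => subKer 0 (Function.update F j (heatD (lam j) e m)) t x y)
      (posOrthant n) := by
  have hK := fun i => (heatClass_heatK (lam j)).iterate_dS (hlam j) i
  have hB := fun i => (heatClass_heatB (hlam j)).iterate_dS (hlam j) i
  have hnn : ∀ i : ℕ, (0 : ℝ) ≤ 0 + i := fun i => by positivity
  have hnn' : ∀ i : ℕ, (0 : ℝ) ≤ 0 + i + 1 / 2 := fun i => by positivity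
  have step0 : ∀ (i : ℕ) (g : EuclideanSpace ℝ (Fin n) → ℝ),
      EqOn g (fun x => subKer 0 (Function.update F j (dS^[i] (heatK (lam j)))) t x y)
        (posOrthant n) →
      EqOn (deltaJ j g) (fun x => subKer 0 (Function.update F j (dX (dS^[i] (heatK (lam j))))) t x y)
        (posOrthant n) := by
    intro i g hg
    simpa using deltaJ_of_eqOn hn hlam (hF.update j (hnn i) (hK i)) ht hy hg j
  have step0' : ∀ (i : ℕ) (g : EuclideanSpace ℝ (Fin n) → ℝ),
      EqOn g (fun x => subKer 0 (Function.update F j (dX (dS^[i] (heatK (lam j))))) t x y)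
        (posOrthant n) →
      EqOn (deltaStarJ lam j g)
        (fun x => subKer 0 (Function.update F j (dS^[i + 1] (heatK (lam j)))) t x y)
        (posOrthant n) := by
    intro i g hg
    simpa using deltaStarJ_of_eqOn hn hlam (hF.update j (hnn' i) ((hK i).dX (hlam j))) ht hy hg j
      (G := dS^[i + 1] (heatK (lam j))) (fun s x y hs hx => by
        simpa using heat_equation_iterate (hlam j) i hs hx y)
  have step1 : ∀ (i : ℕ) (g : EuclideanSpace ℝ (Fin n) → ℝ),
      EqOn g (fun x => subKer 0 (Function.update F j (dS^[i] (heatB (lam j)))) t x y)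
        (posOrthant n) →
      EqOn (deltaStarJ lam j g)
        (fun x => subKer 0 (Function.update F j (fun v => -dY (dS^[i] (heatK (lam j))) v)) t x y)
        (posOrthant n) := by
    intro i g hg
    simpa using deltaStarJ_of_eqOn hn hlam (hF.update j (hnn i) (hB i)) ht hy hg j
      (G := fun v => -dY (dS^[i] (heatK (lam j))) v) (fun s x y hs hx => by
        simpa using star_heatB_iterate (hlam j) i hs hx y)
  have step1' : ∀ (i : ℕ) (g : EuclideanSpace ℝ (Fin n) → ℝ),
      EqOn g (fun x => subKer 0 (Function.update F j (fun v => -dY (dS^[i] (heatK (lam j))) v)) t x y)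
        (posOrthant n) →
      EqOn (deltaJ j g)
        (fun x => subKer 0 (Function.update F j (dS^[i + 1] (heatB (lam j)))) t x y)
        (posOrthant n) := by
    intro i g hg x hx
    have h := deltaJ_of_eqOn hn hlam (hF.update j (hnn' i) ((hK i).dY (hlam j)).neg) ht hy hg j hx
    simp only [Function.update_self, Function.update_idem] at h
    rw [h]
    refine subKer_congr 0 fun i' s hs => ?_
    rcases eq_or_ne i' j with rfl | hne
    · simp only [Function.update_self]
      have h3 := dX_dY_iterate (hlam i') i hs (x i') (y i')
      simp only [dX] at h3 ⊢
      rw [fderiv_fun_neg, _root_.neg_apply, h3, neg_neg]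
    · simp [hne]
  have iter0 : ∀ i : ℕ, e = 0 →
      EqOn ((fun g => deltaStarJ lam j (deltaJ j g))^[i] f)
        (fun x => subKer 0 (Function.update F j (dS^[i] (heatK (lam j)))) t x y)
        (posOrthant n) := by
    intro i he
    induction i with
    | zero =>
      have : Function.update F j (heatK (lam j)) = F := by
        rw [Function.update_eq_self_iff, hFj, he]; simp [heatD]
      simpa [this] using hf
    | succ i ih =>
      rw [Function.iterate_succ_apply']
      exact step0' i _ (step0 i _ ih)
  have iter1 : ∀ i : ℕ, e ≠ 0 →
      EqOn ((fun g => deltaJ j (deltaStarJ lam j g))^[i] f)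
        (fun x => subKer 0 (Function.update F j (dS^[i] (heatB (lam j)))) t x y)
        (posOrthant n) := by
    intro i he
    induction i with
    | zero =>
      have : Function.update F j (heatB (lam j)) = F := by
        rw [Function.update_eq_self_iff, hFj]; simp [heatD, he]
      simpa [this] using hf
    | succ i ih =>
      rw [Function.iterate_succ_apply']
      exact step1' i _ (step1 i _ ih)
  unfold deltaOne heatD
  split_ifs with h1 h2 h2
  · exact iter0 _ h1
  · exact step0 _ _ (iter0 _ h1)
  · exact iter1 _ h1
  · exact step1 _ _ (iter1 _ h1)

lemma admissible_heatD (hlam : ∀ j, -(1 / 2) < lam j) (η : Fin n → Fin 2) (M : Fin n → ℕ) :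
    Admissible lam (fun j => heatD (lam j) (η j) (M j)) :=
  ⟨fun j => (M j : ℝ) / 2, fun j => by positivity, fun j => heatClass_heatD (hlam j) _ _⟩

lemma deltaOp_poissonKer (hn : 1 ≤ n) (hlam : ∀ j, -(1 / 2) < lam j) (η : Fin n → Fin 2)
    (M : Fin n → ℕ) {t : ℝ} (ht : 0 < t) {y : EuclideanSpace ℝ (Fin n)} (hy : y ∈ posOrthant n) :
    EqOn (deltaOp lam η M (fun x => poissonKer lam η t x y))
      (fun x => subKer 0 (fun j => heatD (lam j) (η j) (M j)) t x y) (posOrthant n) := by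
  -- The coordinates in `L` are those already differentiated. Absence of repetitions guarantees that
  -- the next one is still of order zero.
  have key : ∀ L : List (Fin n), L.Nodup →
      EqOn (L.foldr (fun j g => deltaOne lam j (η j) (M j) g) (fun x => poissonKer lam η t x y))
        (fun x => subKer 0 (fun j => heatD (lam j) (η j) (if j ∈ L then M j else 0)) t x y)
        (posOrthant n) := by
    intro L hL
    induction L with
    | nil => intro x hx; simpa using poissonKer_eq lam η ht hx hy
    | cons j L ih =>
      have hj := List.nodup_cons.1 hL
      have h := deltaOne_of_eqOn hn hlam (admissible_heatD hlam η (fun i => if i ∈ L then M i else 0))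
        ht hy (ih hj.2) j (η j) (M j) (by simp [hj.1])
      rw [List.foldr_cons]
      have e : Function.update (fun j => heatD (lam j) (η j) (if j ∈ L then M j else 0)) j
          (heatD (lam j) (η j) (M j)) =
          fun i => heatD (lam i) (η i) (if i ∈ j :: L then M i else 0) := by
        funext i
        rcases eq_or_ne i j with rfl | hne
        · simp
        · simp [hne]
      rwa [e] at h
  have h := key (List.finRange n) (List.nodup_finRange n)
  simpa [deltaOp] using h

lemma iteratedDeriv_subKer (hn : 1 ≤ n) (hlam : ∀ j, -(1 / 2) < lam j)
    {F : Fin n → ℝ × ℝ × ℝ → ℝ} (hF : Admissible lam F) {x y : EuclideanSpace ℝ (Fin n)}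
    (hx : x ∈ posOrthant n) (hy : y ∈ posOrthant n) {f : ℝ → ℝ}
    (hf : ∀ t, 0 < t → f t = subKer 0 F t x y) (K : ℕ) {t : ℝ} (ht : 0 < t) :
    iteratedDeriv K f t = subKer K F t x y := by
  obtain ⟨κ, hκ, h⟩ := hF
  induction K generalizing t with
  | zero => simpa using hf t ht
  | succ K ih =>
    rw [iteratedDeriv_succ]
    have h1 := hasDerivAt_subKer hn hlam K hκ h ht hx hy 1 0 0
    simp only [smul_zero, add_zero, PiLp.zero_apply, zero_mul, Finset.sum_const_zero, one_mul,
      mul_one] at h1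
    rw [← sub_self t] at h1
    have h2 := h1.comp_sub_const t t
    simp only [add_sub_cancel] at h2
    refine HasDerivAt.deriv (h2.congr_of_eventuallyEq ?_)
    filter_upwards [lt_mem_nhds ht] with t' ht'
    exact ih ht'

/-- The kernel of the Lusin area integral in terms of subordinated kernels. -/
theorem lusinKer_eq (hn : 1 ≤ n) (hlam : ∀ j, -(1 / 2) < lam j) (η : Fin n → Fin 2) (K : ℕ)
    (M : Fin n → ℕ) {y : EuclideanSpace ℝ (Fin n)} (hy : y ∈ posOrthant n)
    (x : EuclideanSpace ℝ (Fin n)) (p : EuclideanSpace ℝ (Fin n) × ℝ) (hp : 0 < p.2) :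
    lusinKer lam η K M x y p = subKer K (fun j => heatD (lam j) (η j) (M j)) p.2 (x + p.1) y *
      Real.sqrt (Xi lam x p.1 (p.2 ^ 2)) * (posOrthant n).indicator (fun _ => 1) (x + p.1) := by
  rw [lusinKer]
  by_cases h : x + p.1 ∈ posOrthant n
  · rw [iteratedDeriv_subKer hn hlam (admissible_heatD hlam η M) h hy
      (fun t ht => deltaOp_poissonKer hn hlam η M ht hy h) K hp]
  · simp [h]

end DunklBessel

end

/-! ### Size estimates at a nearby centre, and Lipschitz estimates. -/

noncomputable section

namespace DunklBessel

open Filter Topology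
open scoped ContDiff
variable {n : ℕ} {lam : Fin n → ℝ}

/-- Size estimate for the subordinated kernels, in terms of `bulk` at a nearby centre. -/
theorem subKer_le_of_close (hn : 1 ≤ n) (hlam : ∀ j, -(1 / 2) < lam j) (K : ℕ) {κ : Fin n → ℝ}
    {F : Fin n → ℝ × ℝ × ℝ → ℝ} (hκ : ∀ j, 0 ≤ κ j) (hF : ∀ j, HeatClass (lam j) (κ j) (F j)) :
    ∃ C : ℝ, 0 < C ∧ ∀ (t R : ℝ), ∀ x ∈ posOrthant n, ∀ w ∈ posOrthant n, ∀ y ∈ posOrthant n,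
      0 < t → 0 < R → R ≤ 4 * (t + ‖w - y‖) → (∀ j, |w j - x j| ≤ R) →
      |subKer K F t w y| ≤ C * (R ^ (-(K + 2 * ∑ j, κ j)) / bulk lam x R) := by
  obtain ⟨C, hC, hb⟩ := subKer_le hn hlam K hκ hF
  obtain ⟨ε, A, hε, hA, hbulk⟩ := bulk_growth hn hlam
  obtain ⟨D, hD, hDb⟩ := bulk_le_of_close lam one_le_two
  set N : ℝ := K + 2 * ∑ j, κ j with hN
  -- The size estimate is used at radius R/4, which costs a power of 4 in the homogeneity and 4^A by
  -- doubling; D is the price of moving the centre from w to x.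
  refine ⟨C * (4⁻¹ ^ (-N) * (D * 4 ^ A)), by positivity, fun t R x hx w hw y hy ht hR hRt hwx => ?_⟩
  have hr : 0 < R / 4 := by positivity
  refine (hb t (R / 4) w hw y hy ht hr (by linarith)).trans ?_
  have h1 := (hbulk w hw (R / 4) R hr (by linarith)).2
  rw [show R / (R / 4) = 4 by field_simp] at h1
  have h2 := hDb x hx w hw R hR fun j => by
    have := abs_le.1 (hwx j)
    have h3 := hx j
    have h4 := hw j
    constructor <;> linarith
  have p1 := bulk_pos (lam := lam) hx hR
  have p2 := bulk_pos (lam := lam) hw hr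
  have h3 : 1 / bulk lam w (R / 4) ≤ D * 4 ^ A / bulk lam x R := by
    rw [div_le_div_iff₀ p2 p1, one_mul]
    calc bulk lam x R ≤ D * bulk lam w R := h2
      _ ≤ D * (4 ^ A * bulk lam w (R / 4)) := by gcongr
      _ = _ := by ring
  have h4 : (R / 4) ^ (-N) = 4⁻¹ ^ (-N) * R ^ (-N) := by
    rw [← Real.mul_rpow (by norm_num) hR.le]; congr 1; ring
  calc C * ((R / 4) ^ (-N) / bulk lam w (R / 4))
      = C * (4⁻¹ ^ (-N) * R ^ (-N) * (1 / bulk lam w (R / 4))) := by rw [h4]; ring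
    _ ≤ C * (4⁻¹ ^ (-N) * R ^ (-N) * (D * 4 ^ A / bulk lam x R)) := by gcongr
    _ = _ := by ring

lemma convex_posOrthant (n : ℕ) : Convex ℝ (posOrthant n) := by
  intro x hx y hy a b ha hb hab j
  have h1 := hx j
  have h2 := hy j
  simp only [PiLp.add_apply, PiLp.smul_apply, smul_eq_mul]
  rcases ha.eq_or_lt with rfl | ha
  · rw [zero_add] at hab; subst hab; simpa using h2
  · have := mul_pos ha h1
    have := mul_nonneg hb h2.le
    linarith

lemma add_smul_sub_mem {x y : EuclideanSpace ℝ (Fin n)} (hx : x ∈ posOrthant n)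
    (hy : y ∈ posOrthant n) {τ : ℝ} (h0 : 0 ≤ τ) (h1 : τ ≤ 1) : x + τ • (y - x) ∈ posOrthant n := by
  have := convex_posOrthant n hx hy (a := 1 - τ) (b := τ) (by linarith) h0 (by ring)
  convert this using 1
  rw [smul_sub, sub_smul, one_smul]; abel

/-- Lipschitz estimate for the subordinated kernels. -/
theorem subKer_sub_le (hn : 1 ≤ n) (hlam : ∀ j, -(1 / 2) < lam j) (K : ℕ) {κ : Fin n → ℝ}
    {F : Fin n → ℝ × ℝ × ℝ → ℝ} (hκ : ∀ j, 0 ≤ κ j) (hF : ∀ j, HeatClass (lam j) (κ j) (F j)) :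
    ∃ C : ℝ, 0 < C ∧ ∀ (t R : ℝ), ∀ x ∈ posOrthant n, ∀ w ∈ posOrthant n, ∀ w' ∈ posOrthant n,
      ∀ y ∈ posOrthant n, ∀ y' ∈ posOrthant n, 0 < t → 0 < R →
      (∀ τ : ℝ, 0 ≤ τ → τ ≤ 1 → R ≤ 4 * (t + ‖w + τ • (w' - w) - (y + τ • (y' - y))‖) ∧
        ∀ j, |(w + τ • (w' - w)) j - x j| ≤ R) →
      |subKer K F t w' y' - subKer K F t w y| ≤
        C * (‖w' - w‖ + ‖y' - y‖) * (R ^ (-(K + 2 * ∑ j, κ j + 1)) / bulk lam x R) := by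
  have hFX := fun j => heatClass_update hF j ((hF j).dX (hlam j))
  have hFY := fun j => heatClass_update hF j ((hF j).dY (hlam j))
  have hκ' := fun j => update_nonneg hκ j (a := κ j + 1 / 2) (by linarith [hκ j])
  choose CX hCX hbX using fun j => subKer_le_of_close hn hlam K (hκ' j) (hFX j)
  choose CY hCY hbY using fun j => subKer_le_of_close hn hlam K (hκ' j) (hFY j)
  -- A space derivative raises one κ_j by 1/2, hence the total order by one.
  have hN : ∀ j, (K : ℝ) + 2 * ∑ i, Function.update κ j (κ j + 1 / 2) i =
      K + 2 * ∑ j, κ j + 1 := by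
    intro j
    rw [Finset.sum_update_of_mem (Finset.mem_univ j),
      ← Finset.add_sum_erase _ κ (Finset.mem_univ j), Finset.sdiff_singleton_eq_erase]
    ring
  simp only [hN] at hbX hbY
  refine ⟨(∑ j, (CX j + CY j)) + 1, by
    have : 0 ≤ ∑ j, (CX j + CY j) := Finset.sum_nonneg fun j _ => (add_pos (hCX j) (hCY j)).le
    positivity, fun t R x hx w hw w' hw' y hy y' hy' ht hR h => ?_⟩
  set B := R ^ (-(K + 2 * ∑ j, κ j + 1)) / bulk lam x R with hB
  have hB0 : 0 < B := div_pos (by positivity) (bulk_pos hx hR)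
  have hder : ∀ τ ∈ Icc (0 : ℝ) 1, HasDerivAt
      (fun τ : ℝ => subKer K F t (w + τ • (w' - w)) (y + τ • (y' - y)))
      (∑ j, ((w' - w) j * subKer K (Function.update F j (dX (F j))) t (w + τ • (w' - w))
        (y + τ • (y' - y)) + (y' - y) j * subKer K (Function.update F j (dY (F j))) t
        (w + τ • (w' - w)) (y + τ • (y' - y)))) τ := by
    intro τ hτ
    have h1 := hasDerivAt_subKer hn hlam K hκ hF ht (add_smul_sub_mem hw hw' hτ.1 hτ.2)
      (add_smul_sub_mem hy hy' hτ.1 hτ.2) 0 (w' - w) (y' - y)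
    simp only [mul_zero, add_zero, zero_mul, zero_add] at h1
    -- `hasDerivAt_subKer` differentiates at parameter zero, so the base point is moved along the
    -- segment.
    rw [← sub_self τ] at h1
    have h2 := h1.comp_sub_const τ τ
    have e : ∀ (a b : EuclideanSpace ℝ (Fin n)) (σ : ℝ), a + τ • b + (σ - τ) • b = a + σ • b := by
      intro a b σ; rw [sub_smul]; abel
    simpa only [e] using h2
  have hmain := norm_image_sub_le_of_norm_deriv_le_segment_01'
    (C := ((∑ j, (CX j + CY j)) + 1) * (‖w' - w‖ + ‖y' - y‖) * B)
    (fun τ hτ => (hder τ hτ).hasDerivWithinAt) (fun τ hτ => ?_)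
  · simpa using hmain
  · have hp1 := add_smul_sub_mem hw hw' hτ.1 hτ.2.le
    have hp2 := add_smul_sub_mem hy hy' hτ.1 hτ.2.le
    obtain ⟨h3, h4⟩ := h τ hτ.1 hτ.2.le
    rw [Real.norm_eq_abs]
    calc |∑ j, ((w' - w) j * subKer K (Function.update F j (dX (F j))) t (w + τ • (w' - w))
        (y + τ • (y' - y)) + (y' - y) j * subKer K (Function.update F j (dY (F j))) t
        (w + τ • (w' - w)) (y + τ • (y' - y)))|
        ≤ ∑ j, (CX j + CY j) * ((‖w' - w‖ + ‖y' - y‖) * B) := by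
          refine (Finset.abs_sum_le_sum_abs _ _).trans (Finset.sum_le_sum fun j _ => ?_)
          refine (abs_add_le _ _).trans ?_
          rw [abs_mul, abs_mul]
          have n1 : |(w' - w) j| ≤ ‖w' - w‖ + ‖y' - y‖ :=
            (PiLp.norm_apply_le (w' - w) j).trans (le_add_of_nonneg_right (norm_nonneg _))
          have n2 : |(y' - y) j| ≤ ‖w' - w‖ + ‖y' - y‖ :=
            (PiLp.norm_apply_le (y' - y) j).trans (le_add_of_nonneg_left (norm_nonneg _))
          have b1 := hbX j t R x hx _ hp1 _ hp2 ht hR h3 h4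
          have b2 := hbY j t R x hx _ hp1 _ hp2 ht hR h3 h4
          calc _ ≤ (‖w' - w‖ + ‖y' - y‖) * (CX j * B) + (‖w' - w‖ + ‖y' - y‖) * (CY j * B) := by
                gcongr
            _ = _ := by ring
      _ = (∑ j, (CX j + CY j)) * ((‖w' - w‖ + ‖y' - y‖) * B) := by rw [Finset.sum_mul]
      _ ≤ ((∑ j, (CX j + CY j)) + 1) * ((‖w' - w‖ + ‖y' - y‖) * B) := by
          gcongr; linarith
      _ = _ := by ring

end DunklBessel

end

/-! ### The one-dimensional weight: intervals and translations. -/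

noncomputable section

namespace DunklBessel

open Filter Topology

/-- The density `s ^ (2 l)` on the half-line, extended by zero. -/
def powDens (l s : ℝ) : ℝ := if 0 < s then s ^ (2 * l) else 0

/-- A primitive of `powDens`. -/
def powPrim (l s : ℝ) : ℝ := (max s 0) ^ (2 * l + 1) / (2 * l + 1)

lemma powDens_nonneg (l s : ℝ) : 0 ≤ powDens l s := by
  unfold powDens; split_ifs with h <;> positivity

lemma measurable_powDens (l : ℝ) : Measurable (powDens l) := by
  unfold powDens
  exact Measurable.ite measurableSet_Ioi (by fun_prop) measurable_const

variable {l : ℝ}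

lemma powPrim_mono (hl : -(1 / 2) < l) : Monotone (powPrim l) := by
  intro a b hab
  unfold powPrim
  have : 0 < 2 * l + 1 := by linarith
  gcongr

lemma intervalIntegrable_powDens (hl : -(1 / 2) < l) (a b : ℝ) :
    IntervalIntegrable (powDens l) volume a b := by
  have h : IntervalIntegrable (fun s : ℝ => s ^ (2 * l)) volume a b :=
    intervalIntegral.intervalIntegrable_rpow' (by linarith)
  refine h.mono_fun (measurable_powDens l).aestronglyMeasurable
    (Eventually.of_forall fun s => ?_)
  by_cases h0 : 0 < s <;> simp [powDens, h0]

lemma integral_powDens_zero (hl : -(1 / 2) < l) (b : ℝ) :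
    ∫ s in (0 : ℝ)..b, powDens l s = powPrim l b := by
  have hp : 0 < 2 * l + 1 := by linarith
  rcases le_total 0 b with hb | hb
  · have : ∫ s in (0 : ℝ)..b, powDens l s = ∫ s in (0 : ℝ)..b, s ^ (2 * l) := by
      rw [intervalIntegral.integral_of_le hb, intervalIntegral.integral_of_le hb]
      exact setIntegral_congr_fun measurableSet_Ioc fun s hs => by simp [powDens, hs.1]
    rw [this, integral_rpow (Or.inl (by linarith)), powPrim, max_eq_left hb,
      Real.zero_rpow hp.ne', sub_zero]
  · have : ∫ s in (0 : ℝ)..b, powDens l s = ∫ s in (0 : ℝ)..b, (0 : ℝ) := by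
      refine intervalIntegral.integral_congr fun s hs => ?_
      rw [uIcc_of_ge hb] at hs
      simp [powDens, hs.2]
    rw [this, powPrim, max_eq_right hb, Real.zero_rpow hp.ne']
    simp

lemma integral_powDens (hl : -(1 / 2) < l) (a b : ℝ) :
    ∫ s in a..b, powDens l s = powPrim l b - powPrim l a := by
  rw [← intervalIntegral.integral_interval_sub_left (intervalIntegrable_powDens hl 0 b)
    (intervalIntegrable_powDens hl 0 a), integral_powDens_zero hl, integral_powDens_zero hl]

lemma integral_powDens_shift (hl : -(1 / 2) < l) (x a b : ℝ) :
    ∫ z in a..b, powDens l (x + z) = powPrim l (x + b) - powPrim l (x + a) := by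
  rw [intervalIntegral.integral_comp_add_left (fun s => powDens l s), integral_powDens hl]

lemma intervalIntegrable_powDens_shift (hl : -(1 / 2) < l) (x a b : ℝ) :
    IntervalIntegrable (fun z => powDens l (x + z)) volume a b := by
  have := (intervalIntegrable_powDens hl (x + a) (x + b)).comp_add_left x
  simpa using this

lemma powPrim_sub_le {a h B : ℝ} (hl : -(1 / 2) < l) (hh : 0 ≤ h) (ha : 0 < a)
    (hB : ∀ s, a ≤ s → s ≤ a + h → s ^ (2 * l) ≤ B) : powPrim l (a + h) - powPrim l a ≤ h * B := by
  rw [← integral_powDens hl]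
  have h1 := intervalIntegral.norm_integral_le_of_norm_le_const (a := a) (b := a + h) (C := B)
    (f := powDens l) fun s hs => by
      rw [uIoc_of_le (by linarith)] at hs
      rw [Real.norm_of_nonneg (powDens_nonneg l s), powDens, if_pos (by linarith [hs.1])]
      exact hB s hs.1.le hs.2
  rw [add_sub_cancel_left, abs_of_nonneg hh] at h1
  linarith [(le_abs_self _).trans h1]

lemma le_powPrim_sub {a h B : ℝ} (hl : -(1 / 2) < l) (hh : 0 ≤ h) (ha : 0 < a)
    (hB : ∀ s, a ≤ s → s ≤ a + h → B ≤ s ^ (2 * l)) : h * B ≤ powPrim l (a + h) - powPrim l a := by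
  rw [← integral_powDens hl]
  have h1 := intervalIntegral.integral_mono_on (a := a) (b := a + h) (f := fun _ => B)
    (g := powDens l) (by linarith) (by simp) (intervalIntegrable_powDens hl _ _) fun s hs => by
      rw [powDens, if_pos (by linarith [hs.1])]
      exact hB s hs.1 hs.2
  simpa using h1

lemma vPlusOne_eq (hl : -(1 / 2) < l) {t x : ℝ} (ht : 0 < t) :
    vPlusOne l t x = powPrim l (x + t) - powPrim l (x - t) := by
  have hle : x - t ≤ x + t := by linarith
  have hI : (fun s => ENNReal.ofReal (powDens l s)) =
      (Ioi (0 : ℝ)).indicator fun s => ENNReal.ofReal (s ^ (2 * l)) := by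
    ext s
    by_cases h0 : 0 < s <;> simp [powDens, h0]
  rw [← integral_powDens hl, intervalIntegral.integral_of_le hle, integral_Ioc_eq_integral_Ioo,
    integral_eq_lintegral_of_nonneg_ae (Eventually.of_forall (powDens_nonneg l))
      (measurable_powDens l).aestronglyMeasurable, hI, setLIntegral_indicator measurableSet_Ioi,
    vPlusOne, Measure.real, wPlusOne,
    withDensity_apply _ (measurableSet_Ioo.inter measurableSet_Ioi),
    Measure.restrict_restrict (measurableSet_Ioo.inter measurableSet_Ioi), inter_assoc, inter_self,
    inter_comm]

/-- The part from x + t/2 to x + t is enough: there s is within a factor two of t + x. -/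
lemma le_vPlusOne (hl : -(1 / 2) < l) : ∃ c : ℝ, 0 < c ∧ ∀ t x : ℝ, 0 < t → 0 < x →
    c * (t * (t + x) ^ (2 * l)) ≤ vPlusOne l t x := by
  refine ⟨(2 * 2 ^ |2 * l|)⁻¹, by positivity, fun t x ht hx => ?_⟩
  have h1 := le_powPrim_sub (a := x + t / 2) (h := t / 2) (B := (2 ^ |2 * l|)⁻¹ * (t + x) ^ (2 * l))
    hl (by positivity) (by positivity) fun s hs hs' => by
      rw [inv_mul_le_iff₀ (by positivity)]
      exact rpow_le_of_le_mul (by linarith) (by linarith) (by norm_num) (by linarith)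
        (by linarith) _
  rw [vPlusOne_eq hl ht]
  have h2 := powPrim_mono hl (show x - t ≤ x + t / 2 by linarith)
  have e : x + t / 2 + t / 2 = x + t := by ring
  rw [e] at h1
  calc _ = t / 2 * ((2 ^ |2 * l|)⁻¹ * (t + x) ^ (2 * l)) := by rw [mul_inv]; ring
    _ ≤ _ := by linarith

/-- Either the whole interval is comparable with t + x, or t + x ≤ 3t and the primitive at the right
end suffices. -/
lemma vPlusOne_le (hl : -(1 / 2) < l) : ∃ C : ℝ, 0 < C ∧ ∀ t x : ℝ, 0 < t → 0 < x →
    vPlusOne l t x ≤ C * (t * (t + x) ^ (2 * l)) := by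
  have hp : 0 < 2 * l + 1 := by linarith
  refine ⟨2 * 4 ^ |2 * l| + 3 / (2 * l + 1), by positivity, fun t x ht hx => ?_⟩
  have hpos : 0 < t * (t + x) ^ (2 * l) := by positivity
  rw [vPlusOne_eq hl ht, add_mul]
  rcases le_total ((x + t) / 4) (x - t) with h | h
  · have h1 := powPrim_sub_le (a := x - t) (h := 2 * t) (B := 4 ^ |2 * l| * (t + x) ^ (2 * l))
      hl (by positivity) (by linarith) fun s hs hs' =>
        rpow_le_of_le_mul (by linarith) (by linarith) (by norm_num) (by linarith) (by linarith) _
    have e : x - t + 2 * t = x + t := by ring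
    rw [e] at h1
    have : 0 < 3 / (2 * l + 1) * (t * (t + x) ^ (2 * l)) := by positivity
    linarith
  · have h0 : 0 ≤ powPrim l (x - t) := by unfold powPrim; positivity
    have h1 : powPrim l (x + t) ≤ 3 / (2 * l + 1) * (t * (t + x) ^ (2 * l)) := by
      rw [powPrim, max_eq_left (by linarith), Real.rpow_add (by linarith), Real.rpow_one,
        add_comm x t]
      have : (t + x) ^ (2 * l) * (t + x) ≤ (t + x) ^ (2 * l) * (3 * t) := by
        gcongr; linarith
      calc _ ≤ (t + x) ^ (2 * l) * (3 * t) / (2 * l + 1) := by gcongr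
        _ = _ := by ring
    have : 0 < 2 * 4 ^ |2 * l| * (t * (t + x) ^ (2 * l)) := by positivity
    linarith

lemma vPlusOne_pos (hl : -(1 / 2) < l) {t x : ℝ} (ht : 0 < t) (hx : 0 < x) :
    0 < vPlusOne l t x := by
  obtain ⟨c, hc, h⟩ := le_vPlusOne hl
  exact lt_of_lt_of_le (by positivity) (h t x ht hx)

lemma integral_powDens_shift_eq_vPlusOne (hl : -(1 / 2) < l) {t : ℝ} (x : ℝ) (ht : 0 < t) :
    ∫ z in (-t)..t, powDens l (x + z) = vPlusOne l t x := by
  rw [integral_powDens_shift hl, vPlusOne_eq hl ht, ← sub_eq_add_neg]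

lemma powPrim_nonneg (hl : -(1 / 2) < l) (s : ℝ) : 0 ≤ powPrim l s := by
  have hp : 0 < 2 * l + 1 := by linarith
  unfold powPrim; positivity

lemma powPrim_of_nonpos (hl : -(1 / 2) < l) {s : ℝ} (hs : s ≤ 0) : powPrim l s = 0 := by
  rw [powPrim, max_eq_right hs, Real.zero_rpow (by linarith), zero_div]

/-- Subadditivity of a power with exponent in (0,1]: the strip of length h with the largest mass
begins at the origin. -/
lemma powPrim_add_le (hl : -(1 / 2) < l) (hl0 : l ≤ 0) {a h : ℝ} (ha : 0 ≤ a) (hh : 0 ≤ h) :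
    powPrim l (a + h) ≤ powPrim l a + powPrim l h := by
  have hp : 0 < 2 * l + 1 := by linarith
  unfold powPrim
  rw [max_eq_left ha, max_eq_left hh, max_eq_left (by positivity), ← add_div]
  gcongr
  exact Real.rpow_add_le_add_rpow ha hh hp.le (by linarith)

/-- The `L¹` modulus of continuity of the density under translations. -/
lemma integral_abs_powDens_sub_le (hl : -(1 / 2) < l) {δ : ℝ} (hδ1 : δ ≤ 1)
    (hδl : δ ≤ 2 * l + 1) : ∃ C : ℝ, 0 < C ∧ ∀ t x h : ℝ, 0 < t → 0 < x → 0 ≤ h → h ≤ t →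
      ∫ z in (-t)..t, |powDens l (x + h + z) - powDens l (x + z)| ≤
        C * ((h / t) ^ δ * vPlusOne l t x) := by
  have hp : 0 < 2 * l + 1 := by linarith
  obtain ⟨c, hc, hcV⟩ := le_vPlusOne hl
  suffices H : ∃ C : ℝ, 0 < C ∧ ∀ t x h : ℝ, 0 < t → 0 < x → 0 < h → h ≤ t →
      ∫ z in (-t)..t, |powDens l (x + h + z) - powDens l (x + z)| ≤
        C * ((h / t) ^ δ * (t * (t + x) ^ (2 * l))) by
    obtain ⟨C, hC, H⟩ := H
    refine ⟨C / c, by positivity, fun t x h ht hx hh hht => ?_⟩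
    rcases hh.eq_or_lt with rfl | hh
    · have : 0 < vPlusOne l t x := vPlusOne_pos hl ht hx
      simp only [add_zero, sub_self, abs_zero, intervalIntegral.integral_zero]
      positivity
    refine (H t x h ht hx hh hht).trans ?_
    rw [div_mul_eq_mul_div, le_div_iff₀ hc]
    have := mul_le_mul_of_nonneg_left (hcV t x ht hx)
      (show 0 ≤ C * (h / t) ^ δ by positivity)
    linarith
  have key : ∀ t h : ℝ, 0 < t → 0 < h → h ≤ t → ∀ p : ℝ, δ ≤ p → (h / t) ^ p ≤ (h / t) ^ δ :=
    fun t h ht hh hht p hpδ => Real.rpow_le_rpow_of_exponent_ge (by positivity)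
      ((div_le_one ht).2 hht) hpδ
  have hint : ∀ x a b : ℝ, IntervalIntegrable (fun z => powDens l (x + z)) volume a b :=
    intervalIntegrable_powDens_shift hl
  -- For l ≥ 0 the extended density is monotone, so the absolute value disappears and only the
  -- strips of length h at the two ends remain.
  rcases le_total 0 l with h0 | h0
  · refine ⟨2 ^ |2 * l|, by positivity, fun t x h ht hx hh hht => ?_⟩
    have hmono : Monotone (powDens l) := by
      intro a b hab
      unfold powDens
      split_ifs with h1 h2 h2
      · exact Real.rpow_le_rpow h1.le hab (by linarith)
      · exact absurd (h1.trans_le hab) h2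
      · positivity
      · exact le_rfl
    have e : ∀ z, |powDens l (x + h + z) - powDens l (x + z)| =
        powDens l (x + h + z) - powDens l (x + z) := fun z =>
      abs_of_nonneg (sub_nonneg.2 (hmono (by linarith)))
    simp only [e]
    rw [intervalIntegral.integral_sub (hint _ _ _) (hint _ _ _), integral_powDens_shift hl,
      integral_powDens_shift hl]
    have h1 := powPrim_mono hl (show x + -t ≤ x + h + -t by linarith)
    have h2 := powPrim_sub_le (a := x + t) (h := h) (B := 2 ^ |2 * l| * (t + x) ^ (2 * l))
      hl hh.le (by linarith) fun s hs hs' =>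
        rpow_le_of_le_mul (by linarith) (by linarith) (by norm_num) (by linarith) (by linarith) _
    have e2 : x + t + h = x + h + t := by ring
    rw [e2] at h2
    calc _ ≤ h * (2 ^ |2 * l| * (t + x) ^ (2 * l)) := by linarith
      _ = 2 ^ |2 * l| * ((h / t) ^ (1 : ℝ) * (t * (t + x) ^ (2 * l))) := by
        rw [Real.rpow_one]; field_simp
      _ ≤ _ := by
        have := key t h ht hh hht 1 hδ1
        gcongr
  -- For l ≤ 0 the density decreases only on the positive half-line. A strip at the origin has mass
  -- of order h^(2l+1), and this is why δ ≤ 2l + 1 is required.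
  · have hanti : ∀ a b : ℝ, 0 < a → a ≤ b → powDens l b ≤ powDens l a := fun a b ha hab => by
      rw [powDens, powDens, if_pos ha, if_pos (ha.trans_le hab)]
      exact Real.rpow_le_rpow_of_nonpos ha hab (by linarith)
    -- the case where the singularity matters
    have hsing : ∀ t x h : ℝ, 0 < t → 0 < x → 0 < h → h ≤ t → x + t ≤ 4 * t →
        2 * powPrim l h ≤ 2 * 4 ^ |2 * l| / (2 * l + 1) *
          ((h / t) ^ δ * (t * (t + x) ^ (2 * l))) := by
      intro t x h ht hx hh hht hxt
      have h1 : t ^ (2 * l) ≤ 4 ^ |2 * l| * (t + x) ^ (2 * l) :=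
        rpow_le_of_le_mul ht (by linarith) (by norm_num) (by linarith) (by linarith) _
      have h2 := key t h ht hh hht _ hδl
      rw [powPrim, max_eq_left hh.le]
      calc 2 * (h ^ (2 * l + 1) / (2 * l + 1))
          = 2 / (2 * l + 1) * ((h / t) ^ (2 * l + 1) * (t * t ^ (2 * l))) := by
            rw [Real.div_rpow hh.le ht.le, Real.rpow_add ht, Real.rpow_one]
            field_simp
        _ ≤ 2 / (2 * l + 1) * ((h / t) ^ δ * (t * (4 ^ |2 * l| * (t + x) ^ (2 * l)))) := by
            gcongr
        _ = _ := by ring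
    refine ⟨2 * 4 ^ |2 * l| / (2 * l + 1) + 4 ^ |2 * l|, by positivity,
      fun t x h ht hx hh hht => ?_⟩
    have hpos : 0 < (h / t) ^ δ * (t * (t + x) ^ (2 * l)) := by positivity
    have hA : 0 < 2 * 4 ^ |2 * l| / (2 * l + 1) * ((h / t) ^ δ * (t * (t + x) ^ (2 * l))) := by
      positivity
    have hB : 0 < 4 ^ |2 * l| * ((h / t) ^ δ * (t * (t + x) ^ (2 * l))) := by positivity
    rw [add_mul]
    -- If x ≤ t the interval reaches the origin, and the integral is split at z = -x, where the
    -- unshifted density starts.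
    rcases le_total x t with hxt | hxt
    · have hs := hsing t x h ht hx hh hht (by linarith)
      have hii : ∀ a b : ℝ, IntervalIntegrable
          (fun z => |powDens l (x + h + z) - powDens l (x + z)|) volume a b := fun a b =>
        ((hint (x + h) a b).sub (hint x a b)).abs
      rw [← intervalIntegral.integral_add_adjacent_intervals (hii (-t) (-x)) (hii (-x) t)]
      have i1 : ∫ z in (-t)..(-x), |powDens l (x + h + z) - powDens l (x + z)| =
          ∫ z in (-t)..(-x), powDens l (x + h + z) :=
        intervalIntegral.integral_congr fun z hz => by
          rw [uIcc_of_le (by linarith)] at hz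
          have : powDens l (x + z) = 0 := if_neg (by linarith [hz.2])
          simp only [this, sub_zero, abs_of_nonneg (powDens_nonneg l _)]
      have i2 : ∫ z in (-x)..t, |powDens l (x + h + z) - powDens l (x + z)| =
          ∫ z in (-x)..t, (powDens l (x + z) - powDens l (x + h + z)) := by
        rw [intervalIntegral.integral_of_le (by linarith),
          intervalIntegral.integral_of_le (by linarith)]
        refine setIntegral_congr_fun measurableSet_Ioc fun z hz => ?_
        have := hanti (x + z) (x + h + z) (by linarith [hz.1]) (by linarith)
        simp only [abs_sub_comm (powDens l (x + h + z)), abs_of_nonneg (sub_nonneg.2 this)]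
      rw [i1, i2, intervalIntegral.integral_sub (hint _ _ _) (hint _ _ _),
        integral_powDens_shift hl, integral_powDens_shift hl, integral_powDens_shift hl]
      have e1 : x + h + -x = h := by ring
      rw [e1, add_neg_cancel x, powPrim_of_nonpos hl le_rfl]
      have := powPrim_nonneg hl (x + h + -t)
      have := powPrim_mono hl (show x + t ≤ x + h + t by linarith)
      linarith
    · have i2 : ∫ z in (-t)..t, |powDens l (x + h + z) - powDens l (x + z)| =
          ∫ z in (-t)..t, (powDens l (x + z) - powDens l (x + h + z)) := by
        rw [intervalIntegral.integral_of_le (by linarith),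
          intervalIntegral.integral_of_le (by linarith)]
        refine setIntegral_congr_fun measurableSet_Ioc fun z hz => ?_
        have := hanti (x + z) (x + h + z) (by linarith [hz.1]) (by linarith)
        simp only [abs_sub_comm (powDens l (x + h + z)), abs_of_nonneg (sub_nonneg.2 this)]
      rw [i2, intervalIntegral.integral_sub (hint _ _ _) (hint _ _ _),
        integral_powDens_shift hl, integral_powDens_shift hl]
      have hm := powPrim_mono hl (show x + t ≤ x + h + t by linarith)
      have e1 : x + h + -t = x - t + h := by ring
      rw [e1, ← sub_eq_add_neg x t]
      -- Either the left strip is far from the origin and the density there is comparable with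
      -- (t+x)^(2l), or x + t ≤ 4t and subadditivity leads back to the strip at the origin.
      rcases le_total ((x + t) / 4) (x - t) with hq | hq
      · have h2 := powPrim_sub_le (a := x - t) (h := h) (B := 4 ^ |2 * l| * (t + x) ^ (2 * l))
          hl hh.le (by linarith) fun s hs hs' =>
            rpow_le_of_le_mul (by linarith) (by linarith) (by norm_num) (by linarith)
              (by linarith) _
        have h3 : h * (4 ^ |2 * l| * (t + x) ^ (2 * l)) ≤
            4 ^ |2 * l| * ((h / t) ^ δ * (t * (t + x) ^ (2 * l))) := by
          calc _ = 4 ^ |2 * l| * ((h / t) ^ (1 : ℝ) * (t * (t + x) ^ (2 * l))) := by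
                rw [Real.rpow_one]; field_simp
            _ ≤ _ := by
              have := key t h ht hh hht 1 hδ1
              gcongr
        linarith
      · have hs := hsing t x h ht hx hh hht (by linarith)
        have h2 := powPrim_add_le hl h0 (show 0 ≤ x - t by linarith) hh.le
        have := powPrim_nonneg hl h
        linarith

/-- The normalised density `s ^ (2 l) / V_t(x)` at `s = x + z`. -/
def normDens (l t x z : ℝ) : ℝ := powDens l (x + z) / vPlusOne l t x

lemma normDens_nonneg (hl : -(1 / 2) < l) {t x : ℝ} (ht : 0 < t) (hx : 0 < x) (z : ℝ) :
    0 ≤ normDens l t x z :=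
  div_nonneg (powDens_nonneg l _) (vPlusOne_pos hl ht hx).le

lemma intervalIntegrable_normDens (hl : -(1 / 2) < l) (t x a b : ℝ) :
    IntervalIntegrable (normDens l t x) volume a b :=
  (intervalIntegrable_powDens_shift hl x a b).div_const _

lemma integral_normDens (hl : -(1 / 2) < l) {t x : ℝ} (ht : 0 < t) (hx : 0 < x) :
    ∫ z in (-t)..t, normDens l t x z = 1 := by
  unfold normDens
  rw [intervalIntegral.integral_div, integral_powDens_shift_eq_vPlusOne hl x ht,
    div_self (vPlusOne_pos hl ht hx).ne']

/-- The numerator and the normalising constant both vary. The constant is the integral of the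
density, so its variation is bounded by the same L¹ modulus, whence the factor 2. -/
lemma integral_abs_normDens_sub_le (hl : -(1 / 2) < l) {δ : ℝ} (hδ1 : δ ≤ 1)
    (hδl : δ ≤ 2 * l + 1) : ∃ C : ℝ, 0 < C ∧ ∀ t x x' : ℝ, 0 < t → 0 < x → 0 < x' → |x - x'| ≤ t →
      ∫ z in (-t)..t, |normDens l t x z - normDens l t x' z| ≤ C * (|x - x'| / t) ^ δ := by
  obtain ⟨C, hC, H⟩ := integral_abs_powDens_sub_le hl hδ1 hδl
  refine ⟨2 * C, by positivity, ?_⟩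
  suffices W : ∀ t x x' : ℝ, 0 < t → 0 < x → 0 < x' → |x - x'| ≤ t → x ≤ x' →
      ∫ z in (-t)..t, |normDens l t x z - normDens l t x' z| ≤ 2 * C * (|x - x'| / t) ^ δ by
    intro t x x' ht hx hx' hd
    rcases le_total x x' with h | h
    · exact W t x x' ht hx hx' hd h
    · simp only [abs_sub_comm (normDens l t x _), abs_sub_comm x] at hd ⊢
      exact W t x' x ht hx' hx hd h
  intro t x x' ht hx hx' hd hxx
  rw [abs_sub_comm, abs_of_nonneg (sub_nonneg.2 hxx)] at hd ⊢
  have hV := vPlusOne_pos hl ht hx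
  have hV' := vPlusOne_pos hl ht hx'
  have hD := H t x (x' - x) ht hx (sub_nonneg.2 hxx) hd
  rw [add_sub_cancel] at hD
  set V := vPlusOne l t x
  set V' := vPlusOne l t x'
  set D := ∫ z in (-t)..t, |powDens l (x' + z) - powDens l (x + z)| with hDdef
  have hint := intervalIntegrable_powDens_shift hl
  have hVV : |V' - V| ≤ D := by
    rw [hDdef, show V' - V = ∫ z in (-t)..t, (powDens l (x' + z) - powDens l (x + z)) by
      rw [intervalIntegral.integral_sub (hint _ _ _) (hint _ _ _),
        integral_powDens_shift_eq_vPlusOne hl _ ht, integral_powDens_shift_eq_vPlusOne hl _ ht]]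
    exact intervalIntegral.abs_integral_le_integral_abs (by linarith)
  have hpt : ∀ z, |normDens l t x z - normDens l t x' z| ≤
      |powDens l (x' + z) - powDens l (x + z)| / V + powDens l (x' + z) * (|V' - V| / (V * V')) := by
    intro z
    have e : normDens l t x z - normDens l t x' z =
        -((powDens l (x' + z) - powDens l (x + z)) / V) +
          powDens l (x' + z) * ((V' - V) / (V * V')) := by
      change powDens l (x + z) / V - powDens l (x' + z) / V' = _
      field_simp
      ring
    rw [e]
    refine (abs_add_le _ _).trans (le_of_eq ?_)
    rw [abs_neg, abs_div, abs_mul, abs_div, abs_of_pos hV, abs_of_pos (mul_pos hV hV'),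
      abs_of_nonneg (powDens_nonneg l _)]
  have i1 : IntervalIntegrable (fun z => |powDens l (x' + z) - powDens l (x + z)| / V)
      volume (-t) t := (((hint x' _ _).sub (hint x _ _)).abs).div_const _
  have i2 : IntervalIntegrable (fun z => powDens l (x' + z) * (|V' - V| / (V * V')))
      volume (-t) t := (hint x' _ _).mul_const _
  calc _ ≤ ∫ z in (-t)..t, (|powDens l (x' + z) - powDens l (x + z)| / V +
        powDens l (x' + z) * (|V' - V| / (V * V'))) :=
        intervalIntegral.integral_mono_on (by linarith)
          (((intervalIntegrable_normDens hl t x _ _).sub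
            (intervalIntegrable_normDens hl t x' _ _)).abs) (i1.add i2) fun z _ => hpt z
    _ = D / V + V' * (|V' - V| / (V * V')) := by
        rw [intervalIntegral.integral_add i1 i2, intervalIntegral.integral_div,
          intervalIntegral.integral_mul_const, integral_powDens_shift_eq_vPlusOne hl _ ht]
    _ = D / V + |V' - V| / V := by field_simp
    _ ≤ D / V + D / V := by gcongr
    _ = 2 * D / V := by ring
    _ ≤ 2 * (C * (((x' - x) / t) ^ δ * V)) / V := by gcongr
    _ = _ := by field_simp

end DunklBessel

end

/-! ### Products of densities on balls, and the measure of balls. -/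

noncomputable section

namespace DunklBessel

open Filter Topology
variable {n : ℕ} {lam : Fin n → ℝ}

/-- The ball is contained in a cube, on which the integral factorises by Fubini. -/
lemma lintegral_ball_prod_le {t : ℝ} (ht : 0 < t) (g : Fin n → ℝ → ℝ) (h0 : ∀ j s, 0 ≤ g j s)
    (hg : ∀ j, IntervalIntegrable (g j) volume (-t) t) :
    ∫⁻ z in {z : EuclideanSpace ℝ (Fin n) | ‖z‖ < t}, ENNReal.ofReal (∏ j, g j (z j)) ≤
      ENNReal.ofReal (∏ j, ∫ s in (-t)..t, g j s) := by
  have hle : -t ≤ t := by linarith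
  set G : Fin n → ℝ → ℝ := fun j => (Ioc (-t) t).indicator (g j) with hG
  have hG0 : ∀ j s, 0 ≤ G j s := fun j s => indicator_nonneg (fun s _ => h0 j s) s
  have hGi : ∀ j, Integrable (G j) := fun j =>
    (integrable_indicator_iff measurableSet_Ioc).2
      ((intervalIntegrable_iff_integrableOn_Ioc_of_le hle).1 (hg j))
  have hprod : Integrable fun w : Fin n → ℝ => ∏ j, G j (w j) := Integrable.fintype_prod hGi
  have hms : MeasurableSet {z : EuclideanSpace ℝ (Fin n) | ‖z‖ < t} :=
    measurableSet_lt (by fun_prop) measurable_const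
  calc ∫⁻ z in {z : EuclideanSpace ℝ (Fin n) | ‖z‖ < t}, ENNReal.ofReal (∏ j, g j (z j))
      = ∫⁻ z in {z : EuclideanSpace ℝ (Fin n) | ‖z‖ < t}, ENNReal.ofReal (∏ j, G j (z j)) := by
        refine setLIntegral_congr_fun hms fun z hz => ?_
        refine congrArg _ (Finset.prod_congr rfl fun j _ => ?_)
        have h1 := (PiLp.norm_apply_le z j).trans_lt hz
        rw [Real.norm_eq_abs, abs_lt] at h1
        exact (indicator_of_mem (s := Ioc (-t) t) ⟨h1.1, h1.2.le⟩ (g j)).symm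
    _ ≤ ∫⁻ z : EuclideanSpace ℝ (Fin n), ENNReal.ofReal (∏ j, G j (z j)) :=
        setLIntegral_le_lintegral _ _
    _ = ∫⁻ w : Fin n → ℝ, ENNReal.ofReal (∏ j, G j (w j)) :=
        (EuclideanSpace.volume_preserving_symm_measurableEquiv_toLp (Fin n)).lintegral_comp_emb
          (MeasurableEquiv.measurableEmbedding _)
          (fun w : Fin n → ℝ => ENNReal.ofReal (∏ j, G j (w j)))
    _ = ENNReal.ofReal (∫ w : Fin n → ℝ, ∏ j, G j (w j)) :=
        (ofReal_integral_eq_lintegral_ofReal hprod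
          (Eventually.of_forall fun w => Finset.prod_nonneg fun j _ => hG0 j _)).symm
    _ = ENNReal.ofReal (∏ j, ∫ s in (-t)..t, g j s) := by
        rw [integral_fintype_prod_volume_eq_prod]
        refine congrArg _ (Finset.prod_congr rfl fun j _ => ?_)
        rw [intervalIntegral.integral_of_le hle, ← integral_indicator measurableSet_Ioc]

lemma measurableSet_posBall (x : EuclideanSpace ℝ (Fin n)) (r : ℝ) :
    MeasurableSet (posBall x r) :=
  (isOpen_posOrthant n).measurableSet.inter (Metric.isOpen_ball (x := x) (ε := r)).measurableSet

lemma wPlus_posBall_le (hlam : ∀ j, -(1 / 2) < lam j) {x : EuclideanSpace ℝ (Fin n)} {r : ℝ}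
    (hr : 0 < r) :
    wPlus lam (posBall x r) ≤ ENNReal.ofReal (∏ j, vPlusOne (lam j) r (x j)) := by
  have h := lintegral_ball_prod_le hr (fun j z => powDens (lam j) (x j + z))
    (fun j s => powDens_nonneg _ _) (fun j => intervalIntegrable_powDens_shift (hlam j) _ _ _)
  simp only [integral_powDens_shift_eq_vPlusOne (hlam _) _ hr] at h
  refine le_trans ?_ h
  have hms : MeasurableSet {z : EuclideanSpace ℝ (Fin n) | ‖z‖ < r} :=
    measurableSet_lt (by fun_prop) measurable_const
  rw [wPlus, withDensity_apply _ (measurableSet_posBall x r),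
    Measure.restrict_restrict (measurableSet_posBall x r), ← lintegral_indicator hms,
    ← lintegral_indicator ((measurableSet_posBall x r).inter (isOpen_posOrthant n).measurableSet),
    ← lintegral_add_left_eq_self _ x]
  refine lintegral_mono fun z => ?_
  refine indicator_apply_le' (fun hz => ?_) fun _ => zero_le
  have hz1 : x + z ∈ posOrthant n := hz.2
  have hz2 : ‖z‖ < r := by simpa using hz.1.2
  rw [indicator_of_mem (by exact hz2)]
  refine le_of_eq (congrArg _ (Finset.prod_congr rfl fun j _ => ?_))
  exact (if_pos (hz1 j)).symm

/-- Finiteness is part of the claim, since the real value of an infinite measure is zero. -/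
lemma wPlus_real_posBall_pos (hlam : ∀ j, -(1 / 2) < lam j) {x : EuclideanSpace ℝ (Fin n)}
    (hx : x ∈ posOrthant n) {r : ℝ} (hr : 0 < r) : 0 < (wPlus lam).real (posBall x r) := by
  refine ENNReal.toReal_pos (fun h0 => ?_)
    ((wPlus_posBall_le hlam hr).trans_lt ENNReal.ofReal_lt_top).ne
  rw [wPlus, withDensity_apply_eq_zero (by fun_prop), Measure.restrict_apply'
    (isOpen_posOrthant n).measurableSet] at h0
  have hopen : IsOpen (posOrthant n ∩ Metric.ball x r) := (isOpen_posOrthant n).inter Metric.isOpen_ball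
  refine (hopen.measure_pos volume ⟨x, hx, Metric.mem_ball_self hr⟩).ne' (measure_mono_null ?_ h0)
  rintro y ⟨hy, hyr⟩
  refine ⟨⟨?_, hy, hyr⟩, hy⟩
  simp only [mem_ofPred_eq, ne_eq, ENNReal.ofReal_eq_zero, not_le]
  exact Finset.prod_pos fun j _ => Real.rpow_pos_of_pos (hy j) _

/-- This one-sided comparison is all that is needed to pass from bounds by 1 / `bulk` to bounds by
the reciprocal measure. -/
lemma wPlus_real_posBall_le (hlam : ∀ j, -(1 / 2) < lam j) : ∃ C : ℝ, 0 < C ∧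
    ∀ x ∈ posOrthant n, ∀ r, 0 < r → (wPlus lam).real (posBall x r) ≤ C * bulk lam x r := by
  choose C hC hV using fun j => vPlusOne_le (hlam j)
  refine ⟨∏ j, C j, Finset.prod_pos fun j _ => hC j, fun x hx r hr => ?_⟩
  have h1 : ∏ j, vPlusOne (lam j) r (x j) ≤ (∏ j, C j) * bulk lam x r := by
    rw [bulk, ← Finset.prod_mul_distrib]
    exact Finset.prod_le_prod (fun j _ => (vPlusOne_pos (hlam j) hr (hx j)).le)
      fun j _ => hV j r (x j) hr (hx j)
  refine ENNReal.toReal_le_of_le_ofReal ?_ ((wPlus_posBall_le hlam hr).trans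
    (ENNReal.ofReal_le_ofReal h1))
  have := bulk_pos (lam := lam) hx hr
  have := Finset.prod_pos fun j (_ : j ∈ Finset.univ) => hC j
  positivity

/-- The product of the normalised densities. -/
def xiDens (lam : Fin n → ℝ) (t : ℝ) (x z : EuclideanSpace ℝ (Fin n)) : ℝ :=
  ∏ j, normDens (lam j) t (x j) (z j)

lemma xiDens_nonneg (hlam : ∀ j, -(1 / 2) < lam j) {t : ℝ} (ht : 0 < t)
    {x : EuclideanSpace ℝ (Fin n)} (hx : x ∈ posOrthant n) (z : EuclideanSpace ℝ (Fin n)) :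
    0 ≤ xiDens lam t x z :=
  Finset.prod_nonneg fun j _ => normDens_nonneg (hlam j) ht (hx j) _

lemma xiDens_of_notMem {t : ℝ} {x z : EuclideanSpace ℝ (Fin n)} (h : x + z ∉ posOrthant n) :
    xiDens lam t x z = 0 := by
  simp only [posOrthant, mem_ofPred_eq, not_forall] at h
  obtain ⟨j, hj⟩ := h
  refine Finset.prod_eq_zero (Finset.mem_univ j) ?_
  rw [normDens, powDens, if_neg (by simpa using hj), zero_div]

/-- The cut-off to the orthant is built into `xiDens`, as `powDens` vanishes off the half-line. -/
lemma sqrt_Xi_mul_indicator {t : ℝ} (ht : 0 < t) (x z : EuclideanSpace ℝ (Fin n)) :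
    Real.sqrt (Xi lam x z (t ^ 2)) * (posOrthant n).indicator (fun _ => 1) (x + z) =
      Real.sqrt (xiDens lam t x z) := by
  by_cases h : x + z ∈ posOrthant n
  · rw [indicator_of_mem h, mul_one, Xi, xiDens, Real.sqrt_sq ht.le]
    congr 1
    refine Finset.prod_congr rfl fun j _ => ?_
    exact congrArg (· / _) (if_pos (h j)).symm
  · rw [xiDens_of_notMem h]; simp [h]

lemma lintegral_xiDens_le (hlam : ∀ j, -(1 / 2) < lam j) {t : ℝ} (ht : 0 < t)
    {x : EuclideanSpace ℝ (Fin n)} (hx : x ∈ posOrthant n) :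
    ∫⁻ z in {z : EuclideanSpace ℝ (Fin n) | ‖z‖ < t}, ENNReal.ofReal (xiDens lam t x z) ≤ 1 := by
  have h := lintegral_ball_prod_le ht (fun j => normDens (lam j) t (x j))
    (fun j => normDens_nonneg (hlam j) ht (hx j)) (fun j => intervalIntegrable_normDens (hlam j) _ _ _ _)
  simpa only [xiDens, integral_normDens (hlam _) ht (hx _), Finset.prod_const_one, ENNReal.ofReal_one]
    using h

/-- A telescoping sum. The undifferenced factors are bounded by a + b so that each term remains a
product of one-variable functions with known integrals. -/
lemma abs_prod_sub_prod_le {ι : Type*} [DecidableEq ι] (s : Finset ι) (a b : ι → ℝ)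
    (ha : ∀ i, 0 ≤ a i) (hb : ∀ i, 0 ≤ b i) :
    |∏ i ∈ s, a i - ∏ i ∈ s, b i| ≤
      ∑ j ∈ s, ∏ i ∈ s, if i = j then |a i - b i| else a i + b i := by
  induction s using Finset.induction_on with
  | empty => simp
  | insert k s hk ih =>
    rw [Finset.prod_insert hk, Finset.prod_insert hk, Finset.sum_insert hk,
      Finset.prod_insert hk, if_pos rfl]
    have e1 : ∏ i ∈ s, (if i = k then |a i - b i| else a i + b i) = ∏ i ∈ s, (a i + b i) :=
      Finset.prod_congr rfl fun i hi => if_neg (ne_of_mem_of_not_mem hi hk)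
    have e2 : ∑ j ∈ s, ∏ i ∈ insert k s, (if i = j then |a i - b i| else a i + b i) =
        (a k + b k) * ∑ j ∈ s, ∏ i ∈ s, (if i = j then |a i - b i| else a i + b i) := by
      rw [Finset.mul_sum]
      refine Finset.sum_congr rfl fun j hj => ?_
      rw [Finset.prod_insert hk, if_neg (ne_of_mem_of_not_mem hj hk).symm]
    rw [e1, e2]
    have hA : ∏ i ∈ s, a i ≤ ∏ i ∈ s, (a i + b i) :=
      Finset.prod_le_prod (fun i _ => ha i) fun i _ => by linarith [hb i]
    have hA0 : 0 ≤ ∏ i ∈ s, a i := Finset.prod_nonneg fun i _ => ha i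
    have e3 : a k * ∏ i ∈ s, a i - b k * ∏ i ∈ s, b i =
        (a k - b k) * ∏ i ∈ s, a i + b k * (∏ i ∈ s, a i - ∏ i ∈ s, b i) := by ring
    rw [e3]
    refine (abs_add_le _ _).trans ?_
    rw [abs_mul, abs_mul, abs_of_nonneg hA0, abs_of_nonneg (hb k)]
    have h1 : |a k - b k| * ∏ i ∈ s, a i ≤ |a k - b k| * ∏ i ∈ s, (a i + b i) := by gcongr
    have h2 : b k * |∏ i ∈ s, a i - ∏ i ∈ s, b i| ≤
        (a k + b k) * ∑ j ∈ s, ∏ i ∈ s, (if i = j then |a i - b i| else a i + b i) :=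
      mul_le_mul (by linarith [ha k]) ih (abs_nonneg _) (add_nonneg (ha k) (hb k))
    linarith

lemma measurable_normDens (l t x : ℝ) : Measurable (normDens l t x) :=
  ((measurable_powDens l).comp (measurable_const_add x)).div_const _

lemma lintegral_abs_xiDens_sub_le (hlam : ∀ j, -(1 / 2) < lam j) {δ : ℝ} (hδ0 : 0 ≤ δ) (hδ1 : δ ≤ 1)
    (hδl : ∀ j, δ ≤ 2 * lam j + 1) : ∃ C : ℝ, 0 < C ∧ ∀ t, 0 < t → ∀ x ∈ posOrthant n,
      ∀ x' ∈ posOrthant n,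
      ∫⁻ z in {z : EuclideanSpace ℝ (Fin n) | ‖z‖ < t},
        ENNReal.ofReal |xiDens lam t x z - xiDens lam t x' z| ≤
          ENNReal.ofReal (C * (‖x - x'‖ / t) ^ δ) := by
  choose C hC H using fun j => integral_abs_normDens_sub_le (hlam j) hδ1 (hδl j)
  refine ⟨(∑ j, C j * 2 ^ n) + 2, by
    have : 0 ≤ ∑ j, C j * 2 ^ n := Finset.sum_nonneg fun j _ => by have := hC j; positivity
    linarith, fun t ht x hx x' hx' => ?_⟩
  have hC0 : 0 ≤ ∑ j, C j * 2 ^ n := Finset.sum_nonneg fun j _ => by have := hC j; positivity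
  -- When |x - x'| > t the right side is at least 2, the trivial bound for two densities of mass at
  -- most one.
  rcases le_or_gt ‖x - x'‖ t with hxt | hxt
  · have hi := fun (y : EuclideanSpace ℝ (Fin n)) j =>
      intervalIntegrable_normDens (hlam j) t (y j) (-t) t
    set g : Fin n → Fin n → ℝ → ℝ := fun j i s =>
      if i = j then |normDens (lam i) t (x i) s - normDens (lam i) t (x' i) s|
      else normDens (lam i) t (x i) s + normDens (lam i) t (x' i) s with hg
    have hg0 : ∀ j i s, 0 ≤ g j i s := fun j i s => by
      have h1 := normDens_nonneg (hlam i) ht (hx i) s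
      have h2 := normDens_nonneg (hlam i) ht (hx' i) s
      simp only [hg]; split_ifs <;> positivity
    have hgm : ∀ j i, Measurable (g j i) := fun j i => by
      have h1 := measurable_normDens (lam i) t (x i)
      have h2 := measurable_normDens (lam i) t (x' i)
      by_cases h : i = j
      · simp only [hg, if_pos h]; fun_prop
      · simp only [hg, if_neg h]; fun_prop
    have hgi : ∀ j i, IntervalIntegrable (g j i) volume (-t) t := fun j i => by
      by_cases h : i = j
      · simp only [hg, if_pos h]; exact ((hi x i).sub (hi x' i)).abs
      · simp only [hg, if_neg h]; exact (hi x i).add (hi x' i)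
    have hbound : ∀ j, ∏ i, ∫ s in (-t)..t, g j i s ≤ C j * 2 ^ n * (‖x - x'‖ / t) ^ δ := by
      intro j
      rw [← Finset.mul_prod_erase _ _ (Finset.mem_univ j)]
      have e1 : ∀ i ∈ Finset.univ.erase j, ∫ s in (-t)..t, g j i s = 2 := fun i hij => by
        simp only [hg, if_neg (Finset.ne_of_mem_erase hij)]
        rw [intervalIntegral.integral_add (hi x i) (hi x' i), integral_normDens (hlam i) ht (hx i),
          integral_normDens (hlam i) ht (hx' i)]
        norm_num
      rw [Finset.prod_congr rfl e1, Finset.prod_const]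
      have e2 : ∫ s in (-t)..t, g j j s ≤ C j * (‖x - x'‖ / t) ^ δ := by
        have hj : |x j - x' j| ≤ ‖x - x'‖ := PiLp.norm_apply_le (x - x') j
        simp only [hg, if_true]
        refine (H j t (x j) (x' j) ht (hx j) (hx' j) (hj.trans hxt)).trans ?_
        have := (hC j).le
        gcongr
      have e3 : (2 : ℝ) ^ (Finset.univ.erase j).card ≤ 2 ^ n := by
        gcongr
        · norm_num
        · simp
      calc _ ≤ C j * (‖x - x'‖ / t) ^ δ * 2 ^ n := by
            have := (hC j).le
            gcongr
        _ = _ := by ring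
    calc _ ≤ ∫⁻ z in {z : EuclideanSpace ℝ (Fin n) | ‖z‖ < t},
          ∑ j, ENNReal.ofReal (∏ i, g j i (z i)) := by
          refine lintegral_mono fun z => ?_
          rw [← ENNReal.ofReal_sum_of_nonneg fun j _ => Finset.prod_nonneg fun i _ => hg0 j i _]
          exact ENNReal.ofReal_le_ofReal (abs_prod_sub_prod_le Finset.univ _ _
            (fun j => normDens_nonneg (hlam j) ht (hx j) _)
            fun j => normDens_nonneg (hlam j) ht (hx' j) _)
      _ = ∑ j, ∫⁻ z in {z : EuclideanSpace ℝ (Fin n) | ‖z‖ < t},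
          ENNReal.ofReal (∏ i, g j i (z i)) := by
          refine lintegral_finsetSum _ fun j _ => ?_
          refine (Finset.measurable_fun_prod _ fun i _ => ?_).ennreal_ofReal
          exact (hgm j i).comp (by fun_prop)
      _ ≤ ∑ j, ENNReal.ofReal (C j * 2 ^ n * (‖x - x'‖ / t) ^ δ) :=
          Finset.sum_le_sum fun j _ => (lintegral_ball_prod_le ht (g j) (hg0 j) (hgi j)).trans
            (ENNReal.ofReal_le_ofReal (hbound j))
      _ = ENNReal.ofReal ((∑ j, C j * 2 ^ n) * (‖x - x'‖ / t) ^ δ) := by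
          rw [← ENNReal.ofReal_sum_of_nonneg fun j _ => by have := hC j; positivity,
            Finset.sum_mul]
      _ ≤ _ := by
          gcongr; linarith
  · have hm : Measurable fun z : EuclideanSpace ℝ (Fin n) => ENNReal.ofReal (xiDens lam t x z) := by
      refine (Finset.measurable_fun_prod _ fun i _ => ?_).ennreal_ofReal
      exact (measurable_normDens _ _ _).comp (by fun_prop)
    calc _ ≤ ∫⁻ z in {z : EuclideanSpace ℝ (Fin n) | ‖z‖ < t},
          (ENNReal.ofReal (xiDens lam t x z) + ENNReal.ofReal (xiDens lam t x' z)) := by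
          refine lintegral_mono fun z => ?_
          have h1 := xiDens_nonneg hlam ht hx z
          have h2 := xiDens_nonneg hlam ht hx' z
          rw [← ENNReal.ofReal_add h1 h2]
          refine ENNReal.ofReal_le_ofReal ((abs_sub _ _).trans_eq ?_)
          rw [abs_of_nonneg h1, abs_of_nonneg h2]
      _ ≤ 1 + 1 := by
          rw [lintegral_add_left hm]
          exact add_le_add (lintegral_xiDens_le hlam ht hx) (lintegral_xiDens_le hlam ht hx')
      _ = ENNReal.ofReal 2 := by rw [one_add_one_eq_two]; simp
      _ ≤ _ := by
          refine ENNReal.ofReal_le_ofReal ?_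
          have : 1 ≤ (‖x - x'‖ / t) ^ δ :=
            Real.one_le_rpow ((one_le_div ht).2 hxt.le) hδ0
          nlinarith

/-- This turns an L¹ modulus of order 2γ for the densities into an L² modulus of order γ for their
roots. -/
lemma sq_sqrt_sub_sqrt_le {a b : ℝ} (ha : 0 ≤ a) (hb : 0 ≤ b) :
    (√a - √b) ^ 2 ≤ |a - b| := by
  have h : |√a - √b| ≤ √a + √b := by
    have := Real.sqrt_nonneg a
    have := Real.sqrt_nonneg b
    exact abs_le.2 ⟨by linarith, by linarith⟩
  calc (√a - √b) ^ 2 = |√a - √b| * |√a - √b| := by rw [← sq, sq_abs]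
    _ ≤ |√a - √b| * |√a + √b| :=
        mul_le_mul_of_nonneg_left (h.trans (le_abs_self _)) (abs_nonneg _)
    _ = |a - b| := by
        rw [← abs_mul]
        congr 1
        linear_combination Real.sq_sqrt ha - Real.sq_sqrt hb

end DunklBessel

end

/-! ### Integration over the cone. -/

noncomputable section

namespace DunklBessel

open Filter Topology
variable {n : ℕ} {lam : Fin n → ℝ}

lemma lintegral_shifted_rpow {a D : ℝ} (ha : 0 < a) (hD : 0 < D) :
    ∫⁻ t in Ioi (0 : ℝ), ENNReal.ofReal ((t + D) ^ (-a - 1)) = ENNReal.ofReal (D ^ (-a) / a) := by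
  have h1 : ∫⁻ t in Ioi (0 : ℝ), ENNReal.ofReal ((t + D) ^ (-a - 1)) =
      ∫⁻ s in Ioi D, ENNReal.ofReal (s ^ (-a - 1)) := by
    rw [← lintegral_indicator measurableSet_Ioi, ← lintegral_indicator measurableSet_Ioi,
      
      ← lintegral_add_right_eq_self ((Ioi D).indicator fun s => ENNReal.ofReal (s ^ (-a - 1))) D]
    refine lintegral_congr fun t => ?_
    by_cases ht : 0 < t
    · rw [indicator_of_mem (by exact ht), indicator_of_mem (by simpa using ht)]
    · rw [indicator_of_notMem (by exact ht), indicator_of_notMem (by simpa using ht)]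
  rw [h1, ← ofReal_integral_eq_lintegral_ofReal
    (integrableOn_Ioi_rpow_of_lt (by linarith) hD), integral_Ioi_rpow_of_lt (by linarith) hD]
  · congr 1
    rw [sub_add_cancel, neg_div_neg_eq]
  · refine (ae_restrict_iff' measurableSet_Ioi).2 (Eventually.of_forall fun s hs => ?_)
    exact Real.rpow_nonneg (hD.le.trans (le_of_lt hs)) _

lemma measurableSet_cone (n : ℕ) : MeasurableSet (cone n) :=
  (measurableSet_lt measurable_const measurable_snd).inter
    (measurableSet_lt measurable_fst.norm measurable_snd)

lemma lintegral_coneMeasure (K : ℕ) (M : Fin n → ℕ) {F : EuclideanSpace ℝ (Fin n) × ℝ → ℝ≥0∞}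
    (hF : Measurable F) :
    ∫⁻ p, F p ∂(coneMeasure K M) = ∫⁻ t in Ioi (0 : ℝ),
      ∫⁻ z in {z : EuclideanSpace ℝ (Fin n) | ‖z‖ < t},
        ENNReal.ofReal (t ^ (2 * (K : ℝ) + 2 * ((∑ j, M j : ℕ) : ℝ) - 1)) * F (z, t) := by
  have hw : Measurable fun p : EuclideanSpace ℝ (Fin n) × ℝ =>
      ENNReal.ofReal (p.2 ^ (2 * (K : ℝ) + 2 * ((∑ j, M j : ℕ) : ℝ) - 1)) := by fun_prop
  have hms : ∀ t, MeasurableSet {z : EuclideanSpace ℝ (Fin n) | ‖z‖ < t} := fun t =>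
    measurableSet_lt (by fun_prop) measurable_const
  rw [coneMeasure, lintegral_withDensity_eq_lintegral_mul _ hw hF,
    ← lintegral_indicator (measurableSet_cone n), Measure.volume_eq_prod,
    lintegral_prod_symm' _ ((hw.mul hF).indicator (measurableSet_cone n)),
    ← lintegral_indicator measurableSet_Ioi]
  refine lintegral_congr fun t => ?_
  by_cases ht : 0 < t
  · rw [indicator_of_mem (by exact ht), ← lintegral_indicator (hms t)]
    refine lintegral_congr fun z => ?_
    by_cases hz : ‖z‖ < t
    · rw [indicator_of_mem (by exact ⟨ht, hz⟩), indicator_of_mem (by exact hz)]; rfl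
    · rw [indicator_of_notMem (fun h => hz h.2), indicator_of_notMem (by exact hz)]
  · rw [indicator_of_notMem (by exact ht)]
    refine (lintegral_congr fun z => ?_).trans lintegral_zero
    exact indicator_of_notMem (fun h => ht h.1) _

lemma eLpNorm_two_le {α : Type*} [MeasurableSpace α] {μ : Measure α} {f : α → ℝ} {A : ℝ}
    (hA : 0 ≤ A) (h : ∫⁻ p, ENNReal.ofReal (f p ^ 2) ∂μ ≤ ENNReal.ofReal (A ^ 2)) :
    eLpNorm (fun p => (f p : ℂ)) 2 μ ≤ ENNReal.ofReal A := by
  rw [eLpNorm_eq_lintegral_rpow_enorm_toReal two_ne_zero ENNReal.ofNat_ne_top, ENNReal.toReal_ofNat]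
  have e : ∀ p, ‖(f p : ℂ)‖ₑ ^ (2 : ℝ) = ENNReal.ofReal (f p ^ 2) := fun p => by
    rw [← ofReal_norm, ENNReal.ofReal_rpow_of_nonneg (norm_nonneg _) zero_le_two,
      Complex.norm_real, Real.rpow_two, Real.norm_eq_abs, sq_abs]
  simp only [e]
  calc _ ≤ ENNReal.ofReal (A ^ 2) ^ (1 / 2 : ℝ) := by gcongr
    _ = ENNReal.ofReal A := by
      rw [ENNReal.ofReal_rpow_of_nonneg (by positivity) (by norm_num), ← Real.sqrt_eq_rpow,
        Real.sqrt_sq hA]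

/-- From a pointwise bound on the cone to a bound of the norm in `L²(coneMeasure K M)`. -/
theorem eLpNorm_coneMeasure_le (hn : 1 ≤ n) (hlam : ∀ j, -(1 / 2) < lam j) (K : ℕ) (M : Fin n → ℕ)
    (hKM : 0 < (∑ j, M j) + K) {γ : ℝ} (hγ0 : 0 ≤ γ) (hγ1 : γ ≤ 1 / 2) :
    ∃ C : ℝ, 0 < C ∧ ∀ x ∈ posOrthant n, ∀ D B : ℝ, 0 < D → 0 ≤ B →
      ∀ f g : EuclideanSpace ℝ (Fin n) × ℝ → ℝ, Measurable f →
      (∀ p ∈ cone n, 0 ≤ g p ∧ |f p| ≤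
        (p.2 + D) ^ (-(K + (∑ j, M j : ℕ) : ℝ)) / bulk lam x (p.2 + D) * √(g p)) →
      (∀ t, 0 < t → ∫⁻ z in {z : EuclideanSpace ℝ (Fin n) | ‖z‖ < t}, ENNReal.ofReal (g (z, t)) ≤
        ENNReal.ofReal (B ^ 2 * t ^ (-(2 * γ)))) →
      eLpNorm (fun p => (f p : ℂ)) 2 (coneMeasure K M) ≤
        ENNReal.ofReal (C * (B * (D ^ (-γ) / bulk lam x D))) := by
  obtain ⟨ε, A, hε, -, hbulk⟩ := bulk_growth hn hlam
  have ha : 0 < 2 * γ + 2 * ε := by linarith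
  refine ⟨√(1 / (2 * γ + 2 * ε)), by positivity, fun x hx D B hD hB f g hf hfg hg => ?_⟩
  set N : ℝ := K + (∑ j, M j : ℕ) with hN
  -- The hypothesis |M| + K > 0 enters here. With γ ≤ 1/2 it makes 2N - 1 - 2γ nonnegative, so that
  -- this power of t is bounded by the same power of t + D.
  have hN1 : 1 ≤ N := by
    rw [hN]
    exact_mod_cast (show 1 ≤ K + ∑ j, M j by omega)
  have hbD := bulk_pos (lam := lam) hx hD
  have hms : ∀ t, MeasurableSet {z : EuclideanSpace ℝ (Fin n) | ‖z‖ < t} := fun t =>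
    measurableSet_lt (by fun_prop) measurable_const
  refine eLpNorm_two_le (by positivity) ?_
  rw [lintegral_coneMeasure K M (by fun_prop)]
  calc _ ≤ ∫⁻ t in Ioi (0 : ℝ), ENNReal.ofReal (B ^ 2 * D ^ (2 * ε) / bulk lam x D ^ 2) *
        ENNReal.ofReal ((t + D) ^ (-(2 * γ + 2 * ε) - 1)) := by
        refine setLIntegral_mono' measurableSet_Ioi fun t ht => ?_
        have ht : 0 < t := ht
        have hR : 0 < t + D := by positivity
        have hbR := bulk_pos (lam := lam) hx hR
        set c := t ^ (2 * N - 1) * ((t + D) ^ (-N) / bulk lam x (t + D)) ^ 2 with hc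
        have hc0 : 0 ≤ c := by positivity
        calc _ ≤ ∫⁻ z in {z : EuclideanSpace ℝ (Fin n) | ‖z‖ < t},
              ENNReal.ofReal c * ENNReal.ofReal (g (z, t)) := by
              refine setLIntegral_mono' (hms t) fun z hz => ?_
              obtain ⟨h0, h1⟩ := hfg (z, t) ⟨ht, hz⟩
              rw [← ENNReal.ofReal_mul (by positivity), ← ENNReal.ofReal_mul hc0]
              refine ENNReal.ofReal_le_ofReal ?_
              have h2 : f (z, t) ^ 2 ≤ ((t + D) ^ (-N) / bulk lam x (t + D)) ^ 2 * g (z, t) := by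
                rw [← Real.sq_sqrt h0, ← mul_pow, ← sq_abs (f (z, t))]
                gcongr
              have e : 2 * (K : ℝ) + 2 * ((∑ j, M j : ℕ) : ℝ) - 1 = 2 * N - 1 := by
                rw [hN]; ring
              rw [e, hc, mul_assoc]
              gcongr
          _ = ENNReal.ofReal c * ∫⁻ z in {z : EuclideanSpace ℝ (Fin n) | ‖z‖ < t},
              ENNReal.ofReal (g (z, t)) := lintegral_const_mul' _ _ ENNReal.ofReal_ne_top
          _ ≤ ENNReal.ofReal c * ENNReal.ofReal (B ^ 2 * t ^ (-(2 * γ))) := by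
              gcongr
              exact hg t ht
          _ ≤ _ := by
              rw [← ENNReal.ofReal_mul hc0, ← ENNReal.ofReal_mul (by positivity)]
              refine ENNReal.ofReal_le_ofReal ?_
              have h1 := (hbulk x hx D (t + D) hD (by linarith)).1
              -- Reverse doubling supplies the decay at infinity, indispensable when γ = 0.
              have h2 : 1 / bulk lam x (t + D) ≤ ((t + D) / D) ^ (-ε) / bulk lam x D := by
                rw [Real.rpow_neg (by positivity), div_le_div_iff₀ hbR hbD, one_mul,
                  ← div_eq_inv_mul, le_div_iff₀ (by positivity)]
                linarith
              have h3 : t ^ (2 * N - 1 - 2 * γ) ≤ (t + D) ^ (2 * N - 1 - 2 * γ) :=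
                Real.rpow_le_rpow ht.le (by linarith) (by linarith)
              have e1 : t ^ (2 * N - 1) * t ^ (-(2 * γ)) = t ^ (2 * N - 1 - 2 * γ) := by
                rw [← Real.rpow_add ht]; ring_nf
              have e2 : (t + D) ^ (2 * N - 1 - 2 * γ) * ((t + D) ^ (-N)) ^ 2 * ((t + D) ^ (-ε)) ^ 2 =
                  (t + D) ^ (-(2 * γ + 2 * ε) - 1) := by
                rw [← Real.rpow_mul_natCast hR.le, ← Real.rpow_mul_natCast hR.le,
                  ← Real.rpow_add hR, ← Real.rpow_add hR]
                congr 1; push_cast; ring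
              have e3 : ((t + D) / D) ^ (-ε) = (t + D) ^ (-ε) * D ^ ε := by
                rw [Real.div_rpow hR.le hD.le, Real.rpow_neg hD.le, div_inv_eq_mul]
              have e4 : (D ^ ε) ^ 2 = D ^ (2 * ε) := by
                rw [← Real.rpow_mul_natCast hD.le]; congr 1; push_cast; ring
              calc c * (B ^ 2 * t ^ (-(2 * γ)))
                  = B ^ 2 * (t ^ (2 * N - 1) * t ^ (-(2 * γ))) * ((t + D) ^ (-N)) ^ 2 *
                    (1 / bulk lam x (t + D)) ^ 2 := by rw [hc]; ring
                _ ≤ B ^ 2 * (t + D) ^ (2 * N - 1 - 2 * γ) * ((t + D) ^ (-N)) ^ 2 *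
                    (((t + D) / D) ^ (-ε) / bulk lam x D) ^ 2 := by
                    rw [e1]; gcongr
                _ = B ^ 2 * (D ^ ε) ^ 2 / bulk lam x D ^ 2 * ((t + D) ^ (2 * N - 1 - 2 * γ) *
                    ((t + D) ^ (-N)) ^ 2 * ((t + D) ^ (-ε)) ^ 2) := by rw [e3]; ring
                _ = _ := by rw [e2, e4]
    _ = ENNReal.ofReal (B ^ 2 * D ^ (2 * ε) / bulk lam x D ^ 2 *
          (D ^ (-(2 * γ + 2 * ε)) / (2 * γ + 2 * ε))) := by
        rw [lintegral_const_mul' _ _ ENNReal.ofReal_ne_top, lintegral_shifted_rpow ha hD,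
          ENNReal.ofReal_mul (by positivity)]
    _ = _ := by
        congr 1
        rw [mul_pow, Real.sq_sqrt (by positivity), mul_pow, div_pow, ← Real.rpow_mul_natCast hD.le]
        have e5 : D ^ (2 * ε) * D ^ (-(2 * γ + 2 * ε)) = D ^ (-γ * (2 : ℕ)) := by
          rw [← Real.rpow_add hD]; congr 1; push_cast; ring
        rw [← e5]; ring

end DunklBessel

end

/-! ### The standard estimates in L² over the cone. -/

noncomputable section

namespace DunklBessel

open Filter Topology
variable {n : ℕ} {lam : Fin n → ℝ}

lemma measurable_vPlusOne {l : ℝ} (hl : -(1 / 2) < l) (x : ℝ) :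
    Measurable fun t => vPlusOne l t x := by
  have e : (fun t => vPlusOne l t x) =
      (Ioi (0 : ℝ)).indicator fun t => powPrim l (x + t) - powPrim l (x - t) := by
    ext t
    by_cases ht : 0 < t
    · rw [indicator_of_mem (by exact ht), vPlusOne_eq hl ht]
    · rw [indicator_of_notMem (by exact ht), vPlusOne,
        Ioo_eq_empty (by linarith), empty_inter, measureReal_empty]
  have hm := (powPrim_mono hl).measurable
  rw [e]
  exact ((hm.comp (by fun_prop)).sub (hm.comp (by fun_prop))).indicator measurableSet_Ioi

lemma measurable_xiDens (hlam : ∀ j, -(1 / 2) < lam j) (x : EuclideanSpace ℝ (Fin n)) :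
    Measurable fun p : EuclideanSpace ℝ (Fin n) × ℝ => xiDens lam p.2 x p.1 := by
  refine Finset.measurable_fun_prod _ fun j _ => ?_
  exact ((measurable_powDens (lam j)).comp (by fun_prop)).div
    ((measurable_vPlusOne (hlam j) (x j)).comp measurable_snd)

/-- The kernel of the area integral, in terms of the subordinated derivatives. -/
def areaKer (lam : Fin n → ℝ) (η : Fin n → Fin 2) (K : ℕ) (M : Fin n → ℕ)
    (x y : EuclideanSpace ℝ (Fin n)) (p : EuclideanSpace ℝ (Fin n) × ℝ) : ℝ :=
  subKer K (fun j => heatD (lam j) (η j) (M j)) p.2 (x + p.1) y * √(xiDens lam p.2 x p.1)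

lemma measurable_subKer_heatD (hlam : ∀ j, -(1 / 2) < lam j) (η : Fin n → Fin 2) (K : ℕ)
    (M : Fin n → ℕ) (x y : EuclideanSpace ℝ (Fin n)) :
    Measurable fun p : EuclideanSpace ℝ (Fin n) × ℝ =>
      subKer K (fun j => heatD (lam j) (η j) (M j)) p.2 (x + p.1) y := by
  have hg : Measurable fun p : EuclideanSpace ℝ (Fin n) × ℝ => (p.2, x + p.1, y) := by fun_prop
  exact (measurable_subKer hlam K fun j => heatClass_heatD (hlam j) (η j) (M j)).comp hg

lemma measurable_areaKer (hlam : ∀ j, -(1 / 2) < lam j) (η : Fin n → Fin 2) (K : ℕ)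
    (M : Fin n → ℕ) (x y : EuclideanSpace ℝ (Fin n)) : Measurable (areaKer lam η K M x y) :=
  (measurable_subKer_heatD hlam η K M x y).mul (measurable_xiDens hlam x).sqrt

lemma lusinKer_eq_areaKer (hn : 1 ≤ n) (hlam : ∀ j, -(1 / 2) < lam j) (η : Fin n → Fin 2) (K : ℕ)
    (M : Fin n → ℕ) (x : EuclideanSpace ℝ (Fin n)) {y : EuclideanSpace ℝ (Fin n)}
    (hy : y ∈ posOrthant n) {p : EuclideanSpace ℝ (Fin n) × ℝ} (hp : 0 < p.2) :
    lusinKer lam η K M x y p = areaKer lam η K M x y p := by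
  rw [lusinKer_eq hn hlam η K M hy x p hp, mul_assoc, sqrt_Xi_mul_indicator hp, areaKer]

lemma ae_coneMeasure (K : ℕ) (M : Fin n → ℕ) : ∀ᵐ p ∂(coneMeasure K M), p ∈ cone n :=
  (withDensity_absolutelyContinuous _ _).ae_le (ae_restrict_mem (measurableSet_cone n))

lemma sum_half_eq (K : ℕ) (M : Fin n → ℕ) :
    (K : ℝ) + 2 * ∑ j, (M j : ℝ) / 2 = K + (∑ j, M j : ℕ) := by
  rw [← Finset.sum_div, mul_div_cancel₀ _ two_ne_zero, Nat.cast_sum]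

/-- Pointwise size of the subordinated derivatives over the cone. -/
lemma subKer_heatD_le (hn : 1 ≤ n) (hlam : ∀ j, -(1 / 2) < lam j) (η : Fin n → Fin 2) (K : ℕ)
    (M : Fin n → ℕ) : ∃ C : ℝ, 0 < C ∧ ∀ x ∈ posOrthant n, ∀ w ∈ posOrthant n, ∀ y ∈ posOrthant n,
      ∀ t D : ℝ, 0 < t → 0 < D → ‖w - x‖ ≤ t + D → D ≤ 2 * (‖w - y‖ + t) →
      |subKer K (fun j => heatD (lam j) (η j) (M j)) t w y| ≤
        C * ((t + D) ^ (-(K + (∑ j, M j : ℕ) : ℝ)) / bulk lam x (t + D)) := by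
  obtain ⟨C, hC, h⟩ := subKer_le_of_close hn hlam K (κ := fun j => (M j : ℝ) / 2)
    (fun j => by positivity) fun j => heatClass_heatD (hlam j) (η j) (M j)
  refine ⟨C, hC, fun x hx w hw y hy t D ht hD h1 h2 => ?_⟩
  rw [← sum_half_eq]
  exact h t (t + D) x hx w hw y hy ht (by positivity) (by linarith [norm_nonneg (w - y)])
    fun j => (PiLp.norm_apply_le (w - x) j).trans h1

/-- The gain 1/(t+D) of the Lipschitz estimate is weakened to 1/D, so that the remaining profile in
t is the one of the size estimate. -/
lemma subKer_heatD_sub_le (hn : 1 ≤ n) (hlam : ∀ j, -(1 / 2) < lam j) (η : Fin n → Fin 2) (K : ℕ)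
    (M : Fin n → ℕ) : ∃ C : ℝ, 0 < C ∧ ∀ x ∈ posOrthant n, ∀ w ∈ posOrthant n, ∀ w' ∈ posOrthant n,
      ∀ y ∈ posOrthant n, ∀ y' ∈ posOrthant n, ∀ t D : ℝ, 0 < t → 0 < D →
      (∀ τ : ℝ, 0 ≤ τ → τ ≤ 1 → ‖w + τ • (w' - w) - x‖ ≤ t + D ∧
        D ≤ 2 * (‖w + τ • (w' - w) - (y + τ • (y' - y))‖ + t)) →
      |subKer K (fun j => heatD (lam j) (η j) (M j)) t w' y' -
          subKer K (fun j => heatD (lam j) (η j) (M j)) t w y| ≤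
        C * ((‖w' - w‖ + ‖y' - y‖) / D) *
          ((t + D) ^ (-(K + (∑ j, M j : ℕ) : ℝ)) / bulk lam x (t + D)) := by
  obtain ⟨C, hC, h⟩ := subKer_sub_le hn hlam K (κ := fun j => (M j : ℝ) / 2)
    (fun j => by positivity) fun j => heatClass_heatD (hlam j) (η j) (M j)
  refine ⟨C, hC, fun x hx w hw w' hw' y hy y' hy' t D ht hD h1 => ?_⟩
  have hR : 0 < t + D := by positivity
  have hb := bulk_pos (lam := lam) hx hR
  refine (h t (t + D) x hx w hw w' hw' y hy y' hy' ht hR fun τ h0 h2 => ?_).trans ?_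
  · obtain ⟨h3, h4⟩ := h1 τ h0 h2
    exact ⟨by linarith [norm_nonneg (w + τ • (w' - w) - (y + τ • (y' - y)))],
      fun j => (PiLp.norm_apply_le (w + τ • (w' - w) - x) j).trans h3⟩
  · rw [sum_half_eq, neg_add, Real.rpow_add hR, Real.rpow_neg_one]
    have h5 : (t + D)⁻¹ ≤ D⁻¹ := by gcongr; linarith
    calc _ ≤ C * (‖w' - w‖ + ‖y' - y‖) *
          ((t + D) ^ (-(K + (∑ j, M j : ℕ) : ℝ)) * D⁻¹ / bulk lam x (t + D)) := by gcongr
      _ = _ := by ring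

lemma le_norm_sub_add (a b : EuclideanSpace ℝ (Fin n)) : ‖a‖ ≤ ‖a + b‖ + ‖b‖ := by
  simpa using norm_sub_le (a + b) b

/-- Size of the kernel. -/
theorem eLpNorm_areaKer_le (hn : 1 ≤ n) (hlam : ∀ j, -(1 / 2) < lam j) (η : Fin n → Fin 2) (K : ℕ)
    (M : Fin n → ℕ) (hKM : 0 < (∑ j, M j) + K) : ∃ C : ℝ, 0 < C ∧
      ∀ x ∈ posOrthant n, ∀ y ∈ posOrthant n, x ≠ y →
      eLpNorm (fun p => (areaKer lam η K M x y p : ℂ)) 2 (coneMeasure K M) ≤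
        ENNReal.ofReal (C * (1 / bulk lam x (dist x y))) := by
  obtain ⟨C, hC, hQ⟩ := subKer_heatD_le hn hlam η K M
  -- Used with γ = 0, as Ξ has mass at most one over each ball.
  obtain ⟨C', hC', H⟩ := eLpNorm_coneMeasure_le hn hlam K M hKM le_rfl (by norm_num)
  refine ⟨C' * C, by positivity, fun x hx y hy hxy => ?_⟩
  have hD : 0 < dist x y := dist_pos.2 hxy
  have h := H x hx (dist x y) C hD hC.le (areaKer lam η K M x y)
    (fun p => C ^ 2 * xiDens lam p.2 x p.1) (measurable_areaKer hlam η K M x y)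
    (fun p hp => ?_) (fun t ht => ?_)
  · simpa [mul_assoc] using h
  · obtain ⟨ht, hz⟩ := hp
    have hξ := xiDens_nonneg hlam ht hx p.1
    refine ⟨by positivity, ?_⟩
    by_cases hw : x + p.1 ∈ posOrthant n
    · rw [Real.sqrt_mul (by positivity), Real.sqrt_sq hC.le, areaKer, abs_mul,
        abs_of_nonneg (Real.sqrt_nonneg _)]
      have h1 := hQ x hx _ hw y hy p.2 (dist x y) ht hD (by simpa using by linarith) (by
        have := le_norm_sub_add (x - y) p.1
        rw [dist_eq_norm, add_sub_right_comm]
        linarith [norm_nonneg (x - y + p.1)])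
      calc _ ≤ _ * √(xiDens lam p.2 x p.1) := mul_le_mul_of_nonneg_right h1 (Real.sqrt_nonneg _)
        _ = _ := by ring
    · simp [areaKer, xiDens_of_notMem hw]
  · simp only [ENNReal.ofReal_mul (sq_nonneg C), mul_zero, neg_zero, Real.rpow_zero,
      mul_one]
    rw [lintegral_const_mul' _ _ ENNReal.ofReal_ne_top]
    exact mul_le_of_le_one_right' (lintegral_xiDens_le hlam ht hx)

/-- It weakens bounds of order one to bounds of order γ. -/
lemma div_le_rpow {a b γ : ℝ} (ha : 0 ≤ a) (hab : a ≤ b) (hb : 0 < b) (hγ1 : γ ≤ 1) :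
    a / b ≤ (a / b) ^ γ := by
  have h1 : a / b ≤ 1 := (div_le_one hb).2 hab
  rcases ha.eq_or_lt with rfl | ha
  · rw [zero_div]; exact Real.rpow_nonneg le_rfl _
  · calc a / b = (a / b) ^ (1 : ℝ) := (Real.rpow_one _).symm
      _ ≤ _ := Real.rpow_le_rpow_of_exponent_ge (by positivity) h1 hγ1

/-- Smoothness of the kernel in the second variable. -/
theorem eLpNorm_areaKer_sub_right_le (hn : 1 ≤ n) (hlam : ∀ j, -(1 / 2) < lam j)
    (η : Fin n → Fin 2) (K : ℕ) (M : Fin n → ℕ) (hKM : 0 < (∑ j, M j) + K) : ∃ C : ℝ, 0 < C ∧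
      ∀ x ∈ posOrthant n, ∀ y ∈ posOrthant n, ∀ y' ∈ posOrthant n, 2 * dist y y' < dist x y →
      eLpNorm (fun p => ((areaKer lam η K M x y p - areaKer lam η K M x y' p : ℝ) : ℂ)) 2
        (coneMeasure K M) ≤
        ENNReal.ofReal (C * (dist y y' / dist x y * (1 / bulk lam x (dist x y)))) := by
  obtain ⟨C, hC, hQ⟩ := subKer_heatD_sub_le hn hlam η K M
  obtain ⟨C', hC', H⟩ := eLpNorm_coneMeasure_le hn hlam K M hKM le_rfl (by norm_num)
  refine ⟨C' * C, by positivity, fun x hx y hy y' hy' hyy => ?_⟩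
  have hD : 0 < dist x y := lt_of_le_of_lt (by positivity) hyy
  set B := C * (dist y y' / dist x y) with hB
  have hB0 : 0 ≤ B := by positivity
  have h := H x hx (dist x y) B hD hB0
    (fun p => areaKer lam η K M x y p - areaKer lam η K M x y' p)
    (fun p => B ^ 2 * xiDens lam p.2 x p.1)
    ((measurable_areaKer hlam η K M x y).sub (measurable_areaKer hlam η K M x y'))
    (fun p hp => ?_) (fun t ht => ?_)
  · simpa [hB, mul_assoc] using h
  · obtain ⟨ht, hz⟩ := hp
    have hξ := xiDens_nonneg hlam ht hx p.1
    refine ⟨by positivity, ?_⟩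
    by_cases hw : x + p.1 ∈ posOrthant n
    · rw [Real.sqrt_mul (by positivity), Real.sqrt_sq hB0, areaKer, areaKer, ← sub_mul, abs_mul,
        abs_of_nonneg (Real.sqrt_nonneg _), abs_sub_comm]
      -- Along the segment the displacement of x - y is less than t + D/2, which leaves D ≤ 2(|x + z
      -- - y_τ| + t).
      have h1 := hQ x hx _ hw _ hw y hy y' hy' p.2 (dist x y) ht hD fun τ h0 h1 => by
        simp only [sub_self, smul_zero, add_zero, add_sub_cancel_left]
        refine ⟨by linarith, ?_⟩
        have e : x + p.1 - (y + τ • (y' - y)) = x - y + (p.1 - τ • (y' - y)) := by abel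
        have h2 := le_norm_sub_add (x - y) (p.1 - τ • (y' - y))
        have h3 := norm_sub_le p.1 (τ • (y' - y))
        have h4 : ‖τ • (y' - y)‖ ≤ dist y y' := by
          rw [norm_smul, Real.norm_of_nonneg h0, dist_comm, dist_eq_norm]
          exact mul_le_of_le_one_left (norm_nonneg _) h1
        rw [e]
        rw [dist_eq_norm x y] at hyy ⊢
        linarith
      rw [sub_self, norm_zero, zero_add, ← dist_eq_norm, dist_comm y' y] at h1
      calc _ ≤ _ * √(xiDens lam p.2 x p.1) := mul_le_mul_of_nonneg_right h1 (Real.sqrt_nonneg _)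
        _ = _ := by ring
    · simp [areaKer, xiDens_of_notMem hw]
  · simp only [ENNReal.ofReal_mul (sq_nonneg B), mul_zero, neg_zero, Real.rpow_zero,
      mul_one]
    rw [lintegral_const_mul' _ _ ENNReal.ofReal_ne_top]
    exact mul_le_of_le_one_right' (lintegral_xiDens_le hlam ht hx)

/-- Smoothness of the kernel in the first variable. -/
theorem eLpNorm_areaKer_sub_left_le (hn : 1 ≤ n) (hlam : ∀ j, -(1 / 2) < lam j)
    (η : Fin n → Fin 2) (K : ℕ) (M : Fin n → ℕ) (hKM : 0 < (∑ j, M j) + K) {γ : ℝ} (hγ0 : 0 ≤ γ)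
    (hγ1 : γ ≤ 1 / 2) (hγ : ∀ k, γ ≤ lam k + 1 / 2) : ∃ C : ℝ, 0 < C ∧
      ∀ x ∈ posOrthant n, ∀ x' ∈ posOrthant n, ∀ y ∈ posOrthant n, 2 * dist x x' < dist x y →
      eLpNorm (fun p => ((areaKer lam η K M x y p - areaKer lam η K M x' y p : ℝ) : ℂ)) 2
        (coneMeasure K M) ≤
        ENNReal.ofReal (C * ((dist x x' / dist x y) ^ γ * (1 / bulk lam x (dist x y)))) := by
  obtain ⟨C₁, hC₁, hQ⟩ := subKer_heatD_le hn hlam η K M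
  obtain ⟨C₂, hC₂, hQs⟩ := subKer_heatD_sub_le hn hlam η K M
  obtain ⟨C₃, hC₃, H⟩ := eLpNorm_coneMeasure_le hn hlam K M hKM le_rfl (by norm_num)
  obtain ⟨C₄, hC₄, Hγ⟩ := eLpNorm_coneMeasure_le hn hlam K M hKM hγ0 hγ1
  -- The conditions δ ≤ 1 and δ ≤ 2 lam_k + 1 at δ = 2γ are the bounds imposed on γ.
  obtain ⟨C₅, hC₅, hΞ⟩ := lintegral_abs_xiDens_sub_le hlam (δ := 2 * γ) (by linarith) (by linarith)
    fun j => by linarith [hγ j]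
  refine ⟨C₃ * C₂ + C₄ * (C₁ * √C₅), by positivity, fun x hx x' hx' y hy hxx => ?_⟩
  have hD : 0 < dist x y := lt_of_le_of_lt (by positivity) hxx
  set D := dist x y with hDdef
  set h := dist x x' with hh
  have hh0 : 0 ≤ h := dist_nonneg
  have hbD := bulk_pos (lam := lam) hx hD
  set Q := fun (w : EuclideanSpace ℝ (Fin n)) (t : ℝ) =>
    subKer K (fun j => heatD (lam j) (η j) (M j)) t w y with hQdef
  -- geometry of the translates of the segment from `x` to `x'`
  have hgeo : ∀ z t, ‖z‖ < t → ∀ τ : ℝ, 0 ≤ τ → τ ≤ 1 →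
      ‖x + z + τ • (x' - x) - x‖ ≤ t + D ∧ D ≤ 2 * (‖x + z + τ • (x' - x) - y‖ + t) := by
    intro z t hz τ h0 h1
    have h4 : ‖τ • (x' - x)‖ ≤ h := by
      rw [norm_smul, Real.norm_of_nonneg h0, hh, dist_comm, dist_eq_norm]
      exact mul_le_of_le_one_left (norm_nonneg _) h1
    have h3 := norm_add_le z (τ • (x' - x))
    have e1 : x + z + τ • (x' - x) - x = z + τ • (x' - x) := by abel
    have e2 : x + z + τ • (x' - x) - y = x - y + (z + τ • (x' - x)) := by abel
    rw [e1, e2]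
    have h2 := le_norm_sub_add (x - y) (z + τ • (x' - x))
    have e3 : D = ‖x - y‖ := dist_eq_norm x y
    constructor <;> linarith
  have hgeo0 : ∀ z t, ‖z‖ < t → ‖x + z - x‖ ≤ t + D ∧ D ≤ 2 * (‖x + z - y‖ + t) :=
    fun z t hz => by simpa using hgeo z t hz 0 le_rfl zero_le_one
  have hgeo1 : ∀ z t, ‖z‖ < t → ‖x' + z - x‖ ≤ t + D ∧ D ≤ 2 * (‖x' + z - y‖ + t) :=
    fun z t hz => by
      have := hgeo z t hz 1 zero_le_one le_rfl
      rwa [one_smul, show x + z + (x' - x) = x' + z by abel] at this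
  set S : Set (EuclideanSpace ℝ (Fin n) × ℝ) := {p | x' + p.1 ∈ posOrthant n} with hS
  have hSm : MeasurableSet S :=
    ((isOpen_posOrthant n).preimage (by fun_prop)).measurableSet
  set f := fun p => areaKer lam η K M x y p - areaKer lam η K M x' y p with hf
  have hfm : Measurable f :=
    (measurable_areaKer hlam η K M x y).sub (measurable_areaKer hlam η K M x' y)
  -- The part with a difference of kernels. The restriction to S is needed because the kernel is
  -- controlled only inside the orthant. What remains is a kernel times a difference of roots: at x'
  -- + z on S, and at x + z off S, where the density of x' vanishes.
  set f₁ : EuclideanSpace ℝ (Fin n) × ℝ → ℝ := S.indicator fun p =>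
    (Q (x + p.1) p.2 - Q (x' + p.1) p.2) * √(xiDens lam p.2 x p.1) with hf₁
  have hf₁m : Measurable f₁ := (((measurable_subKer_heatD hlam η K M x y).sub
    (measurable_subKer_heatD hlam η K M x' y)).mul (measurable_xiDens hlam x).sqrt).indicator hSm
  have hest₁ : eLpNorm (fun p => (f₁ p : ℂ)) 2 (coneMeasure K M) ≤
      ENNReal.ofReal (C₃ * (C₂ * (h / D) * (D ^ (-(0 : ℝ)) / bulk lam x D))) := by
    have hB0 : 0 ≤ C₂ * (h / D) := by positivity
    refine H x hx D _ hD hB0 f₁ (fun p => (C₂ * (h / D)) ^ 2 * xiDens lam p.2 x p.1) hf₁m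
      (fun p hp => ?_) (fun t ht => ?_)
    · obtain ⟨ht, hz⟩ := hp
      have hξ := xiDens_nonneg hlam ht hx p.1
      have hb := bulk_pos (lam := lam) hx (add_pos ht hD)
      refine ⟨by positivity, ?_⟩
      rw [Real.sqrt_mul (by positivity), Real.sqrt_sq hB0]
      by_cases hw' : x' + p.1 ∈ posOrthant n
      · rw [hf₁, indicator_of_mem (by exact hw')]
        by_cases hw : x + p.1 ∈ posOrthant n
        · rw [abs_mul, abs_of_nonneg (Real.sqrt_nonneg _), abs_sub_comm]
          have h1 := hQs x hx _ hw _ hw' y hy y hy p.2 D ht hD fun τ h0 h1 => by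
            simpa using hgeo p.1 p.2 hz τ h0 h1
          rw [sub_self, norm_zero, add_zero, add_sub_add_right_eq_sub, ← dist_eq_norm,
            dist_comm x' x] at h1
          calc _ ≤ _ * √(xiDens lam p.2 x p.1) :=
                mul_le_mul_of_nonneg_right h1 (Real.sqrt_nonneg _)
            _ = _ := by ring
        · simp [xiDens_of_notMem hw]
      · rw [hf₁, indicator_of_notMem (by exact hw'), abs_zero]
        have : 0 < p.2 + D := by positivity
        positivity
    · simp only [ENNReal.ofReal_mul (sq_nonneg (C₂ * (h / D))), mul_zero, neg_zero, Real.rpow_zero,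
        mul_one]
      rw [lintegral_const_mul' _ _ ENNReal.ofReal_ne_top]
      exact mul_le_of_le_one_right' (lintegral_xiDens_le hlam ht hx)
  -- The L¹ modulus of the densities is C₅ (h/t)^(2γ), hence the amplitude C₁ √C₅ h^γ and the
  -- singular power t^(-2γ) in the cone estimate.
  have hest₂ : eLpNorm (fun p => ((f p - f₁ p : ℝ) : ℂ)) 2 (coneMeasure K M) ≤
      ENNReal.ofReal (C₄ * (C₁ * √C₅ * h ^ γ * (D ^ (-γ) / bulk lam x D))) := by
    refine Hγ x hx D _ hD (by positivity) (fun p => f p - f₁ p)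
      (fun p => C₁ ^ 2 * (√(xiDens lam p.2 x p.1) - √(xiDens lam p.2 x' p.1)) ^ 2)
      (hfm.sub hf₁m) (fun p hp => ?_) (fun t ht => ?_)
    · obtain ⟨ht, hz⟩ := hp
      refine ⟨by positivity, ?_⟩
      rw [Real.sqrt_mul (by positivity), Real.sqrt_sq hC₁.le, Real.sqrt_sq_eq_abs]
      have hcase : ∀ w ∈ posOrthant n, ‖w - x‖ ≤ p.2 + D ∧ D ≤ 2 * (‖w - y‖ + p.2) →
          f p - f₁ p = Q w p.2 * (√(xiDens lam p.2 x p.1) - √(xiDens lam p.2 x' p.1)) →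
          |f p - f₁ p| ≤ (p.2 + D) ^ (-(K + (∑ j, M j : ℕ) : ℝ)) / bulk lam x (p.2 + D) *
            (C₁ * |√(xiDens lam p.2 x p.1) - √(xiDens lam p.2 x' p.1)|) := by
        intro w hw hg he
        rw [he, abs_mul]
        calc _ ≤ _ * |√(xiDens lam p.2 x p.1) - √(xiDens lam p.2 x' p.1)| :=
              mul_le_mul_of_nonneg_right (hQ x hx w hw y hy p.2 D ht hD hg.1 hg.2) (abs_nonneg _)
          _ = _ := by ring
      by_cases hw' : x' + p.1 ∈ posOrthant n
      · refine hcase _ hw' (hgeo1 p.1 p.2 hz) ?_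
        rw [hf₁, indicator_of_mem (by exact hw')]
        simp only [hf, areaKer, hQdef]
        ring
      · have hz1 : f₁ p = 0 := indicator_of_notMem (by exact hw') _
        by_cases hw : x + p.1 ∈ posOrthant n
        · refine hcase _ hw (hgeo0 p.1 p.2 hz) ?_
          rw [hz1, xiDens_of_notMem hw']
          simp [hf, areaKer, hQdef, xiDens_of_notMem hw']
        · rw [hz1]
          simp [hf, areaKer, xiDens_of_notMem hw, xiDens_of_notMem hw']
    · simp only [ENNReal.ofReal_mul (sq_nonneg C₁)]
      rw [lintegral_const_mul' _ _ ENNReal.ofReal_ne_top]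
      have h1 : ∫⁻ z in {z : EuclideanSpace ℝ (Fin n) | ‖z‖ < t},
          ENNReal.ofReal ((√(xiDens lam t x z) - √(xiDens lam t x' z)) ^ 2) ≤
          ENNReal.ofReal (C₅ * (h / t) ^ (2 * γ)) := by
        rw [hh, dist_eq_norm]
        exact (lintegral_mono fun z => ENNReal.ofReal_le_ofReal (sq_sqrt_sub_sqrt_le
          (xiDens_nonneg hlam ht hx z) (xiDens_nonneg hlam ht hx' z))).trans (hΞ t ht x hx x' hx')
      calc _ ≤ ENNReal.ofReal (C₁ ^ 2) * ENNReal.ofReal (C₅ * (h / t) ^ (2 * γ)) := by gcongr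
        _ = _ := by
          rw [← ENNReal.ofReal_mul (by positivity)]
          congr 1
          have e : (h ^ γ) ^ 2 = h ^ (2 * γ) := by
            rw [← Real.rpow_mul_natCast hh0]; congr 1; push_cast; ring
          rw [Real.div_rpow hh0 ht.le, Real.rpow_neg ht.le, mul_pow, mul_pow, Real.sq_sqrt hC₅.le, e]
          ring
  have hsum : eLpNorm (fun p => (f p : ℂ)) 2 (coneMeasure K M) ≤
      eLpNorm (fun p => (f₁ p : ℂ)) 2 (coneMeasure K M) +
        eLpNorm (fun p => ((f p - f₁ p : ℝ) : ℂ)) 2 (coneMeasure K M) := by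
    have e : (fun p => (f p : ℂ)) = (fun p => (f₁ p : ℂ)) + fun p => ((f p - f₁ p : ℝ) : ℂ) := by
      ext p; simp
    rw [e]
    exact eLpNorm_add_le (Complex.measurable_ofReal.comp hf₁m).aestronglyMeasurable
      (Complex.measurable_ofReal.comp (hfm.sub hf₁m)).aestronglyMeasurable (by norm_num)
  refine hsum.trans ((add_le_add hest₁ hest₂).trans ?_)
  rw [← ENNReal.ofReal_add (by positivity) (by positivity)]
  refine ENNReal.ofReal_le_ofReal ?_
  have h1 : h / D ≤ (h / D) ^ γ := div_le_rpow hh0 (by linarith) hD (by linarith)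
  have h2 : h ^ γ * D ^ (-γ) = (h / D) ^ γ := by
    rw [Real.div_rpow hh0 hD.le, Real.rpow_neg hD.le, div_eq_mul_inv]
  rw [neg_zero, Real.rpow_zero]
  calc _ = C₃ * (C₂ * (h / D) * (1 / bulk lam x D)) +
        C₄ * (C₁ * √C₅) * (h ^ γ * D ^ (-γ)) * (1 / bulk lam x D) := by ring
    _ ≤ C₃ * (C₂ * (h / D) ^ γ * (1 / bulk lam x D)) +
        C₄ * (C₁ * √C₅) * (h / D) ^ γ * (1 / bulk lam x D) := by rw [h2]; gcongr
    _ = _ := by ring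

/-- The kernel of the area integral as a function with values in `L²` over the cone. -/
def areaL2 (lam : Fin n → ℝ) (η : Fin n → Fin 2) (K : ℕ) (M : Fin n → ℕ)
    (x y : EuclideanSpace ℝ (Fin n)) : coneL2 K M := by
  classical
  -- The default 0 is never used for distinct points of the orthant, by `memLp_areaKer`.
  exact if h : MemLp (fun p => (areaKer lam η K M x y p : ℂ)) 2 (coneMeasure K M) then
    h.toLp _ else 0

lemma norm_areaL2_sub_le {η : Fin n → Fin 2} {K : ℕ} {M : Fin n → ℕ}
    {x y x' y' : EuclideanSpace ℝ (Fin n)} {A : ℝ} (hA : 0 ≤ A)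
    (h : MemLp (fun p => (areaKer lam η K M x y p : ℂ)) 2 (coneMeasure K M))
    (h' : MemLp (fun p => (areaKer lam η K M x' y' p : ℂ)) 2 (coneMeasure K M))
    (hle : eLpNorm (fun p => ((areaKer lam η K M x y p - areaKer lam η K M x' y' p : ℝ) : ℂ)) 2
      (coneMeasure K M) ≤ ENNReal.ofReal A) :
    ‖areaL2 lam η K M x y - areaL2 lam η K M x' y'‖ ≤ A := by
  rw [areaL2, areaL2, dif_pos h, dif_pos h', ← MemLp.toLp_sub, Lp.norm_toLp]
  refine ENNReal.toReal_le_of_le_ofReal hA (le_trans (le_of_eq ?_) hle)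
  congr 1
  ext p
  simp

lemma memLp_areaKer (hn : 1 ≤ n) (hlam : ∀ j, -(1 / 2) < lam j) (η : Fin n → Fin 2) (K : ℕ)
    (M : Fin n → ℕ) (hKM : 0 < (∑ j, M j) + K) {x y : EuclideanSpace ℝ (Fin n)}
    (hx : x ∈ posOrthant n) (hy : y ∈ posOrthant n) (hxy : x ≠ y) :
    MemLp (fun p => (areaKer lam η K M x y p : ℂ)) 2 (coneMeasure K M) := by
  obtain ⟨C, -, h⟩ := eLpNorm_areaKer_le hn hlam η K M hKM
  exact ⟨(Complex.measurable_ofReal.comp (measurable_areaKer hlam η K M x y)).aestronglyMeasurable,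
    (h x hx y hy hxy).trans_lt ENNReal.ofReal_lt_top⟩

theorem standardEstimates_areaL2 (hn : 1 ≤ n) (hlam : ∀ j, -(1 / 2) < lam j) (η : Fin n → Fin 2)
    (K : ℕ) (M : Fin n → ℕ) (hKM : 0 < (∑ j, M j) + K) {γ : ℝ} (hγ0 : 0 ≤ γ) (hγ1 : γ ≤ 1 / 2)
    (hγ : ∀ k, γ ≤ lam k + 1 / 2) : StandardEstimates lam γ (areaL2 lam η K M) := by
  obtain ⟨C₀, hC₀, hw⟩ := wPlus_real_posBall_le hlam
  have hcmp : ∀ x ∈ posOrthant n, ∀ r, 0 < r →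
      1 / bulk lam x r ≤ C₀ * (1 / (wPlus lam).real (posBall x r)) := fun x hx r hr => by
    have h1 := wPlus_real_posBall_pos hlam hx hr
    have h2 := bulk_pos (lam := lam) hx hr
    rw [mul_one_div, div_le_div_iff₀ h2 h1, one_mul]
    exact hw x hx r hr
  have hmem := @memLp_areaKer n lam hn hlam η K M hKM
  refine ⟨?_, ?_, ?_⟩
  · obtain ⟨C, hC, h⟩ := eLpNorm_areaKer_le hn hlam η K M hKM
    refine ⟨C * C₀, by positivity, fun x hx y hy hxy => ?_⟩
    have hD := dist_pos.2 hxy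
    have hb := bulk_pos (lam := lam) hx hD
    rw [areaL2, dif_pos (hmem hx hy hxy), Lp.norm_toLp]
    refine (ENNReal.toReal_le_of_le_ofReal (by positivity) (h x hx y hy hxy)).trans ?_
    rw [mul_assoc]
    exact mul_le_mul_of_nonneg_left (hcmp x hx _ hD) hC.le
  · obtain ⟨C, hC, h⟩ := eLpNorm_areaKer_sub_left_le hn hlam η K M hKM hγ0 hγ1 hγ
    refine ⟨C * C₀, by positivity, fun x hx x' hx' y hy hxx => ?_⟩
    have hD : 0 < dist x y := lt_of_le_of_lt (by positivity) hxx
    have hD' : 0 < dist x' y := by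
      have := dist_triangle x x' y
      linarith [dist_nonneg (x := x) (y := x')]
    have hb := bulk_pos (lam := lam) hx hD
    refine (norm_areaL2_sub_le (by positivity) (hmem hx hy (dist_pos.1 hD))
      (hmem hx' hy (dist_pos.1 hD')) (h x hx x' hx' y hy hxx)).trans ?_
    calc _ ≤ C * ((dist x x' / dist x y) ^ γ *
          (C₀ * (1 / (wPlus lam).real (posBall x (dist x y))))) := by
          gcongr; exact hcmp x hx _ hD
      _ = _ := by ring
  · obtain ⟨C, hC, h⟩ := eLpNorm_areaKer_sub_right_le hn hlam η K M hKM
    refine ⟨C * C₀, by positivity, fun x hx y hy y' hy' hyy => ?_⟩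
    have hD : 0 < dist x y := lt_of_le_of_lt (by positivity) hyy
    have hd0 : 0 ≤ dist y y' := dist_nonneg
    have hD' : 0 < dist x y' := by
      have := dist_triangle x y' y
      rw [dist_comm y' y] at this
      linarith
    have hb := bulk_pos (lam := lam) hx hD
    refine (norm_areaL2_sub_le (by positivity) (hmem hx hy (dist_pos.1 hD))
      (hmem hx hy' (dist_pos.1 hD')) (h x hx y hy y' hy' hyy)).trans ?_
    calc _ ≤ C * ((dist y y' / dist x y) ^ γ *
          (C₀ * (1 / (wPlus lam).real (posBall x (dist x y))))) := by
          gcongr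
          · exact div_le_rpow hd0 (by linarith) hD (by linarith)
          · exact hcmp x hx _ hD
      _ = _ := by ring

end DunklBessel

end

theorem proposition2p8 {n : ℕ} (hn : 1 ≤ n) (lam : Fin n → ℝ) (hlam : ∀ j, -(1 / 2) < lam j)
    (η : Fin n → Fin 2) (K : ℕ) (M : Fin n → ℕ) (hKM : 0 < (∑ j, M j) + K) :
    ∃ S : EuclideanSpace ℝ (Fin n) → EuclideanSpace ℝ (Fin n) → coneL2 K M,
      (∀ x ∈ posOrthant n, ∀ y ∈ posOrthant n, x ≠ y →
        S x y =ᵐ[coneMeasure K M] fun p => (lusinKer lam η K M x y p : ℂ)) ∧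
      (∃ γ : ℝ, 0 < γ ∧ StandardEstimates lam γ S) ∧
      ∀ γ : ℝ, 0 < γ → γ ≤ 1 / 2 → (∀ k, γ < lam k + 1 / 2) → StandardEstimates lam γ S := by
  have hall : ∀ γ : ℝ, 0 < γ → γ ≤ 1 / 2 → (∀ k, γ < lam k + 1 / 2) →
      StandardEstimates lam γ (areaL2 lam η K M) := fun γ h0 h1 h2 =>
    standardEstimates_areaL2 hn hlam η K M hKM h0.le h1 fun k => (h2 k).le
  refine ⟨areaL2 lam η K M, fun x hx y hy hxy => ?_, ?_, hall⟩
  · have h := memLp_areaKer hn hlam η K M hKM hx hy hxy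
    rw [areaL2, dif_pos h]
    filter_upwards [h.coeFn_toLp, ae_coneMeasure K M] with p h1 h2
    rw [h1, lusinKer_eq_areaKer hn hlam η K M x hy h2.1]
  · obtain ⟨ε, hε, hε1, h⟩ := exists_pos_le_of_fin (fun k => lam k + 1 / 2)
      fun k => by linarith [hlam k]
    -- Halving ε gives both γ ≤ 1/2 and the strict inequality γ < lam_k + 1/2.
    exact ⟨ε / 2, by positivity, hall _ (by positivity) (by linarith) fun k => by linarith [h k]⟩
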